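/- **Theorem 2.1.** Let $\varepsilon_0'$ and $\varepsilon_i$, $i\in\mathbb Z$, be i.i.d. real random variables on a probability space $(\Omega,\mathcal A,\mathbb P)$, let $g$ be a real-valued measurable function of one-sided real sequences, and put $\xi_k=(\dots,\varepsilon_{k-1},\varepsilon_k)$, $X_k=g(\xi_k)$ for $k\in\mathbb Z$. Let $\xi_0^*=(\dots,\varepsilon_{-2},\varepsilon_{-1},\varepsilon_0')$ be $\xi_0$ with $\varepsilon_0$ replaced by $\varepsilon'_0$. Assume that the distribution function $F$ of $X_0$ has a square integrable density $f$ which is locally absolutely continuous with square integrable derivative $f'$, and that for all $k\ge1$ and almost every $\xi$ (with respect to the law of $\xi_0$) the conditional distribution of $X_k$ given $\xi_0=\xi$ has a Lebesgue density $f_k(\cdot\mid\xi_0=\xi)$. Let $$\varphi_k(\theta\mid\xi_0=\xi)=\mathbb E\big(e^{\sqrt{-1}\,\theta X_k}\mid \xi_0=\xi\big),\qquad \theta\in\mathbb R,$$ and let $\|Z\|=(\mathbb E|Z|^2)^{1/2}$. For $n\ge1$ and $b>0$ let $$F_n(x)=\frac1n\sum_{i=1}^n\mathbf 1_{X_i\le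 x},\qquad G_n(x)=\sqrt n\,[F_n(x)-F(x)],\qquad \Delta_n(b)=\sup_{|x-y|\le b}|G_n(x)-G_n(y)|.$$ Let $(b_n)_{n\ge1}$ be positive numbers with $b_n\to0$ and $\log n=O(nb_n)$. Assume that there is a constant $c_0>0$ such that $$\sup_{x\in\mathbb R} f_1(x\mid\xi_0)\le c_0\quad\text{almost surely},$$ and that $$\sum_{k=1}^\infty\Big[\int_{\mathbb R}(1+\theta^2)\,\|\varphi_k(\theta\mid\xi_0)-\varphi_k(\theta\mid\xi_0^*)\|^2\,d\theta\Big]^{1/2}<\infty .$$ Then, with $\iota(n)=(\log n)^{1/2}\log\log n$, $$\Delta_n(b_n)=O_{\mathrm{a.s.}}\big(\sqrt{b_n\log n}\big)+o_{\mathrm{a.s.}}\big(b_n\,\iota(n)\big)\qquad(n\to\infty),$$ that is, $\Delta_n(b_n)=U_n+V_n$ for random variables $U_n,V_n$ such that almost surely $U_n/\sqrt{b_n\log n}$ stays bounded as $n\to\infty$ (with a possibly random bound) and $V_n/(b_n\,\iota(n))\to0$. -/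

import Mathlib

open MeasureTheory ProbabilityTheory Filter Asymptotics
open scoped ENNReal Topology

noncomputable section

namespace CausalProcess

variable {Ω : Type*} [MeasurableSpace Ω]

/-- The variables `ε' , ε i (i ∈ ℤ)` as one family: `none` indexes `ε'`, `some i` indexes `ε i`. -/
def innovations (ε : ℤ → Ω → ℝ) (ε' : Ω → ℝ) : Option ℤ → Ω → ℝ
  | none => ε'
  | some i => ε i

/-- `ε'` and the `ε i`, `i ∈ ℤ`, are independent and identically distributed real random
variables on `(Ω, P)`. -/
structure IsIID (P : Measure Ω) (ε : ℤ → Ω → ℝ) (ε' : Ω → ℝ) : Prop where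
  measurable : ∀ i, Measurable (innovations ε ε' i)
  indep : iIndepFun (innovations ε ε') P
  ident : ∀ i j, IdentDistrib (innovations ε ε' i) (innovations ε ε' j) P P

/-- The history `ξ_k = (…, ε_{k-1}, ε_k)`, read backwards in time: entry `j` is `ε_{k-j}`. -/
def past (ε : ℤ → Ω → ℝ) (k : ℤ) (ω : Ω) : ℕ → ℝ := fun j => ε (k - j) ω

/-- The coupled history `ξ_k^*`: the history `ξ_k` with `ε_0` replaced by `ε'`. -/
def coupledPast (ε : ℤ → Ω → ℝ) (ε' : Ω → ℝ) (k : ℤ) : Ω → ℕ → ℝ :=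
  past (Function.update ε 0 ε') k

/-- The causal process `X_k = g(…, ε_{k-1}, ε_k)`. -/
def process (g : (ℕ → ℝ) → ℝ) (ε : ℤ → Ω → ℝ) (k : ℤ) (ω : Ω) : ℝ := g (past ε k ω)

/-- The cumulative distribution function `F` of `X_0` (hence, by stationarity, of every `X_k`). -/
def distFun (P : Measure Ω) (g : (ℕ → ℝ) → ℝ) (ε : ℤ → Ω → ℝ) (x : ℝ) : ℝ :=
  cdf (P.map (process g ε 0)) x

/-- The empirical distribution function `F_n(x) = n⁻¹ ∑_{i=1}^n 1{X_i ≤ x}`. -/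
def empFun (g : (ℕ → ℝ) → ℝ) (ε : ℤ → Ω → ℝ) (n : ℕ) (ω : Ω) (x : ℝ) : ℝ :=
  (n : ℝ)⁻¹ * ∑ i ∈ Finset.Icc 1 n, (Set.Iic x).indicator (fun _ => (1 : ℝ)) (process g ε i ω)

/-- The empirical process `G_n(x) = √n (F_n(x) - F(x))`. -/
def empDev (P : Measure Ω) (g : (ℕ → ℝ) → ℝ) (ε : ℤ → Ω → ℝ) (n : ℕ) (ω : Ω) (x : ℝ) : ℝ :=
  √(n : ℝ) * (empFun g ε n ω x - distFun P g ε x)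

/-- The modulus of continuity `Δ_n(b) = sup_{|x - y| ≤ b} |G_n(x) - G_n(y)|`. The supremum is
over a bounded set, since `|G_n| ≤ √n`. -/
def modulus (P : Measure Ω) (g : (ℕ → ℝ) → ℝ) (ε : ℤ → Ω → ℝ) (n : ℕ) (b : ℝ) (ω : Ω) : ℝ :=
  ⨆ p : {p : ℝ × ℝ // |p.1 - p.2| ≤ b}, |empDev P g ε n ω p.1.1 - empDev P g ε n ω p.1.2|

/-- The regular conditional distribution of `X_k` given `ξ_0`, as a kernel in the value of `ξ_0`. -/
def condLaw (P : Measure Ω) [IsFiniteMeasure P] (g : (ℕ → ℝ) → ℝ) (ε : ℤ → Ω → ℝ) (k : ℕ) :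
    Kernel (ℕ → ℝ) ℝ :=
  condDistrib (process g ε k) (past ε 0) P

/-- The conditional characteristic function `φ_k(θ | ξ_0 = ξ)`. -/
def condCharFun (P : Measure Ω) [IsFiniteMeasure P] (g : (ℕ → ℝ) → ℝ) (ε : ℤ → Ω → ℝ) (k : ℕ)
    (θ : ℝ) (ξ : ℕ → ℝ) : ℂ :=
  charFun (condLaw P g ε k ξ) θ

/-- `f` is a density (with respect to Lebesgue measure) of the measure `μ` on `ℝ`. -/
structure IsDensity (μ : Measure ℝ) (f : ℝ → ℝ) : Prop where
  measurable : Measurable f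
  nonneg : ∀ x, 0 ≤ f x
  eq_withDensity : μ = volume.withDensity (fun x => ENNReal.ofReal (f x))

/-- `f` is square integrable and is the indefinite integral of the square integrable `f'`. -/
structure HasSqIntegrableDeriv (f f' : ℝ → ℝ) : Prop where
  memLp : MemLp f 2 volume
  memLp_deriv : MemLp f' 2 volume
  integral_eq : ∀ x y, f y - f x = ∫ t in x..y, f' t

/-- The short-range dependence condition
`∑_{k ≥ 1} [∫ (1 + θ²) ‖φ_k(θ|ξ_0) - φ_k(θ|ξ_0^*)‖² dθ]^{1/2} < ∞`,
where `‖·‖` is the `L²(P)` norm. -/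
def ShortRange (P : Measure Ω) [IsFiniteMeasure P] (g : (ℕ → ℝ) → ℝ) (ε : ℤ → Ω → ℝ)
    (ε' : Ω → ℝ) : Prop :=
  ∑' k : ℕ, (∫⁻ θ : ℝ, ENNReal.ofReal (1 + θ ^ 2) *
    (eLpNorm (fun ω => condCharFun P g ε (k + 1) θ (past ε 0 ω)
      - condCharFun P g ε (k + 1) θ (coupledPast ε ε' 0 ω)) 2 P) ^ 2) ^ (1 / 2 : ℝ) < ∞

/-- `Z n = O_a.s.(r n)`: almost surely `Z n / r n` stays bounded (the bound may be random). -/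
def IsBigOAS (P : Measure Ω) (Z : ℕ → Ω → ℝ) (r : ℕ → ℝ) : Prop :=
  ∀ᵐ ω ∂P, (fun n => Z n ω) =O[atTop] r

/-- `Z n = o_a.s.(r n)`: almost surely `Z n / r n → 0`. -/
def IsLittleOAS (P : Measure Ω) (Z : ℕ → Ω → ℝ) (r : ℕ → ℝ) : Prop :=
  ∀ᵐ ω ∂P, (fun n => Z n ω) =o[atTop] r

/-- `ι(n) = (log n)^{1/2} log log n`. -/
def iota (n : ℕ) : ℝ := √(Real.log n) * Real.log (Real.log n)

end CausalProcess

end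

set_option linter.unusedSectionVars false

/-! The centred number of visits of `X_1, …, X_n` to an interval `I` splits into a martingale part,
the sum of `1{X_{i+1} ∈ I} - P(X_{i+1} ∈ I | ξ_i)`, and a drift, the sum of `P(X_{i+1} ∈ I | ξ_i) -
P(X_0 ∈ I)`. The martingale part gives the term of order `√(b_n log n)`, the drift the term `o(b_n
ι(n))`. Histories are treated as a stationary Markov chain which pushes a fresh innovation, so
conditioning on the past is integration over that innovation.

Martingale part. Its increments are bounded by 1, and their conditional variances are at most `c₀
|I|` because of the bound on `f_1`. A Freedman type inequality therefore controls one interval. To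
treat all intervals of length at most `b_n` at once, they are squeezed between intervals of a grid
of mesh `b_n / n` on the whole line. There are infinitely many of these, and no truncation is made:
`measure_le_abs_runSum` carries the factor `P(X_0 ∈ I)`, and these probabilities are summable over
the grid (`tsum_measure_gridIoc_le`). The factor arises because the Chernoff argument runs with `e^x
- 1 - x`, which vanishes at 0, in place of `e^x`. Borel-Cantelli concludes
(`IsIID.ae_eventually_visitMart_le`).

Drift. It is the integral over `I` of the sum of `f_1(· | ξ_i) - f`, whose transform is `charSum`. A
Sobolev bound, `norm_intervalIntegral_le_sqrt_energy`, estimates it by `|I|` times the root of the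
energy `∫ (1 + θ²) |charSum|² dθ`. The sum `charSum` is telescoped into layers, one for each
forecast horizon; each layer is a martingale in time, and Jensen's inequality bounds its increments
by the coupling distance in the dependence condition. Doob on every layer, Minkowski over the
layers, and the fact that the chain forgets its past give a maximal energy up to time `N` of mean at
most a constant times `N` (`IsIID.lintegral_maxEnergy_le`). Summing over dyadic times with weights
like `1 / (d log² d)` makes the energy `o(n ι(n)²)` almost surely. -/

namespace CausalProcess

/-! ### The stationary chain of histories -/

/-- The history obtained from `ξ` when the new innovation `e` arrives. -/
def push (e : ℝ) (ξ : ℕ → ℝ) : ℕ → ℝ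
  | 0 => e
  | n + 1 => ξ n

/-- The history `ξ` without its most recent innovation. -/
def pop (ξ : ℕ → ℝ) : ℕ → ℝ := fun n => ξ (n + 1)

@[simp] lemma pop_push (e : ℝ) (ξ : ℕ → ℝ) : pop (push e ξ) = ξ := rfl

lemma measurable_pop : Measurable pop :=
  measurable_pi_lambda _ fun n => measurable_pi_apply (n + 1)

lemma measurable_push : Measurable fun p : (ℕ → ℝ) × ℝ => push p.2 p.1 := by
  refine measurable_pi_lambda _ fun n => ?_
  cases n with
  | zero => exact measurable_snd
  | succ n => exact (measurable_pi_apply n).comp measurable_fst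

lemma measurable_push_left (ξ : ℕ → ℝ) : Measurable fun e => push e ξ :=
  measurable_push.comp measurable_prodMk_left

/-- `ρ` is stationary for the Markov chain which pushes independent innovations of law `ν`. -/
def HistoryLaw (ν : Measure ℝ) (ρ : Measure (ℕ → ℝ)) : Prop :=
  MeasurePreserving (fun p : (ℕ → ℝ) × ℝ => push p.2 p.1) (ρ.prod ν) ρ

section Chain

variable {ν : Measure ℝ} {ρ : Measure (ℕ → ℝ)} [IsProbabilityMeasure ν] [IsProbabilityMeasure ρ]

lemma HistoryLaw.lintegral_eq (h : HistoryLaw ν ρ) {F : (ℕ → ℝ) → ℝ≥0∞} (hF : Measurable F) :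
    ∫⁻ ξ, F ξ ∂ρ = ∫⁻ ξ, ∫⁻ e, F (push e ξ) ∂ν ∂ρ := by
  rw [← h.lintegral_comp hF, lintegral_prod]
  exact (hF.comp measurable_push).aemeasurable

lemma HistoryLaw.integrable_comp (h : HistoryLaw ν ρ) {E : Type*} [NormedAddCommGroup E]
    {F : (ℕ → ℝ) → E} (hF : Integrable F ρ) :
    Integrable (fun p : (ℕ → ℝ) × ℝ => F (push p.2 p.1)) (ρ.prod ν) :=
  h.integrable_comp_of_integrable hF

/-- Stationarity and Fubini together: this plays the role of the tower property, with the inner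
integral as conditional expectation given the previous history. -/
lemma HistoryLaw.integral_eq (h : HistoryLaw ν ρ) {E : Type*} [NormedAddCommGroup E]
    [NormedSpace ℝ E] {F : (ℕ → ℝ) → E} (hF : Integrable F ρ) :
    ∫ ξ, F ξ ∂ρ = ∫ ξ, ∫ e, F (push e ξ) ∂ν ∂ρ := by
  rw [← integral_prod _ (h.integrable_comp hF), ← h.map_eq,
    integral_map h.measurable.aemeasurable, h.map_eq]
  rw [h.map_eq]
  exact hF.aestronglyMeasurable

end Chain

/-! ### Partial sums along the chain -/

section RunSum

variable {E : Type*} [NormedAddCommGroup E]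

/-- The sum `d ξ + d (pop ξ) + ⋯` of `n` terms. -/
def runSum (d : (ℕ → ℝ) → E) : ℕ → (ℕ → ℝ) → E
  | 0, _ => 0
  | n + 1, ξ => runSum d n (pop ξ) + d ξ

lemma pop_past {Ω : Type*} (ε : ℤ → Ω → ℝ) (k : ℤ) (ω : Ω) :
    pop (past ε (k + 1) ω) = past ε k ω := by
  funext n; simp only [pop, past]; congr 1; push_cast; ring

lemma past_eq_push {Ω : Type*} (ε : ℤ → Ω → ℝ) (k : ℤ) (ω : Ω) :
    past ε (k + 1) ω = push (ε (k + 1) ω) (past ε k ω) := by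
  funext n
  cases n with
  | zero => simp [past, push]
  | succ n => simp only [push, past]; congr 1; push_cast; ring

/-- A sum along the trajectory is a function of its last history alone, so its law can be computed
under the stationary measure. -/
lemma runSum_past {Ω : Type*} (ε : ℤ → Ω → ℝ) (d : (ℕ → ℝ) → E) (j : ℤ) (n : ℕ) (ω : Ω) :
    runSum d n (past ε (j + n) ω) = ∑ i ∈ Finset.range n, d (past ε (j + i + 1) ω) := by
  induction n with
  | zero => simp [runSum]
  | succ n ih =>
    rw [Finset.sum_range_succ, ← ih, runSum]
    push_cast
    rw [← add_assoc, pop_past]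

lemma measurable_runSum [MeasurableSpace E] [MeasurableAdd₂ E] {d : (ℕ → ℝ) → E}
    (hd : Measurable d) (n : ℕ) : Measurable (runSum d n) := by
  induction n with
  | zero => exact measurable_const
  | succ n ih => exact (ih.comp measurable_pop).add hd

lemma norm_runSum_le {d : (ℕ → ℝ) → E} {C : ℝ} (hd : ∀ ξ, ‖d ξ‖ ≤ C) (n : ℕ) (ξ : ℕ → ℝ) :
    ‖runSum d n ξ‖ ≤ n * C := by
  induction n generalizing ξ with
  | zero => simp [runSum]
  | succ n ih =>
    rw [runSum]; push_cast
    linarith [norm_add_le (runSum d n (pop ξ)) (d ξ), ih (pop ξ), hd ξ]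

end RunSum

/-! ### A Freedman type inequality with the probability of the set as a factor -/

/-- The function `x ↦ e^x - 1 - x`. -/
noncomputable def expRem (x : ℝ) : ℝ := Real.exp x - 1 - x

lemma expRem_nonneg (x : ℝ) : 0 ≤ expRem x := by
  unfold expRem; linarith [Real.add_one_le_exp x]

/-- Equivalent to `2 x ≤ e^x`. It replaces the factor `e^a` of a Chernoff step by a constant plus a
multiple of `expRem a`, which closes the recursion in `integral_expRem_runSum_le`. -/
lemma exp_le_expRem (x : ℝ) : Real.exp x ≤ 2 + 2 * expRem x := by
  have h2 : 2 * x ≤ Real.exp x := by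
    rcases le_or_gt x 0 with h | h
    · linarith [Real.exp_pos x]
    · have h1 := Real.quadratic_le_exp_of_nonneg h.le
      nlinarith [sq_nonneg (x - 1)]
  unfold expRem; linarith

lemma exp_div_four_le_expRem {x : ℝ} (hx : 2 ≤ x) : Real.exp x / 4 ≤ expRem x := by
  have h1 := Real.quadratic_le_exp_of_nonneg (by linarith : 0 ≤ x)
  have h2 := exp_le_expRem x
  nlinarith

lemma exp_le_quadratic {x : ℝ} (hx : |x| ≤ 1) : Real.exp x ≤ 1 + x + x ^ 2 := by
  have := Real.abs_exp_sub_one_sub_id_le hx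
  linarith [le_abs_self (Real.exp x - 1 - x)]

section Freedman

/-- The conditional probability that the next history lies in `A`. -/
noncomputable def nextProb (ν : Measure ℝ) (A : Set (ℕ → ℝ)) (ξ : ℕ → ℝ) : ℝ :=
  ν.real ((fun e => push e ξ) ⁻¹' A)

/-- The centred indicator of `A`. -/
noncomputable def centredInd (ν : Measure ℝ) (A : Set (ℕ → ℝ)) (ξ : ℕ → ℝ) : ℝ :=
  A.indicator 1 ξ - nextProb ν A (pop ξ)

variable {ν : Measure ℝ} {ρ : Measure (ℕ → ℝ)} [IsProbabilityMeasure ν] [IsProbabilityMeasure ρ]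
  {A : Set (ℕ → ℝ)}

lemma nextProb_nonneg (ξ : ℕ → ℝ) : 0 ≤ nextProb ν A ξ := measureReal_nonneg

lemma nextProb_le_one (ξ : ℕ → ℝ) : nextProb ν A ξ ≤ 1 := measureReal_le_one

lemma measurable_nextProb (hA : MeasurableSet A) : Measurable (nextProb ν A) :=
  (measurable_measure_prodMk_left (measurable_push hA)).ennreal_toReal

lemma measurable_centredInd (hA : MeasurableSet A) : Measurable (centredInd ν A) :=
  (measurable_one.indicator hA).sub ((measurable_nextProb hA).comp measurable_pop)

lemma abs_centredInd_le (ξ : ℕ → ℝ) : |centredInd ν A ξ| ≤ 1 := by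
  have h1 := nextProb_nonneg (ν := ν) (A := A) (pop ξ)
  have h2 := nextProb_le_one (ν := ν) (A := A) (pop ξ)
  unfold centredInd
  by_cases h : ξ ∈ A <;> simp only [h, Set.indicator_of_mem, Set.indicator_of_notMem,
    not_false_eq_true, Pi.one_apply] <;> rw [abs_le] <;> constructor <;> linarith

/-- By `e^y ≤ 1 + y + y²` for `|y| ≤ 1`. The increment is centred, so its linear term integrates to
0, and its variance is `p (1 - p) ≤ p`. -/
lemma integral_expRem_step (hA : MeasurableSet A) {l : ℝ} (hl : |l| ≤ 1) (a : ℝ) (ξ : ℕ → ℝ) :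
    ∫ e, expRem (a + l * centredInd ν A (push e ξ)) ∂ν ≤
      expRem a + Real.exp a * (l ^ 2 * nextProb ν A ξ) := by
  set p := nextProb ν A ξ with hp
  have hp0 : 0 ≤ p := nextProb_nonneg ξ
  set h : ℝ → ℝ := ((fun e => push e ξ) ⁻¹' A).indicator 1 with hh
  have hB : MeasurableSet ((fun e => push e ξ) ⁻¹' A) := measurable_push_left ξ hA
  have hint : ∫ e, h e ∂ν = p := by rw [hh, integral_indicator_one hB]; rfl
  have hhi : Integrable h ν := (integrable_const (1 : ℝ)).indicator hB
  have hc : ∀ e, centredInd ν A (push e ξ) = h e - p := fun e => rfl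
  have hbd : ∀ e, expRem (a + l * centredInd ν A (push e ξ)) ≤
      (Real.exp a * (1 - l * p + l ^ 2 * p ^ 2) - 1 - a + l * p) +
        (Real.exp a * (l + l ^ 2 * (1 - 2 * p)) - l) * h e := by
    intro e
    have h1 : |l * centredInd ν A (push e ξ)| ≤ 1 := by
      rw [abs_mul]; exact mul_le_one₀ hl (abs_nonneg _) (abs_centredInd_le _)
    have h2 := mul_le_mul_of_nonneg_left (exp_le_quadratic h1) (Real.exp_pos a).le
    rw [← Real.exp_add, hc] at h2
    have hsq : h e ^ 2 = h e := by
      rw [hh]; by_cases he : e ∈ (fun e => push e ξ) ⁻¹' A <;> simp [he]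
    unfold expRem
    rw [hc]
    have : Real.exp a * (1 + l * (h e - p) + (l * (h e - p)) ^ 2) =
      Real.exp a * (1 + l * (h e - p) + l ^ 2 * (h e ^ 2 - 2 * p * h e + p ^ 2)) := by ring
    rw [this, hsq] at h2
    linarith
  have hmeas : Measurable fun e => expRem (a + l * centredInd ν A (push e ξ)) := by
    have := (measurable_centredInd (ν := ν) hA).comp (measurable_push_left ξ)
    unfold expRem; fun_prop
  have hb2 : Integrable (fun e => (Real.exp a * (1 - l * p + l ^ 2 * p ^ 2) - 1 - a + l * p) +
        (Real.exp a * (l + l ^ 2 * (1 - 2 * p)) - l) * h e) ν :=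
    (integrable_const _).add (hhi.const_mul _)
  have hi : Integrable (fun e => expRem (a + l * centredInd ν A (push e ξ))) ν := by
    refine hb2.mono' hmeas.aestronglyMeasurable (ae_of_all _ fun e => ?_)
    rw [Real.norm_of_nonneg (expRem_nonneg _)]; exact hbd e
  refine (integral_mono hi hb2 hbd).trans ?_
  rw [integral_add (integrable_const _) (hhi.const_mul _), integral_const_mul, hint]
  simp only [integral_const, probReal_univ, smul_eq_mul, one_mul]
  unfold expRem
  nlinarith [mul_nonneg (Real.exp_pos a).le (mul_nonneg (sq_nonneg l) (sq_nonneg p))]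

lemma integrable_expRem_runSum (hA : MeasurableSet A) (l : ℝ) (n : ℕ) :
    Integrable (fun ξ => expRem (l * runSum (centredInd ν A) n ξ)) ρ := by
  have hm := measurable_runSum (measurable_centredInd (ν := ν) hA) n
  have hm' : Measurable fun ξ => expRem (l * runSum (centredInd ν A) n ξ) := by
    unfold expRem; fun_prop
  refine Integrable.of_bound (C := 2 + 2 * expRem (|l| * n) + |l| * n) hm'.aestronglyMeasurable
    (ae_of_all _ fun ξ => ?_)
  rw [Real.norm_of_nonneg (expRem_nonneg _)]
  have h1 : |l * runSum (centredInd ν A) n ξ| ≤ |l| * n := by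
    rw [abs_mul]
    exact mul_le_mul_of_nonneg_left
      (by simpa using norm_runSum_le (d := centredInd ν A) (C := 1) abs_centredInd_le n ξ)
      (abs_nonneg _)
  have h2 := exp_le_expRem (|l| * n)
  have h3 := Real.exp_le_exp.2 ((le_abs_self _).trans h1)
  have h4 := (neg_abs_le _).trans' (neg_le_neg h1)
  unfold expRem at *
  linarith

lemma HistoryLaw.integral_nextProb (h : HistoryLaw ν ρ) (hA : MeasurableSet A) :
    ∫ ξ, nextProb ν A ξ ∂ρ = ρ.real A := by
  rw [← integral_indicator_one hA,
    h.integral_eq (F := A.indicator 1) ((integrable_const (1 : ℝ)).indicator hA)]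
  refine integral_congr_ae (ae_of_all _ fun ξ => ?_)
  exact (integral_indicator_one (μ := ν) (measurable_push_left ξ hA)).symm

/-- With `u_n` the left side, `exp_le_expRem` turns the one-step bound into `u_{n+1} ≤ (1 + 2 l² q)
u_n + 2 ρ(A)`. The inhomogeneous term is the mean of `nextProb`, which is `ρ(A)` by stationarity.
Since `u_0 = 0`, the whole bound is proportional to `ρ(A)`. -/
lemma integral_expRem_runSum_le (h : HistoryLaw ν ρ) (hA : MeasurableSet A) {q : ℝ} (hq : 0 ≤ q)
    (hAq : ∀ᵐ ξ ∂ρ, nextProb ν A ξ ≤ q) {l : ℝ} (hl : |l| ≤ 1) (n : ℕ) :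
    ∫ ξ, expRem (l * runSum (centredInd ν A) n ξ) ∂ρ ≤
      2 * n * ρ.real A * Real.exp (2 * l ^ 2 * q * n) := by
  have hl2 : l ^ 2 ≤ 1 := by rw [← sq_abs]; exact pow_le_one₀ (abs_nonneg _) hl
  have hpm : Integrable (nextProb ν A) ρ :=
    Integrable.of_bound (C := 1) (measurable_nextProb hA).aestronglyMeasurable
      (ae_of_all _ fun ξ => by
        rw [Real.norm_of_nonneg (nextProb_nonneg ξ)]; exact nextProb_le_one ξ)
  have hpint := h.integral_nextProb hA
  induction n with
  | zero => simp [runSum, expRem]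
  | succ n ih =>
    set u := ∫ ξ, expRem (l * runSum (centredInd ν A) n ξ) ∂ρ
    set m := ρ.real A
    have hm : 0 ≤ m := measureReal_nonneg
    have hint := integrable_expRem_runSum (ν := ν) (ρ := ρ) hA l n
    have key : ∫ ξ, expRem (l * runSum (centredInd ν A) (n + 1) ξ) ∂ρ ≤
        (1 + 2 * l ^ 2 * q) * u + 2 * m := by
      rw [h.integral_eq (integrable_expRem_runSum hA l (n + 1))]
      have : ∀ᵐ ξ ∂ρ, ∫ e, expRem (l * runSum (centredInd ν A) (n + 1) (push e ξ)) ∂ν ≤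
          (1 + 2 * l ^ 2 * q) * expRem (l * runSum (centredInd ν A) n ξ)
            + 2 * nextProb ν A ξ := by
        filter_upwards [hAq] with ξ hξ
        have h1 := integral_expRem_step (ν := ν) hA hl (l * runSum (centredInd ν A) n ξ) ξ
        simp only [runSum, pop_push, mul_add]
        refine h1.trans ?_
        set x := l * runSum (centredInd ν A) n ξ
        have h2 := exp_le_expRem x
        have h3 := nextProb_nonneg (ν := ν) (A := A) ξ
        have h4 : 0 ≤ l ^ 2 * nextProb ν A ξ := mul_nonneg (sq_nonneg _) h3
        have h5 := mul_le_mul_of_nonneg_right h2 h4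
        have h6 : l ^ 2 * nextProb ν A ξ ≤ l ^ 2 * q := by gcongr
        have h7 := mul_le_mul_of_nonneg_right h6 (expRem_nonneg x)
        have h8 : l ^ 2 * nextProb ν A ξ ≤ nextProb ν A ξ := by nlinarith
        nlinarith
      refine (integral_mono_ae ?_ ((hint.const_mul _).add (hpm.const_mul _)) this).trans ?_
      · exact (h.integrable_comp (integrable_expRem_runSum hA l (n + 1))).integral_prod_left
      · simp only [Pi.add_apply]
        rw [integral_add (hint.const_mul _) (hpm.const_mul _), integral_const_mul,
          integral_const_mul, hpint]
    refine key.trans ?_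
    set c := 2 * l ^ 2 * q
    have hc : 0 ≤ c := by positivity
    have e1 : 1 + c ≤ Real.exp c := by linarith [Real.add_one_le_exp c]
    have e2 : Real.exp (c * (n + 1 : ℕ)) = Real.exp c * Real.exp (c * n) := by
      rw [← Real.exp_add]; push_cast; ring_nf
    have e3 : 1 ≤ Real.exp (c * (n + 1 : ℕ)) := Real.one_le_exp (by positivity)
    have hu : 0 ≤ u := integral_nonneg fun ξ => expRem_nonneg _
    calc (1 + c) * u + 2 * m ≤ Real.exp c * (2 * n * m * Real.exp (c * n))
          + 2 * m * Real.exp (c * (n + 1 : ℕ)) := by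
            refine add_le_add (mul_le_mul e1 ih hu (Real.exp_pos _).le) ?_
            exact le_mul_of_one_le_right (by positivity) e3
      _ = _ := by rw [e2]; push_cast; ring

/-- A Freedman type tail bound that carries the probability of `A` as a factor. -/
lemma measure_le_abs_runSum (h : HistoryLaw ν ρ) (hA : MeasurableSet A) {q : ℝ} (hq : 0 ≤ q)
    (hAq : ∀ᵐ ξ ∂ρ, nextProb ν A ξ ≤ q) {l t : ℝ} (hl0 : 0 < l) (hl : l ≤ 1) (hlt : 2 ≤ l * t)
    (n : ℕ) :
    ρ {ξ | t ≤ |runSum (centredInd ν A) n ξ|} ≤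
      ENNReal.ofReal (16 * n * Real.exp (2 * l ^ 2 * q * n - l * t)) * ρ A := by
  -- Markov's inequality at level `e^{l t} / 4`, used for `l' = l` and `l' = -l`. The assumption `2
  -- ≤ l t` makes `e^x / 4 ≤ expRem x` available on the event.
  have one : ∀ l' : ℝ, |l'| ≤ 1 → l' ^ 2 = l ^ 2 →
      ρ.real {ξ | l * t ≤ l' * runSum (centredInd ν A) n ξ} ≤
        8 * n * Real.exp (2 * l ^ 2 * q * n - l * t) * ρ.real A := by
    intro l' hl' hll
    have h1 := integral_expRem_runSum_le h hA hq hAq hl' n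
    rw [hll] at h1
    have h2 := mul_meas_ge_le_integral_of_nonneg (μ := ρ)
      (ae_of_all _ fun ξ => expRem_nonneg (l' * runSum (centredInd ν A) n ξ))
      (integrable_expRem_runSum hA l' n) (Real.exp (l * t) / 4)
    have h3 : ρ.real {ξ | l * t ≤ l' * runSum (centredInd ν A) n ξ} ≤
        ρ.real {ξ | Real.exp (l * t) / 4 ≤ expRem (l' * runSum (centredInd ν A) n ξ)} := by
      refine measureReal_mono fun ξ hξ => ?_
      simp only [Set.mem_ofPred_eq] at hξ ⊢
      exact (div_le_div_of_nonneg_right (Real.exp_le_exp.2 hξ) (by norm_num)).trans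
        (exp_div_four_le_expRem (hlt.trans hξ))
    have h4 : Real.exp (l * t) / 4 *
        ρ.real {ξ | l * t ≤ l' * runSum (centredInd ν A) n ξ} ≤
          2 * n * ρ.real A * Real.exp (2 * l ^ 2 * q * n) :=
      (mul_le_mul_of_nonneg_left h3 (by positivity)).trans (h2.trans h1)
    rw [Real.exp_sub]
    have he := Real.exp_pos (l * t)
    rw [← mul_div_assoc, div_mul_eq_mul_div, le_div_iff₀ he]
    linarith
  have hsub : {ξ | t ≤ |runSum (centredInd ν A) n ξ|} ⊆
      {ξ | l * t ≤ l * runSum (centredInd ν A) n ξ} ∪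
        {ξ | l * t ≤ (-l) * runSum (centredInd ν A) n ξ} := by
    intro ξ hξ
    simp only [Set.mem_ofPred_eq, Set.mem_union, le_abs] at hξ ⊢
    rcases hξ with h | h
    · left; gcongr
    · right; nlinarith
  have h1 := one l (by rw [abs_of_pos hl0]; exact hl) rfl
  have h2 := one (-l) (by rw [abs_neg, abs_of_pos hl0]; exact hl) (by ring)
  have h3 := (measureReal_mono (μ := ρ) hsub).trans (measureReal_union_le _ _)
  rw [← ofReal_measureReal, ← ofReal_measureReal (s := A), ← ENNReal.ofReal_mul (by positivity)]
  refine ENNReal.ofReal_le_ofReal ?_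
  nlinarith

end Freedman

/-! ### Norms in `L²` and Doob's maximal inequality -/

lemma eLpNorm_two_sq {α E : Type*} [MeasurableSpace α] [NormedAddCommGroup E] (μ : Measure α)
    (F : α → E) : (eLpNorm F 2 μ) ^ 2 = ∫⁻ a, ‖F a‖ₑ ^ 2 ∂μ := by
  have := eLpNorm_nnreal_pow_eq_lintegral (f := F) (μ := μ) (p := 2) (by norm_num)
  simpa using this

lemma lintegral_enorm_sq {α E : Type*} [MeasurableSpace α] [NormedAddCommGroup E] {μ : Measure α}
    {F : α → E} (hF : Integrable (fun a => ‖F a‖ ^ 2) μ) :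
    ∫⁻ a, ‖F a‖ₑ ^ 2 ∂μ = ENNReal.ofReal (∫ a, ‖F a‖ ^ 2 ∂μ) := by
  rw [ofReal_integral_eq_lintegral_ofReal hF (ae_of_all _ fun a => by positivity)]
  refine lintegral_congr fun a => ?_
  rw [ENNReal.ofReal_pow (norm_nonneg _), ofReal_norm]

section Doob

/-- The largest norm of the partial sums, started in the past, of which `runSum d n` is the
last one. -/
noncomputable def runMax (d : (ℕ → ℝ) → ℂ) : ℕ → (ℕ → ℝ) → ℝ
  | 0, _ => 0
  | n + 1, ξ => max (runMax d n (pop ξ)) ‖runSum d (n + 1) ξ‖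

variable {d : (ℕ → ℝ) → ℂ}

lemma runMax_nonneg (n : ℕ) (ξ : ℕ → ℝ) : 0 ≤ runMax d n ξ := by
  cases n with
  | zero => exact le_rfl
  | succ n => exact le_max_of_le_right (norm_nonneg _)

lemma measurable_runMax (hd : Measurable d) (n : ℕ) : Measurable (runMax d n) := by
  induction n with
  | zero => exact measurable_const
  | succ n ih => exact (ih.comp measurable_pop).max (measurable_runSum hd (n + 1)).norm

lemma runMax_le {C : ℝ} (hC : 0 ≤ C) (hd : ∀ ξ, ‖d ξ‖ ≤ C) (n : ℕ) (ξ : ℕ → ℝ) :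
    runMax d n ξ ≤ n * C := by
  induction n generalizing ξ with
  | zero => simp [runMax]
  | succ n ih =>
    refine max_le ((ih _).trans ?_) (norm_runSum_le hd _ _)
    push_cast; nlinarith

lemma norm_sum_le_runMax {Ω : Type*} (ε : ℤ → Ω → ℝ) (d : (ℕ → ℝ) → ℂ) (j : ℤ) {m n : ℕ}
    (hmn : m ≤ n) (ω : Ω) :
    ‖∑ i ∈ Finset.range m, d (past ε (j + i + 1) ω)‖ ≤ runMax d n (past ε (j + n) ω) := by
  induction n with
  | zero => obtain rfl : m = 0 := by omega
            simp [runMax]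
  | succ n ih =>
    rw [runMax]; push_cast
    rw [← add_assoc, pop_past]
    rcases hmn.lt_or_eq with h | rfl
    · exact (ih (by omega)).trans (le_max_left _ _)
    · refine le_max_of_le_right ?_
      rw [← runSum_past]; push_cast; rw [add_assoc]

/-- Convexity of the norm, with subgradient `s / ‖s‖` (which is 0 at `s = 0`). The inner product has
conditional mean zero when `v` is a martingale increment. -/
lemma norm_add_inner_le (s v : ℂ) : ‖s‖ + inner ℝ (‖s‖⁻¹ • s) v ≤ ‖s + v‖ := by
  by_cases hs : s = 0
  · simp [hs]
  · have hs' : ‖s‖ ≠ 0 := norm_ne_zero_iff.2 hs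
    have h1 : inner ℝ (‖s‖⁻¹ • s) s = ‖s‖ := by
      rw [real_inner_smul_left, real_inner_self_eq_norm_sq]; field_simp
    have h2 := real_inner_le_norm (‖s‖⁻¹ • s) (s + v)
    rw [inner_add_right, h1, norm_smul, norm_inv, norm_norm, inv_mul_cancel₀ hs', one_mul] at h2
    exact h2

/-- Pathwise core of Doob's inequality, with `a` the running maximum and `s`, `t` the old and new
norms. If the maximum is unchanged there is equality; if it rises to `t`, the two sides differ by
`(a - t)²`. -/
lemma max_sq_sub_le {a s t : ℝ} : max a t ^ 2 - 2 * max a t * t ≤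
    (a ^ 2 - 2 * a * s) - 2 * a * (t - s) := by
  rcases le_total a t with h | h
  · rw [max_eq_right h]; nlinarith [sq_nonneg (a - t)]
  · rw [max_eq_left h]; nlinarith

variable {ν : Measure ℝ} {ρ : Measure (ℕ → ℝ)} [IsProbabilityMeasure ν] [IsProbabilityMeasure ρ]
  {C : ℝ}

lemma integral_inner_push (hdm : Measurable d) (hd : ∀ ξ, ‖d ξ‖ ≤ C)
    (hd0 : ∀ ξ, ∫ e, d (push e ξ) ∂ν = 0) (c : ℂ) (ξ : ℕ → ℝ) :
    Integrable (fun e => d (push e ξ)) ν ∧ ∫ e, inner ℝ c (d (push e ξ)) ∂ν = 0 := by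
  have hi : Integrable (fun e => d (push e ξ)) ν :=
    Integrable.of_bound (hdm.comp (measurable_push_left ξ)).aestronglyMeasurable C
      (ae_of_all _ fun e => hd _)
  refine ⟨hi, ?_⟩
  rw [integral_inner hi, hd0, inner_zero_right]

lemma integrable_norm_sq_of_bound {F : (ℕ → ℝ) → ℂ} (hF : Measurable F) {B : ℝ}
    (hB : ∀ ξ, ‖F ξ‖ ≤ B) : Integrable (fun ξ => ‖F ξ‖ ^ 2) ρ := by
  refine Integrable.of_bound (hF.norm.pow_const 2).aestronglyMeasurable (B ^ 2)
    (ae_of_all _ fun ξ => ?_)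
  rw [Real.norm_of_nonneg (by positivity)]
  exact pow_le_pow_left₀ (norm_nonneg _) (hB ξ) 2

/-- Martingale increments are orthogonal and, by stationarity, have equal second moments. -/
lemma integral_norm_runSum_sq (h : HistoryLaw ν ρ) (hdm : Measurable d) (hd : ∀ ξ, ‖d ξ‖ ≤ C)
    (hd0 : ∀ ξ, ∫ e, d (push e ξ) ∂ν = 0) (n : ℕ) :
    ∫ ξ, ‖runSum d n ξ‖ ^ 2 ∂ρ = n * ∫ ξ, ‖d ξ‖ ^ 2 ∂ρ := by
  have hI := fun k => integrable_norm_sq_of_bound (ρ := ρ) (measurable_runSum hdm k)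
    (norm_runSum_le hd k)
  have hdI := integrable_norm_sq_of_bound (ρ := ρ) hdm hd
  induction n with
  | zero => simp [runSum]
  | succ n ih =>
    have key : ∀ ξ, ∫ e, ‖runSum d (n + 1) (push e ξ)‖ ^ 2 ∂ν =
        ‖runSum d n ξ‖ ^ 2 + ∫ e, ‖d (push e ξ)‖ ^ 2 ∂ν := by
      intro ξ
      obtain ⟨hi, h0⟩ := integral_inner_push hdm hd hd0 (runSum d n ξ) ξ
      have hi2 : Integrable (fun e => ‖d (push e ξ)‖ ^ 2) ν := by
        refine Integrable.of_bound
          ((hdm.comp (measurable_push_left ξ)).norm.pow_const 2).aestronglyMeasurable (C ^ 2)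
          (ae_of_all _ fun e => ?_)
        rw [Real.norm_of_nonneg (by positivity)]
        exact pow_le_pow_left₀ (norm_nonneg _) (hd _) 2
      have hi3 : Integrable (fun e => 2 * inner ℝ (runSum d n ξ) (d (push e ξ))) ν :=
        (hi.const_inner _).const_mul 2
      simp only [runSum, pop_push, norm_add_sq_real]
      rw [integral_add (f := fun e => ‖runSum d n ξ‖ ^ 2 +
          2 * inner ℝ (runSum d n ξ) (d (push e ξ))) ((integrable_const _).add hi3) hi2,
        integral_add (integrable_const _) hi3, integral_const_mul, h0]
      simp
    rw [h.integral_eq (hI (n + 1)), integral_congr_ae (ae_of_all _ key), integral_add (hI n), ih,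
      ← h.integral_eq hdI]
    · push_cast; ring
    · exact (h.integrable_comp hdI).integral_prod_left

/-- Doob's maximal inequality in `L²`. -/
lemma integral_runMax_sq_le (h : HistoryLaw ν ρ) (hdm : Measurable d) (hC : 0 ≤ C)
    (hd : ∀ ξ, ‖d ξ‖ ≤ C) (hd0 : ∀ ξ, ∫ e, d (push e ξ) ∂ν = 0) (n : ℕ) :
    ∫ ξ, runMax d n ξ ^ 2 ∂ρ ≤ 4 * n * ∫ ξ, ‖d ξ‖ ^ 2 ∂ρ := by
  have hbd : ∀ k ξ, ‖runMax d k ξ ^ 2 - 2 * runMax d k ξ * ‖runSum d k ξ‖‖ ≤ 3 * (k * C) ^ 2 := by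
    intro k ξ
    have h1 := runMax_nonneg (d := d) k ξ
    have h2 := runMax_le hC hd k ξ
    have h3 := norm_runSum_le hd k ξ
    have h4 := norm_nonneg (runSum d k ξ)
    have h5 := mul_le_mul h2 h3 h4 (h1.trans h2)
    have h6 := mul_le_mul h2 h2 h1 (h1.trans h2)
    rw [Real.norm_eq_abs, abs_le]
    constructor <;> nlinarith [mul_nonneg h1 h4]
  have hm : ∀ k, Measurable fun ξ => runMax d k ξ ^ 2 - 2 * runMax d k ξ * ‖runSum d k ξ‖ := by
    intro k
    have h1 := measurable_runMax hdm k
    have h2 := (measurable_runSum hdm k).norm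
    fun_prop
  have hint : ∀ k, Integrable
      (fun ξ => runMax d k ξ ^ 2 - 2 * runMax d k ξ * ‖runSum d k ξ‖) ρ := fun k =>
    Integrable.of_bound (hm k).aestronglyMeasurable _ (ae_of_all _ (hbd k))
  -- With `M` the running maximum and `S` the sum, `M² - 2 M ‖S‖` is a supermartingale started at 0.
  have hR : ∫ ξ, (runMax d n ξ ^ 2 - 2 * runMax d n ξ * ‖runSum d n ξ‖) ∂ρ ≤ 0 := by
    induction n with
    | zero => simp [runMax]
    | succ n ih =>
      refine le_trans ?_ ih
      rw [h.integral_eq (hint (n + 1))]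
      refine integral_mono_ae (h.integrable_comp (hint (n + 1))).integral_prod_left (hint n)
        (ae_of_all _ fun ξ => ?_)
      obtain ⟨hi, h0⟩ := integral_inner_push hdm hd hd0
        (‖runSum d n ξ‖⁻¹ • runSum d n ξ) ξ
      set a := runMax d n ξ
      set s := runSum d n ξ
      have hi3 : Integrable (fun e => 2 * a * inner ℝ (‖s‖⁻¹ • s) (d (push e ξ))) ν :=
        (hi.const_inner _).const_mul _
      calc _ ≤ ∫ e, ((a ^ 2 - 2 * a * ‖s‖) - 2 * a * inner ℝ (‖s‖⁻¹ • s) (d (push e ξ))) ∂ν := by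
            refine integral_mono ?_ ((integrable_const _).sub hi3) fun e => ?_
            · exact Integrable.of_bound
                ((hm (n + 1)).comp (measurable_push_left ξ)).aestronglyMeasurable _
                (ae_of_all _ fun e => hbd (n + 1) _)
            · have h1 := norm_add_inner_le s (d (push e ξ))
              have h2 : 0 ≤ a := runMax_nonneg n ξ
              refine (max_sq_sub_le (s := ‖s‖)).trans ?_
              simp only [runSum, pop_push]
              have := mul_le_mul_of_nonneg_left h1 h2
              change (a ^ 2 - 2 * a * ‖s‖) - 2 * a * (‖s + d (push e ξ)‖ - ‖s‖) ≤ _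
              linarith
        _ = _ := by
            rw [integral_sub (integrable_const _) hi3, integral_const_mul, h0]; simp [a, s]
  have hmx : Integrable (fun ξ => runMax d n ξ ^ 2) ρ := by
    refine Integrable.of_bound ((measurable_runMax hdm n).pow_const 2).aestronglyMeasurable
      ((n * C) ^ 2) (ae_of_all _ fun ξ => ?_)
    rw [Real.norm_of_nonneg (by positivity)]
    exact pow_le_pow_left₀ (runMax_nonneg n ξ) (runMax_le hC hd n ξ) 2
  have hs := integrable_norm_sq_of_bound (ρ := ρ) (measurable_runSum hdm n) (norm_runSum_le hd n)
  have hfin : ∫ ξ, (1 / 2 * runMax d n ξ ^ 2 - 2 * ‖runSum d n ξ‖ ^ 2) ∂ρ ≤ 0 := by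
    refine le_trans (integral_mono ((hmx.const_mul _).sub (hs.const_mul _)) (hint n) fun ξ => ?_) hR
    dsimp only
    -- From `(M - 2 ‖S‖)² ≥ 0`, that is `M² / 2 - 2 ‖S‖² ≤ M² - 2 M ‖S‖`; hence the factor 4.
    nlinarith [sq_nonneg (runMax d n ξ - 2 * ‖runSum d n ξ‖)]
  rw [integral_sub (hmx.const_mul _) (hs.const_mul _), integral_const_mul, integral_const_mul,
    integral_norm_runSum_sq h hdm hd hd0] at hfin
  linarith

lemma eLpNorm_runMax_le (h : HistoryLaw ν ρ) (hdm : Measurable d) (hC : 0 ≤ C)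
    (hd : ∀ ξ, ‖d ξ‖ ≤ C) (hd0 : ∀ ξ, ∫ e, d (push e ξ) ∂ν = 0) (n : ℕ) :
    eLpNorm (runMax d n) 2 ρ ≤ ENNReal.ofReal (2 * √n) * eLpNorm d 2 ρ := by
  rw [← ENNReal.pow_le_pow_left_iff two_ne_zero, mul_pow, eLpNorm_two_sq, eLpNorm_two_sq,
    lintegral_enorm_sq (integrable_norm_sq_of_bound hdm hd), ← ENNReal.ofReal_pow (by positivity),
    ← ENNReal.ofReal_mul (by positivity), mul_pow, Real.sq_sqrt (by positivity)]
  have hmx : Integrable (fun ξ => ‖runMax d n ξ‖ ^ 2) ρ := by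
    refine Integrable.of_bound ((measurable_runMax hdm n).norm.pow_const 2).aestronglyMeasurable
      ((n * C) ^ 2) (ae_of_all _ fun ξ => ?_)
    rw [Real.norm_of_nonneg (by positivity), Real.norm_of_nonneg (runMax_nonneg n ξ)]
    exact pow_le_pow_left₀ (runMax_nonneg n ξ) (runMax_le hC hd n ξ) 2
  rw [lintegral_enorm_sq hmx]
  refine ENNReal.ofReal_le_ofReal ?_
  have := integral_runMax_sq_le h hdm hC hd hd0 n
  simp only [Real.norm_eq_abs, sq_abs]
  linarith

end Doob

/-! ### The chain forgets its past -/

section Mixing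

/-- The transition operator of the chain of histories. -/
noncomputable def step {E : Type*} [NormedAddCommGroup E] [NormedSpace ℝ E] (ν : Measure ℝ)
    (u : (ℕ → ℝ) → E) (ξ : ℕ → ℝ) : E := ∫ e, u (push e ξ) ∂ν

variable {ν : Measure ℝ} {ρ : Measure (ℕ → ℝ)} [IsProbabilityMeasure ν] [IsProbabilityMeasure ρ]

lemma measurable_step {E : Type*} [NormedAddCommGroup E] [NormedSpace ℝ E] [MeasurableSpace E]
    [BorelSpace E] [SecondCountableTopology E] {u : (ℕ → ℝ) → E} (hu : Measurable u) :
    Measurable (step ν u) :=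
  ((hu.comp measurable_push).stronglyMeasurable.integral_prod_right
    (f := fun ξ e => u (push e ξ))).measurable

section Iterate

variable {E : Type*} [NormedAddCommGroup E] [NormedSpace ℝ E] {u w : (ℕ → ℝ) → E} {C : ℝ}

lemma norm_step_le (hu : ∀ ξ, ‖u ξ‖ ≤ C) (ξ : ℕ → ℝ) : ‖step ν u ξ‖ ≤ C := by
  simpa [step] using norm_integral_le_of_norm_le_const (μ := ν) (ae_of_all _ fun e => hu (push e ξ))

lemma norm_iterate_step_le (hu : ∀ ξ, ‖u ξ‖ ≤ C) (k : ℕ) (ξ : ℕ → ℝ) :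
    ‖(step ν)^[k] u ξ‖ ≤ C := by
  induction k generalizing ξ with
  | zero => exact hu ξ
  | succ k ih => rw [Function.iterate_succ_apply']; exact norm_step_le ih ξ

/-- Averaging over the newest coordinate removes it and shifts the others down by one. The truncated
subtraction is right: a constant stays constant. -/
lemma dependsOn_step {m : ℕ} (hw : DependsOn w (Set.Iio m)) :
    DependsOn (step ν w) (Set.Iio (m - 1)) := by
  intro x y hxy
  refine integral_congr_ae (ae_of_all _ fun e => hw fun i hi => ?_)
  cases i with
  | zero => rfl
  | succ i => exact hxy i (by simp only [Set.mem_Iio] at hi ⊢; omega)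

lemma dependsOn_iterate_step {m : ℕ} (hw : DependsOn w (Set.Iio m)) (k : ℕ) :
    DependsOn ((step ν)^[k] w) (Set.Iio (m - k)) := by
  induction k with
  | zero => exact hw
  | succ k ih => rw [Function.iterate_succ_apply', ← Nat.sub_sub]; exact dependsOn_step ih

variable [MeasurableSpace E] [BorelSpace E] [SecondCountableTopology E]

lemma measurable_iterate_step (hu : Measurable u) (k : ℕ) : Measurable ((step ν)^[k] u) := by
  induction k with
  | zero => exact hu
  | succ k ih => rw [Function.iterate_succ_apply']; exact measurable_step ih

lemma integrable_of_bound_const (hu : Measurable u) (hC : ∀ ξ, ‖u ξ‖ ≤ C) : Integrable u ρ :=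
  Integrable.of_bound hu.aestronglyMeasurable C (ae_of_all _ hC)

lemma integrable_push (hu : Measurable u) (hC : ∀ ξ, ‖u ξ‖ ≤ C) (ξ : ℕ → ℝ) :
    Integrable (fun e => u (push e ξ)) ν :=
  Integrable.of_bound (hu.comp (measurable_push_left ξ)).aestronglyMeasurable C
    (ae_of_all _ fun _ => hC _)

lemma integral_iterate_step (h : HistoryLaw ν ρ) (hu : Measurable u) (hC : ∀ ξ, ‖u ξ‖ ≤ C)
    (k : ℕ) : ∫ ξ, (step ν)^[k] u ξ ∂ρ = ∫ ξ, u ξ ∂ρ := by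
  induction k with
  | zero => rfl
  | succ k ih =>
    rw [← ih, h.integral_eq (integrable_of_bound_const (measurable_iterate_step hu k)
      (norm_iterate_step_le hC k)), Function.iterate_succ_apply']
    rfl

/-- Stationarity makes the transition operator a contraction of `L¹(ρ)`. -/
lemma integral_norm_iterate_step_sub_le (h : HistoryLaw ν ρ) (hu : Measurable u)
    (hC : ∀ ξ, ‖u ξ‖ ≤ C) (hw : Measurable w) (hwC : ∀ ξ, ‖w ξ‖ ≤ C) (k : ℕ) :
    ∫ ξ, ‖(step ν)^[k] u ξ - (step ν)^[k] w ξ‖ ∂ρ ≤ ∫ ξ, ‖u ξ - w ξ‖ ∂ρ := by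
  induction k with
  | zero => exact le_rfl
  | succ k ih =>
    refine le_trans ?_ ih
    have hku := integrable_of_bound_const (ρ := ρ) (measurable_iterate_step hu k)
      (norm_iterate_step_le (ν := ν) hC k)
    have hkw := integrable_of_bound_const (ρ := ρ) (measurable_iterate_step hw k)
      (norm_iterate_step_le (ν := ν) hwC k)
    have hk1 := integrable_of_bound_const (ρ := ρ) (measurable_iterate_step hu (k + 1))
      (norm_iterate_step_le (ν := ν) hC (k + 1))
    have hk2 := integrable_of_bound_const (ρ := ρ) (measurable_iterate_step hw (k + 1))
      (norm_iterate_step_le (ν := ν) hwC (k + 1))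
    rw [h.integral_eq (F := fun ξ => ‖(step ν)^[k] u ξ - (step ν)^[k] w ξ‖) (hku.sub hkw).norm]
    refine integral_mono (hk1.sub hk2).norm
      (h.integrable_comp (hku.sub hkw).norm).integral_prod_left fun ξ => ?_
    simp only [Function.iterate_succ_apply', step]
    rw [← integral_sub (integrable_push (measurable_iterate_step hu k)
      (norm_iterate_step_le hC k) ξ) (integrable_push (measurable_iterate_step hw k)
      (norm_iterate_step_le hwC k) ξ)]
    exact norm_integral_le_integral_norm _

end Iterate

/-- Lévy's upward theorem for the filtration of the first coordinates of the history. -/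
lemma exists_dependsOn_integral_abs_sub_le {u : (ℕ → ℝ) → ℝ} (hu : Measurable u)
    (hu1 : ∀ ξ, ‖u ξ‖ ≤ 1) {δ : ℝ} (hδ : 0 < δ) :
    ∃ (w : (ℕ → ℝ) → ℝ) (m : ℕ), Measurable w ∧ (∀ ξ, ‖w ξ‖ ≤ 1) ∧ DependsOn w (Set.Iio m) ∧
      ∫ ξ, ‖u ξ - w ξ‖ ∂ρ ≤ δ := by
  let ℱ : Filtration ℕ (MeasurableSpace.pi (X := fun _ : ℕ => ℝ)) := Filtration.piLE
  have hsup : ⨆ n, ℱ n = MeasurableSpace.pi := by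
    refine le_antisymm (iSup_le fun n => ℱ.le n) (iSup_le fun i => ?_)
    refine le_trans ?_ (le_iSup (fun n => ℱ n) i)
    rw [← measurable_iff_comap_le]
    have h1 : Measurable[ℱ i] (Preorder.restrictLe (π := fun _ : ℕ => ℝ) i) :=
      comap_measurable _
    exact (measurable_pi_apply (⟨i, Set.mem_Iic.2 le_rfl⟩ : Set.Iic i)).comp h1
  have hui : Integrable u ρ := integrable_of_bound_const hu hu1
  have ht := tendsto_eLpNorm_condExp (μ := ρ) (ℱ := ℱ) u
  have hself : ρ[u | ⨆ n, ℱ n] = u := by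
    rw [hsup]; exact condExp_of_stronglyMeasurable le_rfl hu.stronglyMeasurable hui
  rw [hself] at ht
  obtain ⟨m, hm⟩ := (ht.eventually_le_const (ENNReal.ofReal_pos.2 hδ)).exists
  -- Clamping to `[-1, 1]` keeps the uniform bound and cannot increase the distance to `u`. The
  -- index is `m + 1` because `ℱ m` contains coordinate `m`.
  refine ⟨fun ξ => max (-1) (min 1 ((ρ[u | ℱ m]) ξ)), m + 1, ?_, fun ξ => ?_, ?_, ?_⟩
  · have := (stronglyMeasurable_condExp (μ := ρ) (m := ℱ m) (f := u)).measurable.mono (ℱ.le m) le_rfl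
    fun_prop
  · rw [Real.norm_eq_abs, abs_le]
    exact ⟨le_max_left _ _, max_le (by norm_num) (min_le_left _ _)⟩
  · have h1 : DependsOn (ρ[u | ℱ m]) (Set.Iic m) :=
      stronglyMeasurable_condExp.dependsOn_of_piLE
    intro x y hxy
    have : (ρ[u | ℱ m]) x = (ρ[u | ℱ m]) y :=
      h1 fun i hi => hxy i (by simp only [Set.mem_Iic, Set.mem_Iio] at hi ⊢; omega)
    simp only [this]
  · have hci : Integrable (ρ[u | ℱ m] - u) ρ := integrable_condExp.sub hui
    rw [eLpNorm_one_eq_lintegral_enorm, ← ofReal_integral_norm_eq_lintegral_enorm hci,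
      ENNReal.ofReal_le_ofReal_iff hδ.le] at hm
    refine le_trans (integral_mono_of_nonneg (ae_of_all _ fun ξ => norm_nonneg _) hci.norm
      (ae_of_all _ fun ξ => ?_)) hm
    have h1 := abs_le.1 (hu1 ξ)
    simp only [Pi.sub_apply, Real.norm_eq_abs]
    set c := (ρ[u | ℱ m]) ξ
    rw [abs_sub_comm c]
    rcases le_total 1 c with hc | hc
    · rw [min_eq_left hc, max_eq_right (by norm_num), abs_of_nonpos (by linarith),
        abs_of_nonpos (by linarith)]; linarith
    · rw [min_eq_right hc]
      rcases le_total (-1) c with hc' | hc'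
      · rw [max_eq_right hc']
      · rw [max_eq_left hc', abs_of_nonneg (by linarith), abs_of_nonneg (by linarith)]; linarith

/-- The chain of histories forgets its starting point. -/
lemma tendsto_integral_abs_iterate_step_sub (h : HistoryLaw ν ρ) {u : (ℕ → ℝ) → ℝ}
    (hu : Measurable u) (hu1 : ∀ ξ, ‖u ξ‖ ≤ 1) :
    Tendsto (fun k => ∫ ξ, ‖(step ν)^[k] u ξ - ∫ ζ, u ζ ∂ρ‖ ∂ρ) atTop (𝓝 0) := by
  rw [Metric.tendsto_atTop]
  intro δ hδ
  obtain ⟨w, m, hw, hw1, hdep, hle⟩ :=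
    exists_dependsOn_integral_abs_sub_le (ρ := ρ) hu hu1 (δ := δ / 3) (by positivity)
  refine ⟨m, fun k hk => ?_⟩
  have hui : Integrable u ρ := integrable_of_bound_const hu hu1
  have hwi : Integrable w ρ := integrable_of_bound_const hw hw1
  -- After `k ≥ m` steps the approximant depends on no coordinate, so it is equal to its mean.
  have hconst : ∀ ξ, (step ν)^[k] w ξ = ∫ ζ, w ζ ∂ρ := by
    intro ξ
    have h1 := dependsOn_iterate_step (ν := ν) hdep k
    have h2 : ∀ x y, (step ν)^[k] w x = (step ν)^[k] w y := by
      intro x y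
      refine h1 fun i hi => ?_
      simp only [Set.mem_Iio] at hi; omega
    rw [← integral_iterate_step h hw hw1 k, integral_congr_ae (ae_of_all _ fun ζ => h2 ζ ξ)]
    simp
  have hku := integrable_of_bound_const (ρ := ρ) (measurable_iterate_step hu k)
    (norm_iterate_step_le (ν := ν) hu1 k)
  have hkw := integrable_of_bound_const (ρ := ρ) (measurable_iterate_step hw k)
    (norm_iterate_step_le (ν := ν) hw1 k)
  rw [Real.dist_eq, sub_zero, abs_of_nonneg (integral_nonneg fun _ => norm_nonneg _)]
  calc ∫ ξ, ‖(step ν)^[k] u ξ - ∫ ζ, u ζ ∂ρ‖ ∂ρ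
      ≤ ∫ ξ, (‖(step ν)^[k] u ξ - (step ν)^[k] w ξ‖ + δ / 3) ∂ρ := by
        refine integral_mono (hku.sub (integrable_const _)).norm
          ((hku.sub hkw).norm.add (integrable_const _)) fun ξ => ?_
        have h3 : ‖(∫ ζ, w ζ ∂ρ) - ∫ ζ, u ζ ∂ρ‖ ≤ δ / 3 := by
          rw [norm_sub_rev, ← integral_sub hui hwi]
          exact (norm_integral_le_integral_norm _).trans hle
        have h4 : (step ν)^[k] u ξ - ∫ ζ, u ζ ∂ρ = ((step ν)^[k] u ξ - (step ν)^[k] w ξ) +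
            ((∫ ζ, w ζ ∂ρ) - ∫ ζ, u ζ ∂ρ) := by rw [hconst]; ring
        dsimp only
        rw [h4]
        exact (norm_add_le _ _).trans (by gcongr)
    _ ≤ δ / 3 + δ / 3 := by
        rw [integral_add (f := fun ξ => ‖(step ν)^[k] u ξ - (step ν)^[k] w ξ‖)
          (hku.sub hkw).norm (integrable_const _)]
        simp only [integral_const, probReal_univ, smul_eq_mul, one_mul]
        gcongr
        exact (integral_norm_iterate_step_sub_le h hu hu1 hw hw1 k).trans hle
    _ < δ := by linarith

lemma re_iterate_step {u : (ℕ → ℝ) → ℂ} (hu : Measurable u) (hu1 : ∀ ξ, ‖u ξ‖ ≤ 1) (k : ℕ)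
    (L : ℂ →L[ℝ] ℝ) (ξ : ℕ → ℝ) :
    L ((step ν)^[k] u ξ) = (step ν)^[k] (fun ζ => L (u ζ)) ξ := by
  induction k generalizing ξ with
  | zero => rfl
  | succ k ih =>
    simp only [Function.iterate_succ_apply']
    rw [step, ← L.integral_comp_comm (integrable_push (measurable_iterate_step hu k)
      (norm_iterate_step_le hu1 k) ξ)]
    simp only [ih]; rfl

/-- Convergence in `L¹` of real and imaginary parts suffices: the difference has norm at most 2, so
its square is at most twice its norm. -/
lemma tendsto_eLpNorm_iterate_step_sub (h : HistoryLaw ν ρ) {u : (ℕ → ℝ) → ℂ}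
    (hu : Measurable u) (hu1 : ∀ ξ, ‖u ξ‖ ≤ 1) :
    Tendsto (fun k => eLpNorm (fun ξ => (step ν)^[k] u ξ - ∫ ζ, u ζ ∂ρ) 2 ρ) atTop (𝓝 0) := by
  have hui : Integrable u ρ := integrable_of_bound_const hu hu1
  have hre := tendsto_integral_abs_iterate_step_sub h (u := fun ξ => Complex.reCLM (u ξ))
    (by fun_prop) (fun ξ => (Complex.abs_re_le_norm _).trans (hu1 ξ))
  have him := tendsto_integral_abs_iterate_step_sub h (u := fun ξ => Complex.imCLM (u ξ))
    (by fun_prop) (fun ξ => (Complex.abs_im_le_norm _).trans (hu1 ξ))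
  have hs := (hre.add him).const_mul 2
  simp only [add_zero, mul_zero] at hs
  have hs2 := ENNReal.tendsto_ofReal hs
  rw [ENNReal.ofReal_zero] at hs2
  have key : ∀ k, (eLpNorm (fun ξ => (step ν)^[k] u ξ - ∫ ζ, u ζ ∂ρ) 2 ρ) ^ 2 ≤
      ENNReal.ofReal (2 * (∫ ξ, ‖(step ν)^[k] (fun ξ => Complex.reCLM (u ξ)) ξ -
        ∫ ζ, Complex.reCLM (u ζ) ∂ρ‖ ∂ρ + ∫ ξ, ‖(step ν)^[k] (fun ξ => Complex.imCLM (u ξ)) ξ -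
        ∫ ζ, Complex.imCLM (u ζ) ∂ρ‖ ∂ρ)) := by
    intro k
    set c := ∫ ζ, u ζ ∂ρ with hc
    have hc1 : ‖c‖ ≤ 1 := by
      simpa using norm_integral_le_of_norm_le_const (μ := ρ) (ae_of_all _ hu1)
    have hkm := measurable_iterate_step (ν := ν) hu k
    have hk1 := norm_iterate_step_le (ν := ν) hu1 k
    have hb : ∀ ξ, ‖(step ν)^[k] u ξ - c‖ ≤ 2 := fun ξ =>
      (norm_sub_le _ _).trans (by linarith [hk1 ξ])
    have hm : Measurable fun ξ => (step ν)^[k] u ξ - c := hkm.sub_const c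
    have hi : Integrable (fun ξ => (step ν)^[k] u ξ - c) ρ := integrable_of_bound_const hm hb
    rw [eLpNorm_two_sq, lintegral_enorm_sq (integrable_norm_sq_of_bound hm hb)]
    refine ENNReal.ofReal_le_ofReal ?_
    have e1 : ∀ (L : ℂ →L[ℝ] ℝ), ∀ ξ, (step ν)^[k] (fun ξ => L (u ξ)) ξ - ∫ ζ, L (u ζ) ∂ρ =
        L ((step ν)^[k] u ξ - c) := by
      intro L ξ
      rw [L.integral_comp_comm hui, ← re_iterate_step hu hu1, map_sub]
    simp only [e1]
    have i1 := (Complex.reCLM.integrable_comp hi).norm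
    have i2 := (Complex.imCLM.integrable_comp hi).norm
    rw [← integral_add i1 i2, ← integral_const_mul]
    refine integral_mono (integrable_norm_sq_of_bound hm hb) ((i1.add i2).const_mul 2) fun ξ => ?_
    dsimp only
    have h1 := Complex.norm_le_abs_re_add_abs_im ((step ν)^[k] u ξ - c)
    have h2 := hb ξ
    have h3 := norm_nonneg ((step ν)^[k] u ξ - c)
    simp only [Complex.reCLM_apply, Complex.imCLM_apply, Real.norm_eq_abs]
    nlinarith
  have h2 : Tendsto (fun k => (eLpNorm (fun ξ => (step ν)^[k] u ξ - ∫ ζ, u ζ ∂ρ) 2 ρ) ^ 2)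
      atTop (𝓝 0) := tendsto_of_tendsto_of_tendsto_of_le_of_le tendsto_const_nhds hs2
        (fun _ => zero_le) key
  have h3 := h2.ennrpow_const (1 / 2 : ℝ)
  rw [ENNReal.zero_rpow_of_pos (by norm_num)] at h3
  refine h3.congr fun k => ?_
  rw [← ENNReal.rpow_natCast, ← ENNReal.rpow_mul]; norm_num

end Mixing

/-! ### Conditional laws as iterated transition kernels -/

section Kernels

variable {ν : Measure ℝ} {ρ : Measure (ℕ → ℝ)} [IsProbabilityMeasure ν] [IsProbabilityMeasure ρ]

/-- The transition kernel of the chain of histories. -/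
noncomputable def stepKernel (ν : Measure ℝ) [IsProbabilityMeasure ν] :
    Kernel (ℕ → ℝ) (ℕ → ℝ) :=
  (Kernel.id ×ₖ Kernel.const (ℕ → ℝ) ν).map fun p => push p.2 p.1

lemma stepKernel_apply (ξ : ℕ → ℝ) : stepKernel ν ξ = ν.map fun e => push e ξ := by
  rw [stepKernel, Kernel.map_apply _ measurable_push, Kernel.prod_apply, Kernel.id_apply,
    Kernel.const_apply, Measure.dirac_prod, Measure.map_map measurable_push measurable_prodMk_left]
  rfl

instance : IsMarkovKernel (stepKernel ν) := Kernel.IsMarkovKernel.map _ measurable_push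

/-- The law of `g` after `k` further innovations, given the history. -/
noncomputable def futureLaw (ν : Measure ℝ) [IsProbabilityMeasure ν] {g : (ℕ → ℝ) → ℝ}
    (hg : Measurable g) : ℕ → Kernel (ℕ → ℝ) ℝ
  | 0 => Kernel.deterministic g hg
  | k + 1 => futureLaw ν hg k ∘ₖ stepKernel ν

variable {g : (ℕ → ℝ) → ℝ} (hg : Measurable g)

instance (k : ℕ) : IsMarkovKernel (futureLaw ν hg k) := by
  induction k with
  | zero => unfold futureLaw; infer_instance
  | succ k ih => unfold futureLaw; infer_instance

lemma lintegral_futureLaw_succ (k : ℕ) (ξ : ℕ → ℝ) {F : ℝ → ℝ≥0∞} (hF : Measurable F) :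
    ∫⁻ x, F x ∂(futureLaw ν hg (k + 1) ξ) = ∫⁻ e, ∫⁻ x, F x ∂(futureLaw ν hg k (push e ξ)) ∂ν := by
  rw [futureLaw, Kernel.lintegral_comp _ _ _ hF, stepKernel_apply,
    lintegral_map hF.lintegral_kernel (measurable_push_left ξ)]

/-- Disintegration of the joint law of the history `k` steps back and the present value of `g`. It
identifies `futureLaw` with the regular conditional distribution. -/
lemma HistoryLaw.lintegral_futureLaw (h : HistoryLaw ν ρ) (k : ℕ) {F : (ℕ → ℝ) × ℝ → ℝ≥0∞}
    (hF : Measurable F) :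
    ∫⁻ ξ, ∫⁻ x, F (ξ, x) ∂(futureLaw ν hg k ξ) ∂ρ = ∫⁻ ξ, F (pop^[k] ξ, g ξ) ∂ρ := by
  induction k generalizing F with
  | zero =>
    refine lintegral_congr fun ξ => ?_
    rw [futureLaw, Kernel.lintegral_deterministic' (f := fun x => F (ξ, x)) hg
      (hF.comp measurable_prodMk_left)]
    rfl
  | succ k ih =>
    have hF' : Measurable fun p : (ℕ → ℝ) × ℝ => F (pop p.1, p.2) :=
      hF.comp ((measurable_pop.comp measurable_fst).prodMk measurable_snd)
    have := ih hF'
    rw [h.lintegral_eq (hF'.lintegral_kernel_prod_right')] at this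
    simp only [Function.iterate_succ_apply', ← this]
    refine lintegral_congr fun ξ => ?_
    exact lintegral_futureLaw_succ hg k ξ (hF.comp measurable_prodMk_left)

lemma futureLaw_one_real {I : Set ℝ} (hI : MeasurableSet I) (ξ : ℕ → ℝ) :
    (futureLaw ν hg 1 ξ).real I = nextProb ν (g ⁻¹' I) ξ := by
  have h1 : futureLaw ν hg 1 ξ I = ν ((fun e => push e ξ) ⁻¹' (g ⁻¹' I)) := by
    rw [← lintegral_indicator_one hI,
      lintegral_futureLaw_succ hg 0 ξ (measurable_one.indicator hI),
      ← lintegral_indicator_one (measurable_push_left ξ (hg hI))]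
    refine lintegral_congr fun e => ?_
    rw [futureLaw, Kernel.lintegral_deterministic' _ (measurable_one.indicator hI)]
    rfl
  rw [measureReal_def, h1]; rfl

/-- The function `exp (i θ g)` of the history. -/
noncomputable def expFun (g : (ℕ → ℝ) → ℝ) (θ : ℝ) (ξ : ℕ → ℝ) : ℂ :=
  Complex.exp (θ * g ξ * Complex.I)

lemma norm_expFun_le (θ : ℝ) (ξ : ℕ → ℝ) : ‖expFun g θ ξ‖ ≤ 1 := by
  rw [expFun, ← Complex.ofReal_mul, Complex.norm_exp_ofReal_mul_I]

include hg in
lemma measurable_expFun (θ : ℝ) : Measurable (expFun g θ) := by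
  unfold expFun; fun_prop

/-- Chapman-Kolmogorov: integrating out the `k` new innovations one by one is iterating the
transition operator on `e^{iθg}`. -/
lemma charFun_futureLaw (k : ℕ) (θ : ℝ) (ξ : ℕ → ℝ) :
    charFun (futureLaw ν hg k ξ) θ = (step ν)^[k] (expFun g θ) ξ := by
  induction k generalizing ξ with
  | zero =>
    rw [charFun_apply_real, futureLaw, Kernel.integral_deterministic]; rfl
  | succ k ih =>
    have hi : Integrable (fun x : ℝ => Complex.exp (θ * x * Complex.I))
        (futureLaw ν hg (k + 1) ξ) := by
      refine Integrable.of_bound (by fun_prop) 1 (ae_of_all _ fun x => ?_)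
      rw [← Complex.ofReal_mul, Complex.norm_exp_ofReal_mul_I]
    rw [charFun_apply_real]
    rw [futureLaw] at hi ⊢
    rw [Kernel.integral_comp hi, stepKernel_apply,
      integral_map (measurable_push_left ξ).aemeasurable, Function.iterate_succ_apply', step]
    · exact integral_congr_ae (ae_of_all _ fun e => by
        dsimp only; rw [← ih, charFun_apply_real])
    · have : (fun ζ => ∫ y, Complex.exp (θ * y * Complex.I) ∂(futureLaw ν hg k ζ)) =
          (step ν)^[k] (expFun g θ) := by
        funext ζ; rw [← ih, charFun_apply_real]
      rw [this]
      exact (measurable_iterate_step (measurable_expFun hg θ) k).aestronglyMeasurable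

end Kernels

/-! ### From the probability space to the chain -/

section Bridge

variable {Ω : Type*} [MeasurableSpace Ω] {P : Measure Ω} [IsProbabilityMeasure P]
  {ε : ℤ → Ω → ℝ} {ε' : Ω → ℝ}

lemma iIndepFun_indepFun_pi {ι κ : Type*} {X : ι → Ω → ℝ} (hX : ∀ i, Measurable (X i))
    (hi : iIndepFun X P) (a : κ → ι) (i : ι) (ha : ∀ j, a j ≠ i) :
    IndepFun (fun ω j => X (a j) ω) (X i) P := by
  have h1 := indep_iSup_of_disjoint (fun j => (hX j).comap_le) hi
    (S := Set.range a) (T := {i}) (by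
      rw [Set.disjoint_singleton_right]; rintro ⟨j, hj⟩; exact ha j hj)
  refine indep_of_indep_of_le h1 ?_ ?_
  · rw [← measurable_iff_comap_le]
    refine @measurable_pi_lambda _ _ _ (_) _ _ fun j => ?_
    rw [measurable_iff_comap_le]
    exact le_iSup₂_of_le (a j) ⟨j, rfl⟩ le_rfl
  · exact le_iSup₂_of_le i rfl le_rfl

/-- The common law of the innovations. -/
noncomputable def innovLaw (P : Measure Ω) (ε : ℤ → Ω → ℝ) : Measure ℝ := P.map (ε 0)

/-- The common law of the histories. -/
noncomputable def pastLaw (P : Measure Ω) (ε : ℤ → Ω → ℝ) : Measure (ℕ → ℝ) := P.map (past ε 0)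

lemma coupledPast_eq (ω : Ω) : coupledPast ε ε' 0 ω = push (ε' ω) (pop (past ε 0 ω)) := by
  funext n
  cases n with
  | zero => simp [coupledPast, past, push]
  | succ n =>
    simp only [coupledPast, past, push, pop]
    rw [Function.update_of_ne]
    push_cast; omega

lemma iterate_pop_past (k : ℕ) (j : ℤ) (ω : Ω) : pop^[k] (past ε (j + k) ω) = past ε j ω := by
  induction k with
  | zero => simp
  | succ k ih =>
    rw [Function.iterate_succ_apply]; push_cast
    rw [← add_assoc, pop_past, ih]

section

variable (hiid : IsIID P ε ε')
include hiid

lemma IsIID.measurable_eps (i : ℤ) : Measurable (ε i) := hiid.measurable (some i)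

lemma IsIID.measurable_past (k : ℤ) : Measurable (past ε k) :=
  measurable_pi_lambda _ fun j => hiid.measurable_eps (k - j)

lemma IsIID.measurable_eps' : Measurable ε' := hiid.measurable none

lemma IsIID.isProbabilityMeasure_innovLaw : IsProbabilityMeasure (innovLaw P ε) :=
  Measure.isProbabilityMeasure_map (hiid.measurable_eps 0).aemeasurable

lemma IsIID.isProbabilityMeasure_pastLaw : IsProbabilityMeasure (pastLaw P ε) :=
  Measure.isProbabilityMeasure_map (hiid.measurable_past 0).aemeasurable

lemma IsIID.map_innovations (i : Option ℤ) : P.map (innovations ε ε' i) = innovLaw P ε :=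
  (hiid.ident i (some 0)).map_eq

/-- Every history is an i.i.d. sequence, so its law is the infinite product of the innovation law,
whatever the time. -/
lemma IsIID.map_past (k : ℤ) : P.map (past ε k) = pastLaw P ε := by
  have : ∀ k : ℤ, P.map (past ε k) = Measure.infinitePi fun _ : ℕ => innovLaw P ε := by
    intro k
    have hinj : Function.Injective fun j : ℕ => some (k - j) := by
      intro i j hij
      simp only [Option.some.injEq] at hij
      omega
    have h1 := (hiid.indep.precomp hinj).map_fun_eq_infinitePi_map fun j => hiid.measurable _
    simp only [hiid.map_innovations] at h1
    exact h1
  rw [this, pastLaw, this]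

lemma IsIID.measurePreserving_past (k : ℤ) : MeasurePreserving (past ε k) P (pastLaw P ε) :=
  ⟨hiid.measurable_past k, hiid.map_past k⟩

lemma IsIID.map_past_prod (k : ℤ) (i : Option ℤ) (hi : ∀ j : ℕ, some (k - j) ≠ i) :
    P.map (fun ω => (past ε k ω, innovations ε ε' i ω)) =
      (pastLaw P ε).prod (innovLaw P ε) := by
  have h1 := iIndepFun_indepFun_pi hiid.measurable hiid.indep (fun j : ℕ => some (k - j)) i hi
  have h2 := h1.map_prod_eq_prod_map_map (hiid.measurable_past k).aemeasurable
    (hiid.measurable i).aemeasurable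
  rw [hiid.map_innovations] at h2
  rw [← hiid.map_past k]
  exact h2

lemma IsIID.historyLaw : HistoryLaw (innovLaw P ε) (pastLaw P ε) := by
  refine ⟨measurable_push, ?_⟩
  rw [← hiid.map_past_prod (-1) (some 0) (fun j => by simp only [ne_eq, Option.some.injEq]; omega),
    Measure.map_map measurable_push
      ((hiid.measurable_past (-1)).prodMk (hiid.measurable (some 0)))]
  rw [pastLaw]
  congr 1
  funext ω
  exact (past_eq_push ε (-1) ω).symm

lemma IsIID.map_past_eps' :
    P.map (fun ω => (past ε 0 ω, ε' ω)) = (pastLaw P ε).prod (innovLaw P ε) :=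
  hiid.map_past_prod 0 none (fun j => by simp)

/-- Uniqueness of regular conditional distributions, the joint law being computed at time `k`, where
`pop^[k]` recovers `ξ_0`. -/
lemma IsIID.condLaw_ae_eq [IsProbabilityMeasure (innovLaw P ε)] {g : (ℕ → ℝ) → ℝ}
    (hg : Measurable g) (k : ℕ) :
    ∀ᵐ ξ ∂(pastLaw P ε), condLaw P g ε k ξ = futureLaw (innovLaw P ε) hg k ξ := by
  have := hiid.isProbabilityMeasure_pastLaw
  have hp : Measurable (process g ε k) := hg.comp (hiid.measurable_past k)
  refine condDistrib_ae_eq_of_measure_eq_compProd _ hp.aemeasurable ?_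
  refine Measure.ext_of_lintegral _ fun F hF => ?_
  change _ = ∫⁻ a, F a ∂(pastLaw P ε ⊗ₘ futureLaw (innovLaw P ε) hg k)
  rw [lintegral_map hF ((hiid.measurable_past 0).prodMk hp), Measure.lintegral_compProd hF,
    hiid.historyLaw.lintegral_futureLaw hg k hF]
  have hm : Measurable fun ξ => F (pop^[k] ξ, g ξ) :=
    hF.comp ((measurable_pop.iterate k).prodMk hg)
  rw [← (hiid.measurePreserving_past k).lintegral_comp hm]
  refine lintegral_congr fun ω => ?_
  have := iterate_pop_past (ε := ε) k 0 ω
  rw [zero_add] at this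
  rw [this]; rfl

end

end Bridge

/-! ### Inequalities of Jensen and Minkowski, and the martingale layers -/

lemma sq_lintegral_le_lintegral_sq {α : Type*} [MeasurableSpace α] {μ : Measure α}
    [IsProbabilityMeasure μ] {F : α → ℂ} (hF : AEStronglyMeasurable F μ) :
    (∫⁻ a, ‖F a‖ₑ ∂μ) ^ 2 ≤ ∫⁻ a, ‖F a‖ₑ ^ 2 ∂μ := by
  rw [← eLpNorm_two_sq, ← eLpNorm_one_eq_lintegral_enorm]
  exact pow_le_pow_left' (eLpNorm_le_eLpNorm_of_exponent_le (by norm_num) hF) 2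

/-- Minkowski's inequality for countable sums of nonnegative functions. -/
lemma sqrt_lintegral_sq_tsum_le {α : Type*} [MeasurableSpace α] {μ : Measure α}
    {F : ℕ → α → ℝ≥0∞} (hF : ∀ k, Measurable (F k)) :
    (∫⁻ a, (∑' k, F k a) ^ (2 : ℝ) ∂μ) ^ (1 / 2 : ℝ) ≤
      ∑' k, (∫⁻ a, F k a ^ (2 : ℝ) ∂μ) ^ (1 / 2 : ℝ) := by
  have hfin : ∀ n, (∫⁻ a, (∑ k ∈ Finset.range n, F k a) ^ (2 : ℝ) ∂μ) ^ (1 / 2 : ℝ) ≤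
      ∑ k ∈ Finset.range n, (∫⁻ a, F k a ^ (2 : ℝ) ∂μ) ^ (1 / 2 : ℝ) := by
    intro n
    induction n with
    | zero => simp
    | succ n ih =>
      simp only [Finset.sum_range_succ]
      refine le_trans ?_ (add_le_add_left ih _)
      exact ENNReal.lintegral_Lp_add_le (f := fun a => ∑ k ∈ Finset.range n, F k a)
        (Finset.measurable_fun_sum _ fun k _ => hF k).aemeasurable (hF n).aemeasurable (by norm_num)
  have hsup : ∫⁻ a, (∑' k, F k a) ^ (2 : ℝ) ∂μ =
      ⨆ n, ∫⁻ a, (∑ k ∈ Finset.range n, F k a) ^ (2 : ℝ) ∂μ := by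
    rw [← lintegral_iSup]
    · refine lintegral_congr fun a => ?_
      rw [ENNReal.tsum_eq_iSup_nat]
      exact (ENNReal.orderIsoRpow 2 (by norm_num)).map_iSup _
    · exact fun n => (Finset.measurable_fun_sum _ fun k _ => hF k).pow_const _
    · intro m n hmn a
      exact ENNReal.rpow_le_rpow (Finset.sum_le_sum_of_subset (Finset.range_mono hmn)) (by norm_num)
  rw [hsup]
  have : (⨆ n, ∫⁻ a, (∑ k ∈ Finset.range n, F k a) ^ (2 : ℝ) ∂μ) ^ (1 / 2 : ℝ) =
      ⨆ n, (∫⁻ a, (∑ k ∈ Finset.range n, F k a) ^ (2 : ℝ) ∂μ) ^ (1 / 2 : ℝ) :=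
    (ENNReal.orderIsoRpow (1 / 2) (by norm_num)).map_iSup _
  rw [this]
  exact iSup_le fun n => (hfin n).trans (ENNReal.sum_le_tsum _)

section Layers

variable {ν : Measure ℝ} {ρ : Measure (ℕ → ℝ)} [IsProbabilityMeasure ν] [IsProbabilityMeasure ρ]
  {g : (ℕ → ℝ) → ℝ}

/-- The conditional characteristic function of `g` after `k` further innovations. -/
noncomputable def condChar (ν : Measure ℝ) (g : (ℕ → ℝ) → ℝ) (k : ℕ) (θ : ℝ) (ξ : ℕ → ℝ) : ℂ :=
  (step ν)^[k] (expFun g θ) ξ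

lemma condChar_succ (k : ℕ) (θ : ℝ) (ξ : ℕ → ℝ) :
    condChar ν g (k + 1) θ ξ = ∫ e, condChar ν g k θ (push e ξ) ∂ν := by
  rw [condChar, Function.iterate_succ_apply']; rfl

lemma norm_condChar_le (k : ℕ) (θ : ℝ) (ξ : ℕ → ℝ) : ‖condChar ν g k θ ξ‖ ≤ 1 :=
  norm_iterate_step_le (norm_expFun_le θ) k ξ

lemma measurable_condChar (hg : Measurable g) (k : ℕ) :
    Measurable fun p : ℝ × (ℕ → ℝ) => condChar ν g k p.1 p.2 := by
  induction k with
  | zero =>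
    have : Measurable fun p : ℝ × (ℕ → ℝ) => g p.2 := hg.comp measurable_snd
    change Measurable fun p : ℝ × (ℕ → ℝ) => Complex.exp (p.1 * g p.2 * Complex.I)
    fun_prop
  | succ k ih =>
    simp only [condChar_succ]
    have hm : Measurable fun q : (ℝ × (ℕ → ℝ)) × ℝ => condChar ν g k q.1.1 (push q.2 q.1.2) :=
      ih.comp ((measurable_fst.comp measurable_fst).prodMk
        (measurable_push.comp ((measurable_snd.comp measurable_fst).prodMk measurable_snd)))
    exact (hm.stronglyMeasurable.integral_prod_right'
      (f := fun q : (ℝ × (ℕ → ℝ)) × ℝ => condChar ν g k q.1.1 (push q.2 q.1.2))).measurable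

lemma measurable_condChar_right (hg : Measurable g) (k : ℕ) (θ : ℝ) :
    Measurable (condChar ν g k θ) := (measurable_condChar hg k).comp measurable_prodMk_left

/-- The martingale difference of the conditional characteristic functions at horizon `k`. -/
noncomputable def charDiff (ν : Measure ℝ) (g : (ℕ → ℝ) → ℝ) (k : ℕ) (θ : ℝ) (ξ : ℕ → ℝ) : ℂ :=
  condChar ν g k θ ξ - condChar ν g (k + 1) θ (pop ξ)

lemma norm_charDiff_le (k : ℕ) (θ : ℝ) (ξ : ℕ → ℝ) : ‖charDiff ν g k θ ξ‖ ≤ 2 :=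
  (norm_sub_le _ _).trans (by
    linarith [norm_condChar_le (ν := ν) (g := g) k θ ξ,
      norm_condChar_le (ν := ν) (g := g) (k + 1) θ (pop ξ)])

lemma measurable_charDiff (hg : Measurable g) (k : ℕ) :
    Measurable fun p : ℝ × (ℕ → ℝ) => charDiff ν g k p.1 p.2 :=
  (measurable_condChar hg k).sub ((measurable_condChar hg (k + 1)).comp
    (measurable_fst.prodMk (measurable_pop.comp measurable_snd)))

lemma measurable_charDiff_right (hg : Measurable g) (k : ℕ) (θ : ℝ) :
    Measurable (charDiff ν g k θ) :=
  (measurable_condChar_right hg k θ).sub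
    ((measurable_condChar_right hg (k + 1) θ).comp measurable_pop)

lemma integrable_condChar_push (hg : Measurable g) (k : ℕ) (θ : ℝ) (ξ : ℕ → ℝ) :
    Integrable (fun e => condChar ν g k θ (push e ξ)) ν :=
  integrable_push (measurable_condChar_right hg k θ) (norm_condChar_le k θ) ξ

lemma integral_charDiff_push (hg : Measurable g) (k : ℕ) (θ : ℝ) (ξ : ℕ → ℝ) :
    ∫ e, charDiff ν g k θ (push e ξ) ∂ν = 0 := by
  simp only [charDiff, pop_push]
  rw [integral_sub (integrable_condChar_push hg k θ ξ) (integrable_const _), condChar_succ]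
  simp

/-- The difference at horizon `k` is the mean, over a resampled newest innovation, of the change in
`condChar`; Jensen's inequality moves the square inside this mean. -/
lemma eLpNorm_charDiff_sq_le (h : HistoryLaw ν ρ) (hg : Measurable g) (k : ℕ) (θ : ℝ) :
    eLpNorm (charDiff ν g k θ) 2 ρ ≤
      eLpNorm (fun p : (ℕ → ℝ) × ℝ => condChar ν g k θ p.1 - condChar ν g k θ (push p.2 (pop p.1)))
        2 (ρ.prod ν) := by
  have hm := measurable_condChar_right (ν := ν) hg k θ
  have hm2 : Measurable fun p : (ℕ → ℝ) × ℝ =>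
      condChar ν g k θ p.1 - condChar ν g k θ (push p.2 (pop p.1)) :=
    (hm.comp measurable_fst).sub (hm.comp (measurable_push.comp
      ((measurable_pop.comp measurable_fst).prodMk measurable_snd)))
  rw [← ENNReal.pow_le_pow_left_iff two_ne_zero, eLpNorm_two_sq, eLpNorm_two_sq,
    lintegral_prod _ (hm2.enorm.pow_const 2).aemeasurable,
    h.lintegral_eq ((measurable_charDiff_right hg k θ).enorm.pow_const 2),
    h.lintegral_eq (hm2.enorm.pow_const 2).lintegral_prod_right']
  refine lintegral_mono fun ξ => lintegral_mono fun e' => ?_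
  simp only [charDiff, pop_push]
  have hi := integrable_condChar_push (ν := ν) hg k θ ξ
  have h1 : condChar ν g k θ (push e' ξ) - condChar ν g (k + 1) θ ξ =
      ∫ e, (condChar ν g k θ (push e' ξ) - condChar ν g k θ (push e ξ)) ∂ν := by
    rw [integral_sub (integrable_const _) hi, condChar_succ]; simp
  rw [h1]
  refine (pow_le_pow_left' (enorm_integral_le_lintegral_enorm _) 2).trans ?_
  exact sq_lintegral_le_lintegral_sq ((integrable_const _).sub hi).aestronglyMeasurable

end Layers

/-! ### Maximal energy of the characteristic function sums -/

section Coupling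

variable {Ω : Type*} [MeasurableSpace Ω] {P : Measure Ω} [IsProbabilityMeasure P]
  {ε : ℤ → Ω → ℝ} {ε' : Ω → ℝ} {g : (ℕ → ℝ) → ℝ}

lemma IsIID.condCharFun_ae_eq (hiid : IsIID P ε ε') (hg : Measurable g) (k : ℕ) (θ : ℝ) :
    ∀ᵐ ξ ∂(pastLaw P ε), condCharFun P g ε k θ ξ = condChar (innovLaw P ε) g k θ ξ := by
  have := hiid.isProbabilityMeasure_innovLaw
  filter_upwards [hiid.condLaw_ae_eq hg k] with ξ hξ
  rw [condCharFun, hξ, charFun_futureLaw]; rfl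

/-- Needed because `condCharFun` is determined only up to null sets of the law of `ξ_0`: the coupled
history must have this law too before `condCharFun` may be replaced by `condChar` there. -/
lemma IsIID.measurePreserving_coupledPast (hiid : IsIID P ε ε') :
    MeasurePreserving (coupledPast ε ε' 0) P (pastLaw P ε) := by
  have := hiid.isProbabilityMeasure_innovLaw
  have := hiid.isProbabilityMeasure_pastLaw
  have h1 : MeasurePreserving (fun ω => (past ε (-1) ω, ε' ω)) P
      ((pastLaw P ε).prod (innovLaw P ε)) :=
    ⟨(hiid.measurable_past (-1)).prodMk hiid.measurable_eps',
      hiid.map_past_prod (-1) none fun j => by simp⟩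
  have h2 := hiid.historyLaw.comp h1
  have h3 : coupledPast ε ε' 0 = (fun p : (ℕ → ℝ) × ℝ => push p.2 p.1) ∘
      fun ω => (past ε (-1) ω, ε' ω) := by
    funext ω
    have h4 := pop_past ε (-1) ω
    rw [neg_add_cancel] at h4
    rw [coupledPast_eq, h4]; rfl
  rw [h3]; exact h2

lemma IsIID.eLpNorm_charDiff_le (hiid : IsIID P ε ε') (hg : Measurable g) (k : ℕ) (θ : ℝ) :
    eLpNorm (charDiff (innovLaw P ε) g k θ) 2 (pastLaw P ε) ≤
      eLpNorm (fun ω => condCharFun P g ε k θ (past ε 0 ω)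
        - condCharFun P g ε k θ (coupledPast ε ε' 0 ω)) 2 P := by
  have := hiid.isProbabilityMeasure_innovLaw
  have := hiid.isProbabilityMeasure_pastLaw
  have hae := hiid.condCharFun_ae_eq hg k θ
  have h1 : (fun ω => condCharFun P g ε k θ (past ε 0 ω)
        - condCharFun P g ε k θ (coupledPast ε ε' 0 ω)) =ᵐ[P]
      (fun p : (ℕ → ℝ) × ℝ => condChar (innovLaw P ε) g k θ p.1 -
        condChar (innovLaw P ε) g k θ (push p.2 (pop p.1))) ∘ fun ω => (past ε 0 ω, ε' ω) := by
    filter_upwards [(hiid.measurePreserving_past 0).quasiMeasurePreserving.ae hae,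
      hiid.measurePreserving_coupledPast.quasiMeasurePreserving.ae hae] with ω h1 h2
    rw [h1, h2, Function.comp_apply, coupledPast_eq]
  have hmp : MeasurePreserving (fun ω => (past ε 0 ω, ε' ω)) P
      ((pastLaw P ε).prod (innovLaw P ε)) :=
    ⟨(hiid.measurable_past 0).prodMk hiid.measurable_eps', hiid.map_past_eps'⟩
  have hm := measurable_condChar_right (ν := innovLaw P ε) hg k θ
  have hm2 : Measurable fun p : (ℕ → ℝ) × ℝ => condChar (innovLaw P ε) g k θ p.1 -
      condChar (innovLaw P ε) g k θ (push p.2 (pop p.1)) :=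
    (hm.comp measurable_fst).sub (hm.comp (measurable_push.comp
      ((measurable_pop.comp measurable_fst).prodMk measurable_snd)))
  rw [eLpNorm_congr_ae h1, eLpNorm_comp_measurePreserving hm2.aestronglyMeasurable hmp]
  exact eLpNorm_charDiff_sq_le hiid.historyLaw hg k θ

/-- The centred sum of the one-step conditional characteristic functions. -/
noncomputable def charSum (P : Measure Ω) (g : (ℕ → ℝ) → ℝ) (ε : ℤ → Ω → ℝ) (n : ℕ) (θ : ℝ)
    (ω : Ω) : ℂ :=
  ∑ i ∈ Finset.range n,
    (condChar (innovLaw P ε) g 1 θ (past ε i ω) - ∫ ξ, expFun g θ ξ ∂(pastLaw P ε))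

/-- The running maximum of the norms of `charSum`. -/
noncomputable def charMax (P : Measure Ω) (g : (ℕ → ℝ) → ℝ) (ε : ℤ → Ω → ℝ) (N : ℕ) (θ : ℝ)
    (ω : Ω) : ℝ :=
  (Finset.range (N + 1)).sup' Finset.nonempty_range_add_one fun n => ‖charSum P g ε n θ ω‖

/-- Telescoping over the horizon: `φ_1(ξ_i)` is the sum over `k < K` of `φ_{k+1}(ξ_{i-k}) -
φ_{k+2}(ξ_{i-k-1})`, plus `φ_{K+1}(ξ_{i-K})`. For fixed `k` the terms are martingale differences in
`i`. The index `i - k` is written in the shape that `norm_sum_le_runMax` expects. -/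
lemma charSum_eq (K n : ℕ) (θ : ℝ) (ω : Ω) :
    charSum P g ε n θ ω =
      (∑ k ∈ Finset.range K, ∑ i ∈ Finset.range n,
        charDiff (innovLaw P ε) g (k + 1) θ (past ε (-k - 1 + i + 1) ω)) +
      ∑ i ∈ Finset.range n, (condChar (innovLaw P ε) g (K + 1) θ (past ε (i - K) ω) -
        ∫ ξ, expFun g θ ξ ∂(pastLaw P ε)) := by
  rw [Finset.sum_comm, ← Finset.sum_add_distrib, charSum]
  refine Finset.sum_congr rfl fun i _ => ?_
  induction K with
  | zero => simp
  | succ K ih =>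
    rw [ih, Finset.sum_range_succ, charDiff]
    have e1 : (-(K : ℤ) - 1 + i + 1) = i - K := by ring
    have e2 : pop (past ε (i - K) ω) = past ε (i - (K + 1 : ℕ)) ω := by
      rw [← pop_past ε (i - (K + 1 : ℕ))]; push_cast; congr 2; ring
    rw [e1, e2]; ring

lemma charMax_le (K N : ℕ) (θ : ℝ) (ω : Ω) :
    charMax P g ε N θ ω ≤
      (∑ k ∈ Finset.range K,
        runMax (charDiff (innovLaw P ε) g (k + 1) θ) N (past ε (-k - 1 + N) ω)) +
      ∑ i ∈ Finset.range N, ‖condChar (innovLaw P ε) g (K + 1) θ (past ε (i - K) ω) -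
        ∫ ξ, expFun g θ ξ ∂(pastLaw P ε)‖ := by
  refine Finset.sup'_le _ _ fun n hn => ?_
  have hn' : n ≤ N := by simpa [Nat.lt_succ_iff] using hn
  rw [charSum_eq K]
  refine (norm_add_le _ _).trans (add_le_add ?_ ?_)
  · refine (norm_sum_le _ _).trans (Finset.sum_le_sum fun k _ => ?_)
    exact norm_sum_le_runMax ε _ _ hn' ω
  · refine (norm_sum_le _ _).trans ?_
    exact Finset.sum_le_sum_of_subset_of_nonneg (Finset.range_mono hn') fun _ _ _ => norm_nonneg _

lemma charMax_nonneg (N : ℕ) (θ : ℝ) (ω : Ω) : 0 ≤ charMax P g ε N θ ω :=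
  (norm_nonneg _).trans (Finset.le_sup' (fun n => ‖charSum P g ε n θ ω‖)
    (Finset.mem_range.2 N.succ_pos))

lemma norm_charSum_le_charMax {n N : ℕ} (hn : n ≤ N) (θ : ℝ) (ω : Ω) :
    ‖charSum P g ε n θ ω‖ ≤ charMax P g ε N θ ω :=
  Finset.le_sup' (fun n => ‖charSum P g ε n θ ω‖) (Finset.mem_range.2 (Nat.lt_succ_of_le hn))

lemma IsIID.measurable_charSum (hiid : IsIID P ε ε') (hg : Measurable g) (n : ℕ) :
    Measurable fun p : ℝ × Ω => charSum P g ε n p.1 p.2 := by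
  have := hiid.isProbabilityMeasure_innovLaw
  have := hiid.isProbabilityMeasure_pastLaw
  have h1 : ∀ i : ℕ, Measurable fun p : ℝ × Ω => (p.1, past ε i p.2) := fun i =>
    measurable_fst.prodMk ((hiid.measurable_past i).comp measurable_snd)
  have h2 := fun i => (measurable_condChar (ν := innovLaw P ε) hg 1).comp (h1 i)
  have h3 : Measurable fun p : ℝ × (ℕ → ℝ) => expFun g p.1 p.2 :=
    measurable_condChar (ν := innovLaw P ε) hg 0
  have h4 : Measurable fun θ : ℝ => ∫ ξ, expFun g θ ξ ∂(pastLaw P ε) :=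
    (h3.stronglyMeasurable.integral_prod_right' (ν := pastLaw P ε)).measurable
  have h5 : Measurable fun p : ℝ × Ω => ∫ ξ, expFun g p.1 ξ ∂(pastLaw P ε) :=
    h4.comp measurable_fst
  exact Finset.measurable_fun_sum _ fun i _ => (h2 i).sub h5

lemma IsIID.measurable_charMax (hiid : IsIID P ε ε') (hg : Measurable g) (N : ℕ) :
    Measurable fun p : ℝ × Ω => charMax P g ε N p.1 p.2 := by
  have := Finset.measurable_sup' (Finset.nonempty_range_add_one (n := N))
    (f := fun n (p : ℝ × Ω) => ‖charSum P g ε n p.1 p.2‖)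
    (fun n _ => (hiid.measurable_charSum hg n).norm)
  convert! this using 1
  funext p
  simp [charMax, Finset.sup'_apply]

/-- Doob bounds each layer by `2 √N` times the norm of one increment. With `N` fixed and `K → ∞`,
the `N` remainder terms vanish in `L²` since the chain forgets its past. -/
lemma IsIID.eLpNorm_charMax_le (hiid : IsIID P ε ε') (hg : Measurable g) (N : ℕ) (θ : ℝ) :
    eLpNorm (charMax P g ε N θ) 2 P ≤ ENNReal.ofReal (2 * √N) *
      ∑' k, eLpNorm (charDiff (innovLaw P ε) g (k + 1) θ) 2 (pastLaw P ε) := by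
  have := hiid.isProbabilityMeasure_innovLaw
  have := hiid.isProbabilityMeasure_pastLaw
  set ν := innovLaw P ε
  set ρ := pastLaw P ε
  set c := ∫ ξ, expFun g θ ξ ∂ρ
  have hbound : ∀ K, eLpNorm (charMax P g ε N θ) 2 P ≤ ENNReal.ofReal (2 * √N) *
      ∑' k, eLpNorm (charDiff ν g (k + 1) θ) 2 ρ +
        N * eLpNorm (fun ξ => condChar ν g (K + 1) θ ξ - c) 2 ρ := by
    intro K
    have hrm : ∀ k, Measurable (runMax (charDiff ν g (k + 1) θ) N) := fun k =>
      measurable_runMax (measurable_charDiff_right hg (k + 1) θ) N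
    have hcm : Measurable fun ξ => condChar ν g (K + 1) θ ξ - c :=
      (measurable_condChar_right hg (K + 1) θ).sub_const c
    set A : Ω → ℝ := ∑ k ∈ Finset.range K,
      (runMax (charDiff ν g (k + 1) θ) N ∘ past ε (-k - 1 + N)) with hA
    set D : Ω → ℝ := ∑ i ∈ Finset.range N,
      ((fun ξ => ‖condChar ν g (K + 1) θ ξ - c‖) ∘ past ε (i - K)) with hD
    have hAm : ∀ k ∈ Finset.range K, AEStronglyMeasurable
        (runMax (charDiff ν g (k + 1) θ) N ∘ past ε (-k - 1 + N)) P := fun k _ =>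
      ((hrm k).comp (hiid.measurable_past _)).aestronglyMeasurable
    have hDm : ∀ i ∈ Finset.range N, AEStronglyMeasurable
        ((fun ξ => ‖condChar ν g (K + 1) θ ξ - c‖) ∘ past ε (i - K)) P := fun i _ =>
      (hcm.norm.comp (hiid.measurable_past _)).aestronglyMeasurable
    have h1 : eLpNorm (charMax P g ε N θ) 2 P ≤ eLpNorm (A + D) 2 P := by
      refine eLpNorm_mono_real fun ω => ?_
      rw [Real.norm_of_nonneg (charMax_nonneg N θ ω)]
      simpa [hA, hD] using charMax_le (P := P) (g := g) (ε := ε) K N θ ω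
    refine h1.trans ((eLpNorm_add_le (Finset.aestronglyMeasurable_sum _ hAm)
      (Finset.aestronglyMeasurable_sum _ hDm) (by norm_num)).trans (add_le_add ?_ ?_))
    · refine (eLpNorm_sum_le hAm (by norm_num)).trans ?_
      refine le_trans (Finset.sum_le_sum fun k _ => ?_)
        (le_trans (Finset.mul_sum _ _ _).symm.le
          (mul_le_mul_right (ENNReal.sum_le_tsum (Finset.range K)) _))
      rw [eLpNorm_comp_measurePreserving (hrm k).aestronglyMeasurable
        (hiid.measurePreserving_past _)]
      exact eLpNorm_runMax_le hiid.historyLaw (measurable_charDiff_right hg (k + 1) θ) zero_le_two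
        (norm_charDiff_le (k + 1) θ) (integral_charDiff_push hg (k + 1) θ) N
    · refine (eLpNorm_sum_le hDm (by norm_num)).trans (le_of_eq ?_)
      rw [Finset.sum_congr rfl fun i _ => by
        rw [eLpNorm_comp_measurePreserving hcm.norm.aestronglyMeasurable
          (hiid.measurePreserving_past _), eLpNorm_norm]]
      simp [ρ]
  have ht : Tendsto (fun K => eLpNorm (fun ξ => condChar ν g (K + 1) θ ξ - c) 2 ρ) atTop (𝓝 0) :=
    (tendsto_eLpNorm_iterate_step_sub hiid.historyLaw (measurable_expFun hg θ)
      (norm_expFun_le θ)).comp (tendsto_add_atTop_nat 1)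
  have ht2 := (ENNReal.Tendsto.const_mul (a := (N : ℝ≥0∞)) ht
    (Or.inr (ENNReal.natCast_ne_top N))).const_add
      (ENNReal.ofReal (2 * √N) * ∑' k, eLpNorm (charDiff ν g (k + 1) θ) 2 ρ)
  rw [mul_zero, add_zero] at ht2
  exact ge_of_tendsto' ht2 hbound

/-- The sum in the short-range dependence condition. -/
noncomputable def shortRangeSum (P : Measure Ω) [IsFiniteMeasure P] (g : (ℕ → ℝ) → ℝ)
    (ε : ℤ → Ω → ℝ) (ε' : Ω → ℝ) : ℝ≥0∞ :=
  ∑' k : ℕ, (∫⁻ θ : ℝ, ENNReal.ofReal (1 + θ ^ 2) *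
    (eLpNorm (fun ω => condCharFun P g ε (k + 1) θ (past ε 0 ω)
      - condCharFun P g ε (k + 1) θ (coupledPast ε ε' 0 ω)) 2 P) ^ 2) ^ (1 / 2 : ℝ)

/-- The weighted `L²` energy of the running maximum of the characteristic function sums. -/
noncomputable def maxEnergy (P : Measure Ω) (g : (ℕ → ℝ) → ℝ) (ε : ℤ → Ω → ℝ) (N : ℕ)
    (ω : Ω) : ℝ≥0∞ :=
  ∫⁻ θ : ℝ, ENNReal.ofReal (1 + θ ^ 2) * ‖charMax P g ε N θ ω‖ₑ ^ 2

lemma IsIID.measurable_weight_charMax (hiid : IsIID P ε ε') (hg : Measurable g) (N : ℕ) :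
    Measurable fun p : ℝ × Ω =>
      ENNReal.ofReal (1 + p.1 ^ 2) * ‖charMax P g ε N p.1 p.2‖ₑ ^ 2 := by
  refine Measurable.mul ?_ ((hiid.measurable_charMax hg N).enorm.pow_const 2)
  exact ((measurable_fst.pow_const 2).const_add 1).ennreal_ofReal

lemma IsIID.measurable_maxEnergy (hiid : IsIID P ε ε') (hg : Measurable g) (N : ℕ) :
    Measurable (maxEnergy P g ε N) :=
  (hiid.measurable_weight_charMax hg N).lintegral_prod_left'

/-- Tonelli brings the expectation inside the integral over `θ`; after the maximal bound, Minkowski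
in `L²((1 + θ²) dθ)` takes the sum over horizons out of the norm, which leaves the sum of the
dependence condition. -/
lemma IsIID.lintegral_maxEnergy_le (hiid : IsIID P ε ε') (hg : Measurable g) (N : ℕ) :
    ∫⁻ ω, maxEnergy P g ε N ω ∂P ≤ 4 * N * shortRangeSum P g ε ε' ^ 2 := by
  have := hiid.isProbabilityMeasure_innovLaw
  have := hiid.isProbabilityMeasure_pastLaw
  have hw : Measurable fun θ : ℝ => ENNReal.ofReal (1 + θ ^ 2) :=
    ((measurable_id.pow_const 2).const_add 1).ennreal_ofReal
  set μ : Measure ℝ := volume.withDensity fun θ => ENNReal.ofReal (1 + θ ^ 2) with hμ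
  set G : ℕ → ℝ → ℝ≥0∞ := fun k θ =>
    eLpNorm (charDiff (innovLaw P ε) g (k + 1) θ) 2 (pastLaw P ε) with hG
  have hGsq : ∀ k θ, G k θ = (∫⁻ ξ, ‖charDiff (innovLaw P ε) g (k + 1) θ ξ‖ₑ ^ 2
      ∂(pastLaw P ε)) ^ (1 / 2 : ℝ) := by
    intro k θ
    rw [← eLpNorm_two_sq, ← ENNReal.rpow_natCast, ← ENNReal.rpow_mul]; simp [hG]
  have hGm : ∀ k, Measurable (G k) := by
    intro k
    have h1 := ((measurable_charDiff (ν := innovLaw P ε) hg (k + 1)).enorm.pow_const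
      2).lintegral_prod_right' (ν := pastLaw P ε)
    have h2 : G k = fun θ => (∫⁻ ξ, ‖charDiff (innovLaw P ε) g (k + 1) θ ξ‖ₑ ^ 2
      ∂(pastLaw P ε)) ^ (1 / 2 : ℝ) := funext (hGsq k)
    rw [h2]
    exact h1.pow_const _
  calc ∫⁻ ω, maxEnergy P g ε N ω ∂P
      = ∫⁻ θ : ℝ, ∫⁻ ω, ENNReal.ofReal (1 + θ ^ 2) * ‖charMax P g ε N θ ω‖ₑ ^ 2 ∂P := by
        unfold maxEnergy
        rw [lintegral_lintegral_swap]
        exact ((hiid.measurable_weight_charMax hg N).comp measurable_swap).aemeasurable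
    _ = ∫⁻ θ : ℝ, ENNReal.ofReal (1 + θ ^ 2) * eLpNorm (charMax P g ε N θ) 2 P ^ 2 := by
        refine lintegral_congr fun θ => ?_
        rw [eLpNorm_two_sq, lintegral_const_mul]
        exact ((hiid.measurable_charMax hg N).comp measurable_prodMk_left).enorm.pow_const 2
    _ ≤ ∫⁻ θ : ℝ, ENNReal.ofReal (1 + θ ^ 2) * (4 * N * (∑' k, G k θ) ^ (2 : ℝ)) := by
        refine lintegral_mono fun θ => mul_le_mul_right ?_ _
        refine (pow_le_pow_left' (hiid.eLpNorm_charMax_le hg N θ) 2).trans (le_of_eq ?_)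
        rw [mul_pow, ← ENNReal.ofReal_pow (by positivity), mul_pow, Real.sq_sqrt (by positivity),
          ENNReal.ofReal_mul (by norm_num), ENNReal.ofReal_natCast]
        norm_num [hG]
    _ = 4 * N * ∫⁻ θ, (∑' k, G k θ) ^ (2 : ℝ) ∂μ := by
        rw [hμ, lintegral_withDensity_eq_lintegral_mul _ hw
          ((Measurable.tsum hGm).pow_const _), ← lintegral_const_mul]
        · refine lintegral_congr fun θ => ?_
          simp only [Pi.mul_apply]; ring
        · exact hw.mul ((Measurable.tsum hGm).pow_const _)
    _ ≤ 4 * N * shortRangeSum P g ε ε' ^ 2 := by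
        refine mul_le_mul_right ?_ _
        have h1 := sqrt_lintegral_sq_tsum_le (μ := μ) hGm
        have h2 : ∑' k, (∫⁻ a, G k a ^ (2 : ℝ) ∂μ) ^ (1 / 2 : ℝ) ≤ shortRangeSum P g ε ε' := by
          refine ENNReal.tsum_le_tsum fun k => ENNReal.rpow_le_rpow ?_ (by norm_num)
          rw [hμ, lintegral_withDensity_eq_lintegral_mul _ hw ((hGm k).pow_const _)]
          refine lintegral_mono fun θ => ?_
          simp only [Pi.mul_apply]
          refine mul_le_mul_right ?_ _
          have : G k θ ^ (2 : ℝ) = G k θ ^ 2 := by norm_num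
          rw [this]
          exact pow_le_pow_left' (hiid.eLpNorm_charDiff_le hg (k + 1) θ) 2
        have h3 := pow_le_pow_left' (h1.trans h2) 2
        rw [← ENNReal.rpow_natCast, ← ENNReal.rpow_mul] at h3
        simpa using h3

end Coupling

/-! ### Fourier inversion and a Sobolev bound -/

section Fourier

open FourierTransform SchwartzMap ContDiff

/-- Fourier inversion almost everywhere. -/
lemma ae_eq_fourierInv_fourier {H : ℝ → ℂ} (hH : Integrable H) (hF : Integrable (𝓕 H)) :
    ∀ᵐ x, H x = 𝓕⁻ (𝓕 H) x := by
  have hcont : Continuous (𝓕⁻ (𝓕 H)) := by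
    rw [Real.fourierInv_eq_fourier_comp_neg]
    exact VectorFourier.fourierIntegral_continuous Real.continuous_fourierChar
      (L := innerₗ ℝ) continuous_inner hF.comp_neg
  refine ae_eq_of_integral_contDiff_smul_eq hH.locallyIntegrable hcont.locallyIntegrable
    fun φ hφ hφc => ?_
  have hc : HasCompactSupport (fun x => (φ x : ℂ)) := hφc.comp_left (g := fun y : ℝ => (y : ℂ)) rfl
  let Φ : 𝓢(ℝ, ℂ) := hc.toSchwartzMap (Complex.ofRealCLM.contDiff.comp hφ)
  have hΦ : ∀ x, Φ x = (φ x : ℂ) := fun x => rfl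
  have flip : ∀ {u v : ℝ → ℂ}, Integrable u → Integrable v →
      ∫ x, 𝓕 u x • v x = ∫ x, u x • 𝓕 v x := fun {u v} hu hv => by
    simpa using! VectorFourier.integral_fourierIntegral_smul_eq_flip (L := innerₗ ℝ)
      Real.continuous_fourierChar continuous_inner hu hv
  -- Both pairings with a test function reduce to the pairing of `𝓕⁻ Φ` with `𝓕 H`, by the
  -- multiplication formula and Fourier inversion on Schwartz functions.
  have e1 : ∫ x, φ x • H x = ∫ x, (𝓕⁻ Φ : 𝓢(ℝ, ℂ)) x • 𝓕 H x := by
    rw [← flip (𝓕⁻ Φ : 𝓢(ℝ, ℂ)).integrable hH, ← fourier_coe, FourierTransform.fourier_fourierInv_eq]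
    rfl
  have e2 : ∫ x, φ x • 𝓕⁻ (𝓕 H) x = ∫ x, (𝓕⁻ Φ : 𝓢(ℝ, ℂ)) x • 𝓕 H x := by
    have h1 : ∫ x, φ x • 𝓕⁻ (𝓕 H) x = ∫ x, (Φ : ℝ → ℂ) x • 𝓕 (fun x => 𝓕 H (-x)) x := by
      rw [← Real.fourierInv_eq_fourier_comp_neg]; rfl
    rw [h1, ← flip Φ.integrable hF.comp_neg, ← integral_neg_eq_self]
    simp only [neg_neg]
    rw [fourierInv_coe]
    simp only [Real.fourierInv_eq_fourier_neg]
  rw [e1, e2]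

lemma norm_fourierInv_le (G : ℝ → ℂ) (x : ℝ) : ‖𝓕⁻ G x‖ ≤ ∫ w, ‖G w‖ := by
  rw [Real.fourierInv_eq]
  refine (norm_integral_le_integral_norm _).trans (le_of_eq ?_)
  simp only [Circle.norm_smul]

/-- The Fourier transform with the sign and scaling of characteristic functions. -/
noncomputable def charTransform (H : ℝ → ℂ) (θ : ℝ) : ℂ :=
  ∫ x : ℝ, Complex.exp (θ * x * Complex.I) * H x

lemma fourier_eq_charTransform (H : ℝ → ℂ) (w : ℝ) :
    𝓕 H w = charTransform H (w * (-2 * Real.pi)) := by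
  rw [Real.fourier_real_eq_integral_exp_smul, charTransform]
  refine integral_congr_ae (ae_of_all _ fun x => ?_)
  simp only [smul_eq_mul]
  congr 2
  push_cast; ring

/-- Inversion bounds `H` almost everywhere by the `L¹` norm of its transform; the factor `(2π)⁻¹` is
the change of frequency. Integrals over intervals make a continuous version of `H` unnecessary. -/
lemma norm_intervalIntegral_le_of_charTransform {H : ℝ → ℂ} (hH : Integrable H)
    (hT : Integrable (charTransform H)) {a b : ℝ} (hab : a ≤ b) :
    ‖∫ x in a..b, H x‖ ≤ (b - a) * ((2 * Real.pi)⁻¹ * ∫ θ, ‖charTransform H θ‖) := by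
  have hpi := Real.pi_pos
  have hfun : 𝓕 H = fun w => charTransform H (w * (-2 * Real.pi)) :=
    funext (fourier_eq_charTransform H)
  have hF : Integrable (𝓕 H) := by rw [hfun]; exact hT.comp_mul_right' (by nlinarith)
  have hint : ∫ w, ‖𝓕 H w‖ = (2 * Real.pi)⁻¹ * ∫ θ, ‖charTransform H θ‖ := by
    rw [hfun]
    rw [Measure.integral_comp_mul_right (fun θ => ‖charTransform H θ‖)]
    rw [smul_eq_mul, abs_inv, abs_mul, abs_neg, abs_two, abs_of_pos hpi]
  have h1 : ∫ x in a..b, H x = ∫ x in a..b, 𝓕⁻ (𝓕 H) x :=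
    intervalIntegral.integral_congr_ae ((ae_eq_fourierInv_fourier hH hF).mono fun x hx _ => hx)
  rw [h1, mul_comm, ← abs_of_nonneg (sub_nonneg.2 hab), ← hint]
  exact intervalIntegral.norm_integral_le_of_norm_le_const fun x _ => norm_fourierInv_le _ _

lemma continuous_charTransform {H : ℝ → ℂ} (hH : Integrable H) : Continuous (charTransform H) := by
  have h1 : charTransform H = fun θ => 𝓕 H (θ * (-2 * Real.pi)⁻¹) := by
    funext θ
    rw [fourier_eq_charTransform, inv_mul_cancel_right₀]
    have := Real.pi_pos
    nlinarith
  rw [h1]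
  have h2 : Continuous (𝓕 H) := VectorFourier.fourierIntegral_continuous
    Real.continuous_fourierChar (L := innerₗ ℝ) continuous_inner hH
  exact h2.comp (continuous_mul_const _)

/-- A Sobolev type bound: the weighted energy of the transform controls the density. -/
lemma norm_intervalIntegral_le_sqrt_energy {H : ℝ → ℂ} (hH : Integrable H)
    (hE : ∫⁻ θ : ℝ, ENNReal.ofReal (1 + θ ^ 2) * ‖charTransform H θ‖ₑ ^ 2 ≠ ⊤) {a b : ℝ}
    (hab : a ≤ b) :
    ‖∫ x in a..b, H x‖ ≤ (b - a) *
      √(∫⁻ θ : ℝ, ENNReal.ofReal (1 + θ ^ 2) * ‖charTransform H θ‖ₑ ^ 2).toReal := by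
  have hpi := Real.pi_pos
  have hpi3 := Real.pi_gt_three
  have hc := continuous_charTransform hH
  set T := charTransform H
  have hnn : ∀ θ : ℝ, 0 ≤ (1 + θ ^ 2) * ‖T θ‖ ^ 2 := fun θ => by positivity
  have hcw : Continuous fun θ : ℝ => (1 + θ ^ 2) * ‖T θ‖ ^ 2 := by fun_prop
  have heq : ∫⁻ θ : ℝ, ENNReal.ofReal (1 + θ ^ 2) * ‖T θ‖ₑ ^ 2 =
      ∫⁻ θ : ℝ, ENNReal.ofReal ((1 + θ ^ 2) * ‖T θ‖ ^ 2) := by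
    refine lintegral_congr fun θ => ?_
    rw [ENNReal.ofReal_mul (by positivity), ENNReal.ofReal_pow (norm_nonneg _), ofReal_norm]
  have hWi : Integrable fun θ : ℝ => (1 + θ ^ 2) * ‖T θ‖ ^ 2 := by
    refine ⟨hcw.aestronglyMeasurable, ?_⟩
    rw [hasFiniteIntegral_iff_ofReal (ae_of_all _ hnn), ← heq]
    exact lt_top_iff_ne_top.2 hE
  have hEr : (∫⁻ θ : ℝ, ENNReal.ofReal (1 + θ ^ 2) * ‖T θ‖ₑ ^ 2).toReal =
      ∫ θ : ℝ, (1 + θ ^ 2) * ‖T θ‖ ^ 2 := by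
    rw [heq, integral_eq_lintegral_of_nonneg_ae (ae_of_all _ hnn) hcw.aestronglyMeasurable]
  rw [hEr]
  set E := ∫ θ : ℝ, (1 + θ ^ 2) * ‖T θ‖ ^ 2
  have hE0 : 0 ≤ E := integral_nonneg hnn
  -- Cauchy-Schwarz in its additive form with a free parameter `s`. Taking `s = 1` shows that `T` is
  -- integrable; `s` of the order of `√E` gives the sharp power of the energy.
  have hpt : ∀ s : ℝ, 0 < s → ∀ θ : ℝ, ‖T θ‖ ≤
      s / 2 * (1 + θ ^ 2)⁻¹ + (2 * s)⁻¹ * ((1 + θ ^ 2) * ‖T θ‖ ^ 2) := by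
    intro s hs θ
    have hw : 0 < 1 + θ ^ 2 := by positivity
    have : s / 2 * (1 + θ ^ 2)⁻¹ + (2 * s)⁻¹ * ((1 + θ ^ 2) * ‖T θ‖ ^ 2) - ‖T θ‖ =
        (s - (1 + θ ^ 2) * ‖T θ‖) ^ 2 / (2 * s * (1 + θ ^ 2)) := by
      field_simp; ring
    have h2 : 0 ≤ (s - (1 + θ ^ 2) * ‖T θ‖) ^ 2 / (2 * s * (1 + θ ^ 2)) := by positivity
    linarith
  have hRi : ∀ s : ℝ, Integrable fun θ : ℝ =>
      s / 2 * (1 + θ ^ 2)⁻¹ + (2 * s)⁻¹ * ((1 + θ ^ 2) * ‖T θ‖ ^ 2) := fun s =>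
    (integrable_inv_one_add_sq.const_mul _).add (hWi.const_mul _)
  have hTi : Integrable T := (hRi 1).mono' hc.aestronglyMeasurable
    (ae_of_all _ (hpt 1 one_pos))
  have hbd : ∀ s : ℝ, 0 < s → ∫ θ, ‖T θ‖ ≤ s / 2 * Real.pi + (2 * s)⁻¹ * E := by
    intro s hs
    refine (integral_mono hTi.norm (hRi s) (hpt s hs)).trans (le_of_eq ?_)
    rw [integral_add (integrable_inv_one_add_sq.const_mul _) (hWi.const_mul _),
      integral_const_mul, integral_const_mul, integral_univ_inv_one_add_sq]
  -- The choice `s = √E` yields `(π + 1) / 2 · √E`; the weaker constant `2π` just cancels the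
  -- prefactor of the inversion formula. For `E = 0`, `s` tends to 0 instead.
  have hfin : ∫ θ, ‖T θ‖ ≤ 2 * Real.pi * √E := by
    rcases hE0.eq_or_lt with h0 | h0
    · rw [← h0, Real.sqrt_zero, mul_zero]
      refine le_of_forall_pos_le_add fun η hη => ?_
      have := hbd (2 * η / Real.pi) (by positivity)
      rw [← h0] at this
      refine this.trans (le_of_eq ?_)
      field_simp
      ring
    · have hs := Real.sqrt_pos.2 h0
      have := hbd (√E) hs
      have h2 : (2 * √E)⁻¹ * E = √E / 2 := by
        rw [inv_mul_eq_iff_eq_mul₀ (by positivity)]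
        nlinarith [Real.mul_self_sqrt hE0]
      rw [h2] at this
      nlinarith
  refine (norm_intervalIntegral_le_of_charTransform hH hTi hab).trans ?_
  refine mul_le_mul_of_nonneg_left ?_ (sub_nonneg.2 hab)
  rw [inv_mul_le_iff₀ (by positivity)]
  exact hfin

end Fourier

/-! ### Interval probabilities from characteristic functions -/

section Density

variable {μ : Measure ℝ} [IsProbabilityMeasure μ] {f : ℝ → ℝ}

lemma IsDensity.integrable (h : IsDensity μ f) : Integrable f := by
  refine ⟨h.measurable.aestronglyMeasurable, ?_⟩
  rw [hasFiniteIntegral_iff_ofReal (ae_of_all _ h.nonneg)]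
  have h1 : μ Set.univ = ∫⁻ x, ENNReal.ofReal (f x) := by
    conv_lhs => rw [h.eq_withDensity]
    rw [withDensity_apply _ MeasurableSet.univ, setLIntegral_univ]
  rw [← h1, measure_univ]; exact ENNReal.one_lt_top

lemma IsDensity.integral_eq (h : IsDensity μ f) {E : Type*} [NormedAddCommGroup E]
    [NormedSpace ℝ E] (u : ℝ → E) : ∫ x, u x ∂μ = ∫ x, f x • u x := by
  conv_lhs => rw [h.eq_withDensity]
  rw [integral_withDensity_eq_integral_toReal_smul h.measurable.ennreal_ofReal
    (ae_of_all _ fun _ => ENNReal.ofReal_lt_top)]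
  simp only [ENNReal.toReal_ofReal (h.nonneg _)]

lemma IsDensity.charFun_eq (h : IsDensity μ f) (θ : ℝ) :
    charFun μ θ = charTransform (fun x => (f x : ℂ)) θ := by
  rw [charFun_apply_real, h.integral_eq, charTransform]
  refine integral_congr_ae (ae_of_all _ fun x => ?_)
  simp only [Complex.real_smul]; ring

lemma IsDensity.real_Ioc (h : IsDensity μ f) {a b : ℝ} (hab : a ≤ b) :
    μ.real (Set.Ioc a b) = ∫ x in a..b, f x := by
  have h1 : μ.real (Set.Ioc a b) = ∫ x, (Set.Ioc a b).indicator (1 : ℝ → ℝ) x ∂μ :=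
    (integral_indicator_one measurableSet_Ioc).symm
  rw [h1, h.integral_eq, intervalIntegral.integral_of_le hab, ← integral_indicator measurableSet_Ioc]
  refine integral_congr_ae (ae_of_all _ fun x => ?_)
  by_cases hx : x ∈ Set.Ioc a b <;> simp [hx]

lemma charTransform_sum {ι : Type*} (s : Finset ι) {H : ι → ℝ → ℂ}
    (hH : ∀ i ∈ s, Integrable (H i)) (θ : ℝ) :
    charTransform (fun x => ∑ i ∈ s, H i x) θ = ∑ i ∈ s, charTransform (H i) θ := by
  simp only [charTransform, Finset.mul_sum]
  refine integral_finsetSum _ fun i hi => ?_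
  refine (hH i hi).bdd_mul (c := 1) (by fun_prop) (ae_of_all _ fun x => ?_)
  rw [← Complex.ofReal_mul, Complex.norm_exp_ofReal_mul_I]

lemma charTransform_sub {H K : ℝ → ℂ} (hH : Integrable H) (hK : Integrable K) (θ : ℝ) :
    charTransform (fun x => H x - K x) θ = charTransform H θ - charTransform K θ := by
  have hb : ∀ {L : ℝ → ℂ}, Integrable L →
      Integrable fun x : ℝ => Complex.exp (θ * x * Complex.I) * L x := fun {L} hL => by
    refine hL.bdd_mul (c := 1) (by fun_prop) (ae_of_all _ fun x => ?_)
    rw [← Complex.ofReal_mul, Complex.norm_exp_ofReal_mul_I]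
  simp only [charTransform, mul_sub]
  exact integral_sub (hb hH) (hb hK)

/-- Sums of centred interval probabilities are controlled by the characteristic functions. -/
lemma abs_sum_real_Ioc_sub_le {κ : ℕ → Measure ℝ} [∀ i, IsProbabilityMeasure (κ i)]
    {u : ℕ → ℝ → ℝ} (hu : ∀ i, IsDensity (κ i) (u i)) (hf : IsDensity μ f) (n : ℕ)
    (hE : ∫⁻ θ : ℝ, ENNReal.ofReal (1 + θ ^ 2) *
      ‖∑ i ∈ Finset.range n, (charFun (κ i) θ - charFun μ θ)‖ₑ ^ 2 ≠ ⊤) {a b : ℝ} (hab : a ≤ b) :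
    |∑ i ∈ Finset.range n, ((κ i).real (Set.Ioc a b) - μ.real (Set.Ioc a b))| ≤ (b - a) *
      √(∫⁻ θ : ℝ, ENNReal.ofReal (1 + θ ^ 2) *
        ‖∑ i ∈ Finset.range n, (charFun (κ i) θ - charFun μ θ)‖ₑ ^ 2).toReal := by
  set H : ℝ → ℂ := fun x => ∑ i ∈ Finset.range n, ((u i x : ℂ) - (f x : ℂ)) with hHdef
  have hui : ∀ i, Integrable fun x => (u i x : ℂ) := fun i => (hu i).integrable.ofReal
  have hfi : Integrable fun x => (f x : ℂ) := hf.integrable.ofReal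
  have hd : ∀ i, Integrable fun x => (u i x : ℂ) - (f x : ℂ) := fun i => (hui i).sub hfi
  have hH : Integrable H := integrable_finsetSum _ fun i _ => hd i
  have hT : ∀ θ, charTransform H θ =
      ∑ i ∈ Finset.range n, (charFun (κ i) θ - charFun μ θ) := by
    intro θ
    rw [hHdef, charTransform_sum _ fun i _ => hd i]
    refine Finset.sum_congr rfl fun i _ => ?_
    rw [charTransform_sub (hui i) hfi, (hu i).charFun_eq, hf.charFun_eq]
  simp only [← hT] at hE ⊢
  have key := norm_intervalIntegral_le_sqrt_energy hH hE hab
  have h1 : ∫ x in a..b, H x =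
      ((∑ i ∈ Finset.range n, ((κ i).real (Set.Ioc a b) - μ.real (Set.Ioc a b)) : ℝ) : ℂ) := by
    rw [hHdef]
    dsimp only
    rw [intervalIntegral.integral_finsetSum fun i _ => (hd i).intervalIntegrable]
    push_cast
    refine Finset.sum_congr rfl fun i _ => ?_
    rw [intervalIntegral.integral_sub (hui i).intervalIntegrable hfi.intervalIntegrable,
      intervalIntegral.integral_ofReal, intervalIntegral.integral_ofReal, (hu i).real_Ioc hab,
      hf.real_Ioc hab]
  rw [h1, Complex.norm_real, Real.norm_eq_abs] at key
  exact key

end Density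

/-! ### Almost sure growth of the energy along dyadic times -/

/-- The reciprocal of `d (log d)²`, shifted so as to be positive for all `d`. -/
noncomputable def logWeight (d : ℕ) : ℝ := (((d : ℝ) + 2) * Real.log (d + 2) ^ 2)⁻¹

lemma logWeight_pos (d : ℕ) : 0 < logWeight d := by
  have : 0 < Real.log ((d : ℝ) + 2) := Real.log_pos (by have := d.cast_nonneg (α := ℝ); linarith)
  unfold logWeight; positivity

/-- Cauchy condensation: `2^k` times the weight at `2^k` is of order `1 / (k + 1)²`. -/
lemma summable_logWeight : Summable logWeight := by
  rw [← summable_condensed_iff_of_nonneg fun d => (logWeight_pos d).le]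
  · have hs : Summable fun k : ℕ => 4 / Real.log 2 ^ 2 * (1 / ((k + 1 : ℕ) : ℝ) ^ 2) :=
      ((summable_nat_add_iff (f := fun k : ℕ => 1 / (k : ℝ) ^ 2) 1).2
        (Real.summable_one_div_nat_pow.2 one_lt_two)).mul_left _
    refine Summable.of_nonneg_of_le (fun k => by have := logWeight_pos (2 ^ k); positivity)
      (fun k => ?_) hs
    have hl2 : 0 < Real.log 2 := Real.log_pos one_lt_two
    have h1 : (k : ℝ) * Real.log 2 ≤ Real.log ((2 : ℝ) ^ k + 2) := by
      rw [← Real.log_pow]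
      exact Real.log_le_log (by positivity) (by linarith)
    have h2 : Real.log 2 ≤ Real.log ((2 : ℝ) ^ k + 2) :=
      Real.log_le_log two_pos (by linarith [pow_pos (two_pos : (0 : ℝ) < 2) k])
    -- The average of the two preceding lower bounds; it stays useful at `k = 0`.
    have h3 : ((k : ℝ) + 1) / 2 * Real.log 2 ≤ Real.log ((2 : ℝ) ^ k + 2) := by linarith
    have h4 : (((k : ℝ) + 1) / 2 * Real.log 2) ^ 2 ≤ Real.log ((2 : ℝ) ^ k + 2) ^ 2 :=
      pow_le_pow_left₀ (by positivity) h3 2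
    have h5 : 0 < (((k : ℝ) + 1) / 2 * Real.log 2) ^ 2 := by positivity
    unfold logWeight
    push_cast
    have hp : (0 : ℝ) < 2 ^ k := by positivity
    calc (2 : ℝ) ^ k * (((2 : ℝ) ^ k + 2) * Real.log ((2 : ℝ) ^ k + 2) ^ 2)⁻¹
        ≤ (2 : ℝ) ^ k * ((2 : ℝ) ^ k * (((k : ℝ) + 1) / 2 * Real.log 2) ^ 2)⁻¹ := by
          gcongr; linarith
      _ = _ := by field_simp; norm_num
  · intro m n _ hmn
    have hm : 0 < Real.log ((m : ℝ) + 2) :=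
      Real.log_pos (by have := m.cast_nonneg (α := ℝ); linarith)
    have hmn' : (m : ℝ) ≤ n := by exact_mod_cast hmn
    unfold logWeight
    gcongr

/-- The dyadic level `d` of `n` satisfies `d + 2 ≤ 4 log n` and `log (d + 2) ≤ 3 log log n`, and `36
= 4 · 3²`. This is where `ι` comes from. -/
lemma logWeight_inv_le {n : ℕ} (hn : 2 ≤ Real.log n) :
    (logWeight (Nat.log 2 n + 1))⁻¹ ≤ 36 * iota n ^ 2 := by
  have hn0 : n ≠ 0 := by rintro rfl; simp at hn; linarith
  have hl2 : 0.69 < Real.log 2 := lt_trans (by norm_num) Real.log_two_gt_d9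
  have h1 : (Nat.log 2 n : ℝ) * Real.log 2 ≤ Real.log n := by
    rw [← Real.log_pow]
    refine Real.log_le_log (by positivity) ?_
    exact_mod_cast Nat.pow_log_le_self 2 hn0
  set m : ℝ := (Nat.log 2 n : ℝ)
  have hm0 : 0 ≤ m := Nat.cast_nonneg _
  have h2 : m + 1 + 2 ≤ 4 * Real.log n := by nlinarith
  have hll : Real.log 2 ≤ Real.log (Real.log n) := Real.log_le_log two_pos hn
  have h3 : Real.log (m + 1 + 2) ≤ 3 * Real.log (Real.log n) := by
    refine (Real.log_le_log (by positivity) h2).trans ?_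
    rw [Real.log_mul (by norm_num) (by linarith)]
    have : Real.log 4 = 2 * Real.log 2 := by
      rw [show (4 : ℝ) = 2 ^ 2 by norm_num, Real.log_pow]; norm_num
    linarith
  have h4 : 0 ≤ Real.log (m + 1 + 2) := Real.log_nonneg (by linarith)
  unfold logWeight iota
  rw [inv_inv, mul_pow, Real.sq_sqrt (by linarith)]
  push_cast
  calc (m + 1 + 2) * Real.log (m + 1 + 2) ^ 2
      ≤ (4 * Real.log n) * (3 * Real.log (Real.log n)) ^ 2 := by gcongr
    _ = _ := by ring

section Rate

variable {Ω : Type*} [MeasurableSpace Ω] {P : Measure Ω} [IsProbabilityMeasure P]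
  {ε : ℤ → Ω → ℝ} {ε' : Ω → ℝ} {g : (ℕ → ℝ) → ℝ}

/-- The weighted `L²` energy of the characteristic function sums. -/
noncomputable def energy (P : Measure Ω) (g : (ℕ → ℝ) → ℝ) (ε : ℤ → Ω → ℝ) (n : ℕ)
    (ω : Ω) : ℝ≥0∞ :=
  ∫⁻ θ : ℝ, ENNReal.ofReal (1 + θ ^ 2) * ‖charSum P g ε n θ ω‖ₑ ^ 2

lemma energy_le_maxEnergy {n N : ℕ} (hn : n ≤ N) (ω : Ω) :
    energy P g ε n ω ≤ maxEnergy P g ε N ω := by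
  refine lintegral_mono fun θ => mul_le_mul_right (pow_le_pow_left' ?_ 2) _
  rw [enorm_le_iff_norm_le, Real.norm_of_nonneg (charMax_nonneg N θ ω)]
  exact norm_charSum_le_charMax hn θ ω

lemma IsIID.measurable_energy (hiid : IsIID P ε ε') (hg : Measurable g) (n : ℕ) :
    Measurable (energy P g ε n) := by
  have h1 : Measurable fun p : ℝ × Ω =>
      ENNReal.ofReal (1 + p.1 ^ 2) * ‖charSum P g ε n p.1 p.2‖ₑ ^ 2 :=
    (((measurable_fst.pow_const 2).const_add 1).ennreal_ofReal).mul
      ((hiid.measurable_charSum hg n).enorm.pow_const 2)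
  exact h1.lintegral_prod_left'

/-- The mean maximal energy at `2^d` is of order at most `2^d`, so the weighted series has finite
expectation. It converges almost surely, and its terms tend to 0; this produces the little-o. -/
lemma IsIID.ae_tendsto_maxEnergy (hiid : IsIID P ε ε') (hg : Measurable g)
    (hsrd : shortRangeSum P g ε ε' ≠ ∞) :
    ∀ᵐ ω ∂P, (∀ d, maxEnergy P g ε (2 ^ d) ω ≠ ∞) ∧
      Tendsto (fun d => logWeight d / 2 ^ d * (maxEnergy P g ε (2 ^ d) ω).toReal) atTop (𝓝 0) := by
  have hpos : ∀ d : ℕ, 0 < logWeight d / 2 ^ d := fun d => div_pos (logWeight_pos d) (by positivity)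
  have hm : ∀ d : ℕ, Measurable fun ω =>
      ENNReal.ofReal (logWeight d / 2 ^ d) * maxEnergy P g ε (2 ^ d) ω := fun d =>
    (hiid.measurable_maxEnergy hg _).const_mul _
  have hfin : ∫⁻ ω, ∑' d : ℕ, ENNReal.ofReal (logWeight d / 2 ^ d) * maxEnergy P g ε (2 ^ d) ω ∂P
      ≠ ∞ := by
    rw [lintegral_tsum fun d => (hm d).aemeasurable]
    have hle : ∀ d : ℕ, ∫⁻ ω, ENNReal.ofReal (logWeight d / 2 ^ d) * maxEnergy P g ε (2 ^ d) ω ∂P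
        ≤ ENNReal.ofReal (logWeight d) * (4 * shortRangeSum P g ε ε' ^ 2) := by
      intro d
      rw [lintegral_const_mul _ (hiid.measurable_maxEnergy hg _)]
      refine (mul_le_mul_right (hiid.lintegral_maxEnergy_le hg (2 ^ d)) _).trans (le_of_eq ?_)
      have h2 : ENNReal.ofReal (logWeight d / 2 ^ d) * ((2 ^ d : ℕ) : ℝ≥0∞) =
          ENNReal.ofReal (logWeight d) := by
        rw [← ENNReal.ofReal_natCast, ← ENNReal.ofReal_mul (hpos d).le]
        push_cast
        rw [div_mul_cancel₀ _ (by positivity)]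
      rw [← h2]; ring
    refine ne_top_of_le_ne_top ?_ (ENNReal.tsum_le_tsum hle)
    rw [ENNReal.tsum_mul_right, ← ENNReal.ofReal_tsum_of_nonneg (fun d => (logWeight_pos d).le)
      summable_logWeight]
    exact ENNReal.mul_ne_top ENNReal.ofReal_ne_top
      (ENNReal.mul_ne_top (by norm_num) (ENNReal.pow_ne_top hsrd))
  filter_upwards [ae_lt_top' (AEMeasurable.tsum fun d => (hm d).aemeasurable) hfin] with ω hω
  have h1 := ENNReal.tendsto_atTop_zero_of_tsum_ne_top hω.ne
  refine ⟨fun d hd => ?_, ?_⟩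
  · have := ENNReal.ne_top_of_tsum_ne_top hω.ne d
    rw [hd, ENNReal.mul_top (ENNReal.ofReal_pos.2 (hpos d)).ne'] at this
    exact this rfl
  · have h2 := (ENNReal.tendsto_toReal ENNReal.zero_ne_top).comp h1
    simpa [Function.comp_def, ENNReal.toReal_mul, ENNReal.toReal_ofReal (hpos _).le] using h2

/-- Almost surely the root of the energy is of smaller order than `√n ι(n)`. -/
lemma IsIID.ae_sqrt_energy_isLittleO (hiid : IsIID P ε ε') (hg : Measurable g)
    (hsrd : shortRangeSum P g ε ε' ≠ ∞) :
    ∀ᵐ ω ∂P, (∀ n, energy P g ε n ω ≠ ∞) ∧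
      (fun n => √(energy P g ε n ω).toReal) =o[atTop] fun n : ℕ => √n * iota n := by
  filter_upwards [hiid.ae_tendsto_maxEnergy hg hsrd] with ω hω
  obtain ⟨hfin, hlim⟩ := hω
  have hlt : ∀ n : ℕ, n ≤ 2 ^ (Nat.log 2 n + 1) := fun n =>
    (Nat.lt_pow_succ_log_self one_lt_two n).le
  refine ⟨fun n => ne_top_of_le_ne_top (hfin _) (energy_le_maxEnergy (hlt n) ω), ?_⟩
  rw [isLittleO_iff]
  intro c hc
  have hd : Tendsto (fun n : ℕ => Nat.log 2 n + 1) atTop atTop :=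
    (tendsto_add_atTop_nat 1).comp (tendsto_atTop_atTop.2 fun m => ⟨2 ^ m, fun n hn =>
      Nat.le_log_of_pow_le one_lt_two hn⟩)
  -- `72 = 2 · 36`: a factor 2 from `2^d ≤ 2n`, and 36 from `logWeight_inv_le`.
  have hev := (hlim.comp hd).eventually_le_const (show (0 : ℝ) < c ^ 2 / 72 by positivity)
  have hlog : ∀ᶠ n : ℕ in atTop, 2 ≤ Real.log n :=
    (Real.tendsto_log_atTop.comp tendsto_natCast_atTop_atTop).eventually_ge_atTop 2
  filter_upwards [hev, hlog, eventually_ge_atTop 1] with n h1 h2 h3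
  simp only [Function.comp_apply] at h1
  set d := Nat.log 2 n + 1 with hdn
  set Z := (maxEnergy P g ε (2 ^ d) ω).toReal
  have hw := logWeight_pos d
  have h4 : (energy P g ε n ω).toReal ≤ Z :=
    ENNReal.toReal_mono (hfin d) (energy_le_maxEnergy (hlt n) ω)
  have h5 : (2 : ℝ) ^ d ≤ 2 * n := by
    have : 2 ^ Nat.log 2 n ≤ n := Nat.pow_log_le_self 2 (by omega)
    rw [hdn, pow_succ, mul_comm]
    have : ((2 : ℝ) ^ Nat.log 2 n) ≤ n := by exact_mod_cast this
    linarith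
  have h6 : Z ≤ c ^ 2 / 72 * (2 ^ d * (logWeight d)⁻¹) := by
    rw [div_mul_eq_mul_div, div_le_iff₀ (by positivity)] at h1
    rw [← div_eq_mul_inv, mul_div_assoc', le_div_iff₀ hw]
    linarith
  have h7 := logWeight_inv_le h2
  have h8 : Z ≤ (c * (√n * iota n)) ^ 2 := by
    refine h6.trans ?_
    calc c ^ 2 / 72 * (2 ^ d * (logWeight d)⁻¹) ≤ c ^ 2 / 72 * (2 * n * (36 * iota n ^ 2)) := by
          gcongr
      _ = _ := by rw [mul_pow, mul_pow, Real.sq_sqrt (by positivity)]; ring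
  rw [Real.norm_of_nonneg (Real.sqrt_nonneg _)]
  refine (Real.sqrt_le_sqrt (h4.trans h8)).trans (le_of_eq ?_)
  rw [Real.sqrt_sq_eq_abs, abs_mul, abs_of_pos hc, Real.norm_eq_abs]

end Rate

/-! ### The martingale part on a grid -/

/-- The half-open interval between the `j`-th and `(j + l)`-th points of the grid of mesh `δ`. -/
def gridIoc (δ : ℝ) (j : ℤ) (l : ℕ) : Set ℝ := Set.Ioc (j * δ) ((j + l) * δ)

lemma measurableSet_gridIoc (δ : ℝ) (j : ℤ) (l : ℕ) : MeasurableSet (gridIoc δ j l) :=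
  measurableSet_Ioc

/-- A point lies in at most `l` of these intervals. The induction splits off the last cell and uses
that single cells are disjoint. -/
lemma tsum_measure_gridIoc_le {μ : Measure ℝ} [IsProbabilityMeasure μ] (δ : ℝ)
    (l : ℕ) : ∑' j : ℤ, μ (gridIoc δ j l) ≤ l := by
  have hone : ∑' j : ℤ, μ (gridIoc δ j 1) ≤ 1 := by
    have h1 : Pairwise (Function.onFun Disjoint fun j : ℤ => gridIoc δ j 1) := by
      have := Set.pairwise_disjoint_Ioc_add_zsmul (0 : ℝ) δ
      simpa [gridIoc] using this
    rw [← measure_iUnion h1 fun j => measurableSet_gridIoc δ j 1]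
    exact prob_le_one
  induction l with
  | zero => simp [gridIoc]
  | succ l ih =>
    have hsub : ∀ j : ℤ, μ (gridIoc δ j (l + 1)) ≤
        μ (gridIoc δ j l) + μ (gridIoc δ (j + l) 1) := by
      intro j
      refine (measure_mono ?_).trans (measure_union_le _ _)
      unfold gridIoc
      push_cast
      rw [add_assoc]
      exact Set.Ioc_subset_Ioc_union_Ioc
    calc ∑' j : ℤ, μ (gridIoc δ j (l + 1))
        ≤ ∑' j : ℤ, (μ (gridIoc δ j l) + μ (gridIoc δ (j + l) 1)) := ENNReal.tsum_le_tsum hsub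
      _ = ∑' j : ℤ, μ (gridIoc δ j l) + ∑' j : ℤ, μ (gridIoc δ (j + l) 1) := ENNReal.tsum_add
      _ = ∑' j : ℤ, μ (gridIoc δ j l) + ∑' j : ℤ, μ (gridIoc δ j 1) := by
          congr 1; exact (Equiv.addRight (l : ℤ)).tsum_eq fun j => μ (gridIoc δ j 1)
      _ ≤ l + 1 := add_le_add ih hone
      _ = _ := by push_cast; rfl

section Martingale

variable {Ω : Type*} [MeasurableSpace Ω] {P : Measure Ω} [IsProbabilityMeasure P]
  {ε : ℤ → Ω → ℝ} {ε' : Ω → ℝ} {g : (ℕ → ℝ) → ℝ}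

/-- The martingale part of the number of visits to `I` up to time `n`. -/
noncomputable def visitMart (P : Measure Ω) (g : (ℕ → ℝ) → ℝ) (ε : ℤ → Ω → ℝ) (n : ℕ)
    (I : Set ℝ) (ω : Ω) : ℝ :=
  ∑ i ∈ Finset.range n, (I.indicator (fun _ => (1 : ℝ)) (process g ε (i + 1) ω) -
    nextProb (innovLaw P ε) (g ⁻¹' I) (past ε i ω))

lemma visitMart_eq_runSum (n : ℕ) (I : Set ℝ) (ω : Ω) :
    visitMart P g ε n I ω =
      runSum (centredInd (innovLaw P ε) (g ⁻¹' I)) n (past ε n ω) := by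
  have := runSum_past ε (centredInd (innovLaw P ε) (g ⁻¹' I)) 0 n ω
  rw [zero_add] at this
  rw [this, visitMart]
  refine Finset.sum_congr rfl fun i _ => ?_
  rw [zero_add, centredInd, pop_past]
  rfl

lemma IsIID.measurable_process (hiid : IsIID P ε ε') (hg : Measurable g) (k : ℤ) :
    Measurable (process g ε k) := hg.comp (hiid.measurable_past k)

lemma IsIID.map_process (hiid : IsIID P ε ε') (hg : Measurable g) :
    P.map (process g ε 0) = (pastLaw P ε).map g :=
  (Measure.map_map hg (hiid.measurable_past 0)).symm

/-- The conditional density bound in terms of interval probabilities. -/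
lemma IsIID.nextProb_Ioc_le (hiid : IsIID P ε ε') (hg : Measurable g)
    {fc : (ℕ → ℝ) → ℝ → ℝ}
    (hfc : ∀ᵐ ξ ∂(P.map (past ε 0)), IsDensity (condLaw P g ε 1 ξ) (fc ξ))
    {c₀ : ℝ} (hbdd : ∀ᵐ ω ∂P, ∀ x, fc (past ε 0 ω) x ≤ c₀) {a b : ℝ} (hab : a ≤ b) :
    ∀ᵐ ξ ∂(pastLaw P ε), nextProb (innovLaw P ε) (g ⁻¹' Set.Ioc a b) ξ ≤ c₀ * (b - a) := by
  have := hiid.isProbabilityMeasure_innovLaw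
  have hI : MeasurableSet (Set.Ioc a b) := measurableSet_Ioc
  rw [← hiid.map_past 0, ae_map_iff (hiid.measurable_past 0).aemeasurable
    (measurableSet_le (measurable_nextProb (hg hI)) measurable_const)]
  filter_upwards [hbdd, (hiid.measurePreserving_past 0).quasiMeasurePreserving.ae hfc,
    (hiid.measurePreserving_past 0).quasiMeasurePreserving.ae (hiid.condLaw_ae_eq hg 1)]
    with ω h1 h2 h3
  rw [h3] at h2
  rw [← futureLaw_one_real hg hI, h2.real_Ioc hab]
  have h4 : ∫ x in a..b, fc (past ε 0 ω) x ≤ ∫ _ in a..b, c₀ :=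
    intervalIntegral.integral_mono_on hab h2.integrable.intervalIntegrable
      intervalIntegrable_const fun x _ => h1 x
  rw [intervalIntegral.integral_const, smul_eq_mul, mul_comm] at h4
  exact h4

lemma IsIID.real_map_process_Ioc_le (hiid : IsIID P ε ε') (hg : Measurable g)
    {fc : (ℕ → ℝ) → ℝ → ℝ}
    (hfc : ∀ᵐ ξ ∂(P.map (past ε 0)), IsDensity (condLaw P g ε 1 ξ) (fc ξ))
    {c₀ : ℝ} (hbdd : ∀ᵐ ω ∂P, ∀ x, fc (past ε 0 ω) x ≤ c₀) {a b : ℝ} (hab : a ≤ b) :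
    (P.map (process g ε 0)).real (Set.Ioc a b) ≤ c₀ * (b - a) := by
  have := hiid.isProbabilityMeasure_innovLaw
  have := hiid.isProbabilityMeasure_pastLaw
  rw [hiid.map_process hg, map_measureReal_apply hg measurableSet_Ioc,
    ← hiid.historyLaw.integral_nextProb (hg measurableSet_Ioc)]
  refine (integral_mono_ae ?_ (integrable_const _) (hiid.nextProb_Ioc_le hg hfc hbdd hab)).trans
    (by simp)
  exact Integrable.of_bound (C := 1) (measurable_nextProb (hg measurableSet_Ioc)).aestronglyMeasurable
    (ae_of_all _ fun ξ => by
      rw [Real.norm_of_nonneg (nextProb_nonneg ξ)]; exact nextProb_le_one ξ)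

/-- The event that the martingale part is large on some interval of at most `n + 1` grid cells. -/
def gridEvent (P : Measure Ω) (g : (ℕ → ℝ) → ℝ) (ε : ℤ → Ω → ℝ) (n : ℕ) (δ t : ℝ) : Set Ω :=
  ⋃ (l ∈ Finset.range (n + 2)) (j : ℤ), {ω | t ≤ |visitMart P g ε n (gridIoc δ j l) ω|}

/-- Union bound over infinitely many intervals: each tail carries the probability of its interval,
so the sum over `j` costs at most `n + 2`, and the number of lengths gives another factor `n + 2`.
-/
lemma IsIID.measure_gridEvent_le (hiid : IsIID P ε ε') (hg : Measurable g)
    {fc : (ℕ → ℝ) → ℝ → ℝ}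
    (hfc : ∀ᵐ ξ ∂(P.map (past ε 0)), IsDensity (condLaw P g ε 1 ξ) (fc ξ))
    {c₀ : ℝ} (hc₀ : 0 ≤ c₀) (hbdd : ∀ᵐ ω ∂P, ∀ x, fc (past ε 0 ω) x ≤ c₀)
    {δ : ℝ} (hδ : 0 < δ) {l t : ℝ} (hl0 : 0 < l) (hl : l ≤ 1) (hlt : 2 ≤ l * t) (n : ℕ) :
    P (gridEvent P g ε n δ t) ≤ ENNReal.ofReal
      (16 * n * (n + 2) ^ 2 * Real.exp (2 * l ^ 2 * (c₀ * ((n + 1) * δ)) * n - l * t)) := by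
  have := hiid.isProbabilityMeasure_innovLaw
  have := hiid.isProbabilityMeasure_pastLaw
  have : IsProbabilityMeasure (P.map (process g ε 0)) :=
    Measure.isProbabilityMeasure_map (hiid.measurable_process hg 0).aemeasurable
  set q : ℝ := c₀ * ((n + 1) * δ)
  set c : ℝ := 16 * n * Real.exp (2 * l ^ 2 * q * n - l * t)
  have hc : 0 ≤ c := by positivity
  have hone : ∀ k ∈ Finset.range (n + 2), ∀ j : ℤ,
      P {ω | t ≤ |visitMart P g ε n (gridIoc δ j k) ω|} ≤
        ENNReal.ofReal c * (P.map (process g ε 0)) (gridIoc δ j k) := by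
    intro k hk j
    have hk' : (k : ℝ) ≤ n + 1 := by
      have : k ≤ n + 1 := by simpa [Nat.lt_succ_iff] using hk
      exact_mod_cast this
    have hI := measurableSet_gridIoc δ j k
    have hm := measurable_runSum (measurable_centredInd (ν := innovLaw P ε) (hg hI)) n
    have hab : (j : ℝ) * δ ≤ (j + k) * δ := by gcongr; simp
    have hq := (hiid.nextProb_Ioc_le hg hfc hbdd hab).mono fun ξ hξ => hξ.trans
      (show _ ≤ q by
        refine mul_le_mul_of_nonneg_left ?_ hc₀
        nlinarith)
    have h1 := measure_le_abs_runSum hiid.historyLaw (hg hI) (by positivity) hq hl0 hl hlt n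
    rw [hiid.map_process hg, Measure.map_apply hg hI]
    refine le_trans (le_of_eq ?_) h1
    rw [← hiid.map_past n, Measure.map_apply (hiid.measurable_past n)
      (measurableSet_le measurable_const hm.abs)]
    simp only [visitMart_eq_runSum]
    rfl
  calc P (gridEvent P g ε n δ t)
      ≤ ∑ k ∈ Finset.range (n + 2), P (⋃ j : ℤ,
          {ω | t ≤ |visitMart P g ε n (gridIoc δ j k) ω|}) := measure_biUnion_finset_le _ _
    _ ≤ ∑ k ∈ Finset.range (n + 2), ENNReal.ofReal c * (n + 2 : ℕ) := by
        refine Finset.sum_le_sum fun k hk => ?_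
        refine (measure_iUnion_le _).trans ((ENNReal.tsum_le_tsum (hone k hk)).trans ?_)
        rw [ENNReal.tsum_mul_left]
        refine mul_le_mul_right ((tsum_measure_gridIoc_le δ k).trans ?_) _
        exact_mod_cast (Finset.mem_range.1 hk).le
    _ = _ := by
        rw [Finset.sum_const, Finset.card_range, nsmul_eq_mul, ← ENNReal.ofReal_natCast,
          ← ENNReal.ofReal_mul hc, ← ENNReal.ofReal_mul (by positivity)]
        congr 1
        push_cast
        simp only [c]; ring

/-- Borel-Cantelli. The condition `log n = O(n b_n)` is what lets the exponential parameter, of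
order `√(log n / (n b_n))`, stay below 1. -/
lemma IsIID.ae_eventually_visitMart_le (hiid : IsIID P ε ε') (hg : Measurable g)
    {fc : (ℕ → ℝ) → ℝ → ℝ}
    (hfc : ∀ᵐ ξ ∂(P.map (past ε 0)), IsDensity (condLaw P g ε 1 ξ) (fc ξ))
    {c₀ : ℝ} (hc₀ : 0 ≤ c₀) (hbdd : ∀ᵐ ω ∂P, ∀ x, fc (past ε 0 ω) x ≤ c₀)
    {b : ℕ → ℝ} (hb_pos : ∀ n, 1 ≤ n → 0 < b n)
    (hb_log : (fun n : ℕ => Real.log n) =O[atTop] fun n : ℕ => (n : ℝ) * b n) :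
    ∃ K, 0 ≤ K ∧ ∀ᵐ ω ∂P, ∀ᶠ n in atTop, ∀ (j : ℤ) (l : ℕ), l ≤ n + 1 →
      |visitMart P g ε n (gridIoc (b n / n) j l) ω| ≤ K * √(n * b n * Real.log n) := by
  obtain ⟨C, hC, hCb⟩ := hb_log.exists_pos
  have hCb' := hCb.bound
  set s := √(max C 1) with hs
  have hmax : 1 ≤ max C 1 := le_max_right _ _
  have hs1 : 1 ≤ s := Real.one_le_sqrt.2 hmax
  have hss : s ^ 2 = max C 1 := Real.sq_sqrt (by linarith)
  -- Chosen so that the linear part of the exponent is `(4 c₀ + 5) log n`. The variance part is at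
  -- most `4 c₀ log n`, which leaves `n⁻⁵` against a prefactor of at most `64 n³`.
  set K := (4 * c₀ + 5) * s with hK
  refine ⟨K, by positivity, ?_⟩
  obtain ⟨n₀, hn₀⟩ := eventually_atTop.1 hCb'
  -- The events are emptied for small `n`, where `log n ≤ C n b_n` may fail, so that the bound holds
  -- for every `n`.
  set B : ℕ → Set Ω := fun n => if n₀ + 2 ≤ n then
    gridEvent P g ε n (b n / n) (K * √(n * b n * Real.log n)) else ∅ with hB
  have hPB : ∀ n, P (B n) ≤ ENNReal.ofReal (64 * (1 / (n : ℝ) ^ 2)) := by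
    intro n
    simp only [hB]
    split_ifs with hn
    · have hnR : (2 : ℝ) ≤ n := by exact_mod_cast (by omega : 2 ≤ n)
      have hn0 : (0 : ℝ) < n := by linarith
      have hbn := hb_pos n (by omega)
      have hlog : 0.69 < Real.log n :=
        lt_of_lt_of_le (lt_trans (by norm_num) Real.log_two_gt_d9)
          (Real.log_le_log two_pos hnR)
      have hlog0 : 0 < Real.log n := by linarith
      have hnb : 0 < n * b n := by positivity
      have h1 := hn₀ n (by omega)
      rw [Real.norm_of_nonneg hlog0.le, Real.norm_of_nonneg hnb.le] at h1
      have h2 : Real.log n ≤ s ^ 2 * (n * b n) := by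
        rw [hss]
        exact h1.trans (mul_le_mul_of_nonneg_right (le_max_left _ _) hnb.le)
      set r := √(Real.log n / (n * b n)) with hr
      have hr0 : 0 < r := Real.sqrt_pos.2 (by positivity)
      have hr2 : r ^ 2 = Real.log n / (n * b n) := Real.sq_sqrt (by positivity)
      have hrs : r ≤ s := by
        refine abs_le_of_sq_le_sq' ?_ (by linarith) |>.2
        rw [hr2, div_le_iff₀ hnb]; exact h2
      have hrt : r * √(n * b n * Real.log n) = Real.log n := by
        rw [hr, ← Real.sqrt_mul (by positivity), div_mul_eq_mul_div, mul_comm (n * b n) (Real.log n),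
          ← mul_assoc, mul_div_assoc, div_self hnb.ne', mul_one, Real.sqrt_mul_self hlog0.le]
      have hlt : s⁻¹ * r * (K * √(n * b n * Real.log n)) = (4 * c₀ + 5) * Real.log n := by
        have : s⁻¹ * r * (K * √(n * b n * Real.log n)) =
            (s⁻¹ * s) * (4 * c₀ + 5) * (r * √(n * b n * Real.log n)) := by rw [hK]; ring
        rw [this, hrt, inv_mul_cancel₀ (by linarith), one_mul]
      have hl0 : 0 < s⁻¹ * r := by positivity
      have hl1 : s⁻¹ * r ≤ 1 := by rw [inv_mul_le_iff₀ (by linarith)]; linarith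
      refine (hiid.measure_gridEvent_le hg hfc hc₀ hbdd (div_pos hbn hn0) hl0 hl1
        (by rw [hlt]; nlinarith) n).trans (ENNReal.ofReal_le_ofReal ?_)
      rw [hlt]
      have he : 2 * (s⁻¹ * r) ^ 2 * (c₀ * ((n + 1) * (b n / n))) * n ≤ 4 * c₀ * Real.log n := by
        have e1 : (s⁻¹ * r) ^ 2 ≤ r ^ 2 :=
          pow_le_pow_left₀ hl0.le (mul_le_of_le_one_left hr0.le (inv_le_one_of_one_le₀ hs1)) 2
        have e2 : (n + 1) * (b n / n) * n = (n + 1) * b n := by field_simp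
        have e3 : ((n : ℝ) + 1) * b n ≤ 2 * (n * b n) := by nlinarith
        calc 2 * (s⁻¹ * r) ^ 2 * (c₀ * ((n + 1) * (b n / n))) * n
            = 2 * (s⁻¹ * r) ^ 2 * c₀ * ((n + 1) * (b n / n) * n) := by ring
          _ ≤ 2 * r ^ 2 * c₀ * (2 * (n * b n)) := by rw [e2]; gcongr
          _ = 4 * c₀ * (r ^ 2 * (n * b n)) := by ring
          _ = _ := by rw [hr2, div_mul_cancel₀ _ hnb.ne']
      have hexp : Real.exp (2 * (s⁻¹ * r) ^ 2 * (c₀ * ((n + 1) * (b n / n))) * n -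
          (4 * c₀ + 5) * Real.log n) ≤ ((n : ℝ) ^ 5)⁻¹ := by
        rw [← Real.exp_log (inv_pos.2 (pow_pos hn0 5)), Real.log_inv, Real.log_pow]
        refine Real.exp_le_exp.2 ?_
        push_cast
        linarith
      calc 16 * n * (n + 2) ^ 2 * Real.exp (2 * (s⁻¹ * r) ^ 2 * (c₀ * ((n + 1) * (b n / n))) * n -
          (4 * c₀ + 5) * Real.log n) ≤ 16 * n * (2 * n) ^ 2 * ((n : ℝ) ^ 5)⁻¹ := by
            gcongr; linarith
        _ = _ := by field_simp; norm_num
    · simp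
  have hsum : ∑' n, P (B n) ≠ ∞ := by
    refine ne_top_of_le_ne_top ?_ (ENNReal.tsum_le_tsum hPB)
    exact ((Real.summable_one_div_nat_pow.2 one_lt_two).mul_left 64).tsum_ofReal_ne_top
  filter_upwards [ae_eventually_notMem hsum] with ω hω
  filter_upwards [hω, eventually_ge_atTop (n₀ + 2)] with n hn hn2 j l hl
  by_contra hcon
  refine hn ?_
  simp only [hB, if_pos hn2, gridEvent, Set.mem_iUnion]
  exact ⟨l, Finset.mem_range.2 (by omega), j, (not_le.1 hcon).le⟩

end Martingale

/-! ### Increments of the empirical process -/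

/-- Every interval of length at most `n δ` lies between two grid intervals of at most `n + 1` cells
which differ from it by at most two cells. -/
lemma exists_gridIoc_sandwich {δ : ℝ} (hδ : 0 < δ) {n : ℕ} {x y : ℝ} (hxy : x < y)
    (hyx : y - x ≤ n * δ) :
    ∃ (j j' : ℤ) (l l' : ℕ), l ≤ n + 1 ∧ l' ≤ n + 1 ∧
      gridIoc δ j' l' ⊆ Set.Ioc x y ∧ Set.Ioc x y ⊆ gridIoc δ j l ∧
      ∃ k k' : ℤ, gridIoc δ j l ⊆ Set.Ioc x y ∪ (gridIoc δ k 1 ∪ gridIoc δ k' 1) ∧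
        Set.Ioc x y ⊆ gridIoc δ j' l' ∪ (gridIoc δ k 1 ∪ gridIoc δ k' 1) := by
  set j := ⌊x / δ⌋ with hj
  set m := ⌊y / δ⌋ with hm
  have hjx : (j : ℝ) * δ ≤ x := (le_div_iff₀ hδ).1 (Int.floor_le _)
  have hxj : x < (j + 1) * δ := (div_lt_iff₀ hδ).1 (Int.lt_floor_add_one _)
  have hmy : (m : ℝ) * δ ≤ y := (le_div_iff₀ hδ).1 (Int.floor_le _)
  have hym : y < (m + 1) * δ := (div_lt_iff₀ hδ).1 (Int.lt_floor_add_one _)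
  have hjm : j ≤ m := Int.floor_le_floor (by gcongr)
  have hmj : m ≤ j + n := by
    have : (m : ℝ) < j + 1 + n := by
      by_contra hcon
      have := mul_le_mul_of_nonneg_right (not_lt.1 hcon) hδ.le
      nlinarith
    have h2 : m < j + 1 + n := by exact_mod_cast this
    omega
  have hl : ((j : ℝ) + ((m + 1 - j).toNat : ℕ)) = m + 1 := by
    have : ((m + 1 - j).toNat : ℤ) = m + 1 - j := Int.toNat_of_nonneg (by omega)
    have h2 : (((m + 1 - j).toNat : ℕ) : ℝ) = m + 1 - j := by exact_mod_cast this
    rw [h2]; ring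
  -- The outer interval runs from cell `j` of `x` through cell `m` of `y`; the inner one omits both
  -- end cells. If `x` and `y` share a cell, `toNat` truncates the inner length to 0.
  refine ⟨j, j + 1, (m + 1 - j).toNat, (m - j - 1).toNat, by omega, by omega, ?_, ?_, j, m, ?_, ?_⟩
  · rcases hjm.eq_or_lt with h | h
    · have : (m - j - 1).toNat = 0 := by omega
      rw [this]; simp [gridIoc]
    · have h1 : ((m - j - 1).toNat : ℤ) = m - j - 1 := Int.toNat_of_nonneg (by omega)
      have h2 : (((m - j - 1).toNat : ℕ) : ℝ) = m - j - 1 := by exact_mod_cast h1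
      intro z hz
      simp only [gridIoc, h2, Set.mem_Ioc] at hz ⊢
      push_cast at hz
      constructor <;> nlinarith
  · intro z hz
    simp only [gridIoc, hl, Set.mem_Ioc] at hz ⊢
    constructor <;> linarith
  · intro z hz
    simp only [gridIoc, hl, Set.mem_Ioc, Set.mem_union, Nat.cast_one] at hz ⊢
    rcases le_or_gt z x with h | h
    · right; left; constructor <;> linarith
    · rcases le_or_gt z y with h' | h'
      · left; exact ⟨h, h'⟩
      · right; right; constructor <;> linarith
  · intro z hz
    simp only [gridIoc, Set.mem_Ioc, Set.mem_union, Nat.cast_one] at hz ⊢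
    rcases le_or_gt z ((j + 1) * δ) with h | h
    · right; left; constructor <;> linarith
    · rcases le_or_gt z (m * δ) with h' | h'
      · left
        have hlt : (j : ℝ) + 1 < m := by
          by_contra hcon
          nlinarith [mul_le_mul_of_nonneg_right (not_lt.1 hcon) hδ.le]
        have hlt' : j + 1 < m := by exact_mod_cast hlt
        have h1 : ((m - j - 1).toNat : ℤ) = m - j - 1 := Int.toNat_of_nonneg (by omega)
        have h2 : (((m - j - 1).toNat : ℕ) : ℝ) = m - j - 1 := by exact_mod_cast h1
        rw [h2]
        push_cast
        constructor <;> nlinarith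
      · right; right; constructor <;> linarith

section Oscillation

variable {Ω : Type*} [MeasurableSpace Ω] {P : Measure Ω} [IsProbabilityMeasure P]
  {ε : ℤ → Ω → ℝ} {ε' : Ω → ℝ} {g : (ℕ → ℝ) → ℝ}

/-- The predictable part of the centred number of visits to `I` up to time `n`. -/
noncomputable def visitDrift (P : Measure Ω) (g : (ℕ → ℝ) → ℝ) (ε : ℤ → Ω → ℝ) (n : ℕ)
    (I : Set ℝ) (ω : Ω) : ℝ :=
  ∑ i ∈ Finset.range n, (nextProb (innovLaw P ε) (g ⁻¹' I) (past ε i ω) -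
    (P.map (process g ε 0)).real I)

/-- The number of visits to `I` up to time `n`. -/
noncomputable def visits (g : (ℕ → ℝ) → ℝ) (ε : ℤ → Ω → ℝ) (n : ℕ) (I : Set ℝ) (ω : Ω) : ℝ :=
  ∑ i ∈ Finset.range n, I.indicator (fun _ => (1 : ℝ)) (process g ε (i + 1) ω)

lemma visits_eq (n : ℕ) (I : Set ℝ) (ω : Ω) :
    visits g ε n I ω = visitMart P g ε n I ω + visitDrift P g ε n I ω +
      n * (P.map (process g ε 0)).real I := by
  simp only [visits, visitMart, visitDrift, Finset.sum_sub_distrib, Finset.sum_const,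
    Finset.card_range, nsmul_eq_mul]
  ring

lemma visits_mono {I J : Set ℝ} (hIJ : I ⊆ J) (n : ℕ) (ω : Ω) :
    visits g ε n I ω ≤ visits g ε n J ω :=
  Finset.sum_le_sum fun _ _ => Set.indicator_le_indicator_of_subset hIJ (fun _ => zero_le_one) _

/-- The exceptional set is the one outside which every `ξ_i` has a conditional density; it depends
neither on `n` nor on the interval, so the Sobolev bound holds for all intervals at once. -/
lemma IsIID.ae_visitDrift_le (hiid : IsIID P ε ε') (hg : Measurable g)
    {f : ℝ → ℝ} (hf : IsDensity (P.map (process g ε 0)) f) {fc : (ℕ → ℝ) → ℝ → ℝ}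
    (hfc : ∀ᵐ ξ ∂(P.map (past ε 0)), IsDensity (condLaw P g ε 1 ξ) (fc ξ)) :
    ∀ᵐ ω ∂P, ∀ n, energy P g ε n ω ≠ ∞ → ∀ a b : ℝ, a ≤ b →
      |visitDrift P g ε n (Set.Ioc a b) ω| ≤ (b - a) * √(energy P g ε n ω).toReal := by
  have := hiid.isProbabilityMeasure_innovLaw
  have := hiid.isProbabilityMeasure_pastLaw
  have : IsProbabilityMeasure (P.map (process g ε 0)) :=
    Measure.isProbabilityMeasure_map (hiid.measurable_process hg 0).aemeasurable
  have hall : ∀ᵐ ω ∂P, ∀ i : ℕ,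
      IsDensity (futureLaw (innovLaw P ε) hg 1 (past ε i ω)) (fc (past ε i ω)) := by
    rw [ae_all_iff]
    intro i
    filter_upwards [(hiid.measurePreserving_past i).quasiMeasurePreserving.ae hfc,
      (hiid.measurePreserving_past i).quasiMeasurePreserving.ae (hiid.condLaw_ae_eq hg 1)]
      with ω h1 h2
    rwa [h2] at h1
  filter_upwards [hall] with ω hω n hE a b hab
  have hlaw : ∀ θ, charFun (P.map (process g ε 0)) θ = ∫ ξ, expFun g θ ξ ∂(pastLaw P ε) := by
    intro θ
    rw [charFun_apply_real, hiid.map_process hg, integral_map hg.aemeasurable (by fun_prop)]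
    rfl
  have hcs : ∀ θ, ∑ i ∈ Finset.range n, (charFun (futureLaw (innovLaw P ε) hg 1 (past ε i ω)) θ -
      charFun (P.map (process g ε 0)) θ) = charSum P g ε n θ ω := by
    intro θ
    simp only [charFun_futureLaw, hlaw]
    rfl
  have key := abs_sum_real_Ioc_sub_le (κ := fun i : ℕ => futureLaw (innovLaw P ε) hg 1 (past ε i ω))
    (u := fun i => fc (past ε i ω)) hω hf n (by simp only [hcs]; exact hE) hab
  simp only [hcs, futureLaw_one_real hg measurableSet_Ioc] at key
  exact key

lemma IsIID.empDev_sub (hiid : IsIID P ε ε') (hg : Measurable g) (n : ℕ) (ω : Ω) {x y : ℝ}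
    (hxy : x ≤ y) :
    empDev P g ε n ω y - empDev P g ε n ω x = (√n)⁻¹ * (visits g ε n (Set.Ioc x y) ω -
      n * (P.map (process g ε 0)).real (Set.Ioc x y)) := by
  have : IsProbabilityMeasure (P.map (process g ε 0)) :=
    Measure.isProbabilityMeasure_map (hiid.measurable_process hg 0).aemeasurable
  rcases n.eq_zero_or_pos with rfl | hn
  · simp [empDev]
  have hemp : ∀ z, empFun g ε n ω z = (n : ℝ)⁻¹ * visits g ε n (Set.Iic z) ω := by
    intro z
    have h1 := Finset.sum_Ico_add' (fun i : ℕ =>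
      (Set.Iic z).indicator (fun _ => (1 : ℝ)) (process g ε i ω)) 0 n 1
    have h2 : Finset.Icc 1 n = Finset.Ico (0 + 1) (n + 1) := by ext i; simp
    rw [empFun, visits, h2, ← h1, Finset.range_eq_Ico]
    simp only [Nat.cast_add, Nat.cast_one]
  have hvis : visits g ε n (Set.Iic y) ω - visits g ε n (Set.Iic x) ω =
      visits g ε n (Set.Ioc x y) ω := by
    rw [visits, visits, ← Finset.sum_sub_distrib]
    refine Finset.sum_congr rfl fun i _ => ?_
    set z := process g ε (i + 1) ω
    by_cases h1 : z ≤ x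
    · have h2 := h1.trans hxy
      simp [h1, h2, Set.indicator, not_lt.2 h1]
    · by_cases h2 : z ≤ y <;> simp [h1, h2, Set.indicator, not_le.1 h1]
  have hcdf : distFun P g ε y - distFun P g ε x =
      (P.map (process g ε 0)).real (Set.Ioc x y) := by
    rw [distFun, distFun, cdf_eq_real, cdf_eq_real, ← measureReal_sdiff (Set.Iic_subset_Iic.2 hxy)
      measurableSet_Iic, Set.Iic_sdiff_Iic]
  have hs : √(n : ℝ) * √n = n := Real.mul_self_sqrt (Nat.cast_nonneg n)
  have hs0 : 0 < √(n : ℝ) := Real.sqrt_pos.2 (by exact_mod_cast hn)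
  have hn0 : (n : ℝ)⁻¹ = (√n)⁻¹ * (√n)⁻¹ := by rw [← mul_inv, hs]
  calc empDev P g ε n ω y - empDev P g ε n ω x
      = √n * ((n : ℝ)⁻¹ * (visits g ε n (Set.Iic y) ω - visits g ε n (Set.Iic x) ω) -
        (distFun P g ε y - distFun P g ε x)) := by rw [empDev, empDev, hemp, hemp]; ring
    _ = _ := by
        rw [hvis, hcdf, hn0]
        generalize √(n : ℝ) = s at hs hs0
        rw [← hs]
        field_simp

/-- Pathwise bound for an increment of the empirical process. -/
lemma IsIID.abs_empDev_sub_le (hiid : IsIID P ε ε') (hg : Measurable g) {n : ℕ} (hn : 1 ≤ n)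
    {c₀ b M E : ℝ} (hb : 0 < b) (hE : 0 ≤ E)
    (hlaw : ∀ a c : ℝ, a ≤ c → (P.map (process g ε 0)).real (Set.Ioc a c) ≤ c₀ * (c - a)) {ω : Ω}
    (hM : ∀ (j : ℤ) (l : ℕ), l ≤ n + 1 → |visitMart P g ε n (gridIoc (b / n) j l) ω| ≤ M)
    (hD : ∀ a c : ℝ, a ≤ c → |visitDrift P g ε n (Set.Ioc a c) ω| ≤ (c - a) * E)
    {x y : ℝ} (hxy : x < y) (hyx : y - x ≤ b) :
    |empDev P g ε n ω y - empDev P g ε n ω x| ≤ (√n)⁻¹ * (M + 2 * b * E + 2 * c₀ * b) := by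
  have : IsProbabilityMeasure (P.map (process g ε 0)) :=
    Measure.isProbabilityMeasure_map (hiid.measurable_process hg 0).aemeasurable
  set p := (P.map (process g ε 0)).real
  have hn0 : (0 : ℝ) < n := by exact_mod_cast hn
  have hn1 : (1 : ℝ) ≤ n := by exact_mod_cast hn
  set δ := b / n with hδdef
  have hδ : 0 < δ := div_pos hb hn0
  have hnδ : n * δ = b := by rw [hδdef]; field_simp
  obtain ⟨j, j', l, l', hl, hl', hin, hout, k, k', hou, hiu⟩ :=
    exists_gridIoc_sandwich hδ hxy (n := n) (by rw [hnδ]; exact hyx)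
  have hcell : ∀ i : ℤ, p (gridIoc δ i 1) ≤ c₀ * δ := by
    intro i
    refine (hlaw _ _ (by gcongr; simp)).trans (le_of_eq ?_)
    push_cast; ring
  have hun : ∀ I J : Set ℝ, J ⊆ I ∪ (gridIoc δ k 1 ∪ gridIoc δ k' 1) → p J ≤ p I + 2 * (c₀ * δ) := by
    intro I J h
    have h1 := (measureReal_mono (μ := P.map (process g ε 0)) h).trans (measureReal_union_le _ _)
    have h2 := measureReal_union_le (μ := P.map (process g ε 0)) (gridIoc δ k 1) (gridIoc δ k' 1)
    have h3 := hcell k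
    have h4 := hcell k'
    change p J ≤ p I + _ at h1
    change _ ≤ p _ + p _ at h2
    linarith
  -- The length is at most `(n + 1) b / n ≤ 2b`.
  have hdr : ∀ (i : ℤ) (r : ℕ), r ≤ n + 1 →
      |visitDrift P g ε n (gridIoc δ i r) ω| ≤ 2 * b * E := by
    intro i r hr
    refine (hD _ _ (by gcongr; simp)).trans (mul_le_mul_of_nonneg_right ?_ hE)
    have hr' : (r : ℝ) ≤ n + 1 := by exact_mod_cast hr
    nlinarith
  -- Counts are monotone in the interval, so those of the inner and outer grid intervals bracket the
  -- one of `(x, y]`. Replacing the law of the interval costs at most two cells, that is `n · 2 c₀ b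
  -- / n = 2 c₀ b`.
  have hO := visits_mono (g := g) (ε := ε) hout n ω
  have hI := visits_mono (g := g) (ε := ε) hin n ω
  rw [visits_eq (P := P) n (gridIoc δ j l)] at hO
  rw [visits_eq (P := P) n (gridIoc δ j' l')] at hI
  have a1 := abs_le.1 (hM j l hl)
  have a2 := abs_le.1 (hM j' l' hl')
  have a3 := abs_le.1 (hdr j l hl)
  have a4 := abs_le.1 (hdr j' l' hl')
  have a5 := mul_le_mul_of_nonneg_left (hun _ _ hou) hn0.le
  have a6 := mul_le_mul_of_nonneg_left (hun _ _ hiu) hn0.le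
  have a7 : (n : ℝ) * (2 * (c₀ * δ)) = 2 * c₀ * b := by rw [← hnδ]; ring
  rw [mul_add, a7] at a5 a6
  rw [hiid.empDev_sub hg n ω hxy.le, abs_mul, abs_of_nonneg (by positivity)]
  refine mul_le_mul_of_nonneg_left ?_ (by positivity)
  change |visits g ε n (Set.Ioc x y) ω - n * p (Set.Ioc x y)| ≤ _
  change _ ≤ _ + _ + n * p _ at hO
  change _ + _ + n * p _ ≤ _ at hI
  rw [abs_le]
  constructor <;> linarith

/-! ### Measurability of the modulus of continuity -/

section Measurability

lemma abs_empDev_le (n : ℕ) (ω : Ω) (x : ℝ) : |empDev P g ε n ω x| ≤ √n * 2 := by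
  have h1 : |empFun g ε n ω x| ≤ 1 := by
    rw [empFun, abs_mul, abs_of_nonneg (by positivity)]
    rcases n.eq_zero_or_pos with rfl | hn
    · simp
    rw [inv_mul_le_iff₀ (by exact_mod_cast hn), mul_one]
    refine (Finset.abs_sum_le_sum_abs _ _).trans ?_
    have : ∀ i ∈ Finset.Icc 1 n,
        |(Set.Iic x).indicator (fun _ => (1 : ℝ)) (process g ε i ω)| ≤ 1 := by
      intro i _
      by_cases h : process g ε i ω ∈ Set.Iic x <;> simp [h]
    refine (Finset.sum_le_sum this).trans ?_
    simp
  have h2 : |distFun P g ε x| ≤ 1 := by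
    rw [distFun, abs_of_nonneg (cdf_nonneg _ _)]; exact cdf_le_one _ _
  rw [empDev, abs_mul, abs_of_nonneg (Real.sqrt_nonneg _)]
  refine mul_le_mul_of_nonneg_left ((abs_sub _ _).trans (by linarith)) (Real.sqrt_nonneg _)

lemma bddAbove_empDev {ι : Type*} (n : ℕ) (ω : Ω) (u v : ι → ℝ) :
    BddAbove (Set.range fun i => |empDev P g ε n ω (u i) - empDev P g ε n ω (v i)|) := by
  refine ⟨√n * 2 + √n * 2, ?_⟩
  rintro _ ⟨i, rfl⟩
  exact (abs_sub _ _).trans (add_le_add (abs_empDev_le n ω _) (abs_empDev_le n ω _))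

lemma tendsto_empDev_right (n : ℕ) (ω : Ω) (x : ℝ) :
    Tendsto (empDev P g ε n ω) (𝓝[>] x) (𝓝 (empDev P g ε n ω x)) := by
  have hF : Tendsto (distFun P g ε) (𝓝[>] x) (𝓝 (distFun P g ε x)) :=
    ((cdf (P.map (process g ε 0))).right_continuous x).mono_left
      (nhdsWithin_mono _ Set.Ioi_subset_Ici_self)
  have hE : Tendsto (empFun g ε n ω) (𝓝[>] x) (𝓝 (empFun g ε n ω x)) := by
    refine Tendsto.const_mul _ (tendsto_finsetSum _ fun i _ => ?_)
    refine tendsto_const_nhds.congr' ?_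
    by_cases h : process g ε i ω ≤ x
    · filter_upwards [self_mem_nhdsWithin] with z hz
      simp [Set.indicator, h, h.trans (le_of_lt hz)]
    · filter_upwards [Ioo_mem_nhdsGT (not_le.1 h)] with z hz
      simp [Set.indicator, h, hz.2]
  exact (hE.sub hF).const_mul _

/-- Right continuity allows both endpoints to move slightly to the right. When `y - x = b`, the left
one has to move at least as far as the right one to keep the gap within `b`. -/
lemma exists_rat_empDev_close {b : ℝ} (hb : 0 < b) (n : ℕ) (ω : Ω) {x y : ℝ} (hxy : x ≤ y)
    (hyx : y - x ≤ b) {η : ℝ} (hη : 0 < η) :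
    ∃ p q : ℚ, |(p : ℝ) - q| ≤ b ∧ |empDev P g ε n ω x - empDev P g ε n ω p| ≤ η ∧
      |empDev P g ε n ω y - empDev P g ε n ω q| ≤ η := by
  have key : ∀ z, ∃ u > z, ∀ w ∈ Set.Ioo z u, |empDev P g ε n ω z - empDev P g ε n ω w| ≤ η := by
    intro z
    have h1 := (tendsto_empDev_right (P := P) (g := g) (ε := ε) n ω z).eventually
      (Metric.closedBall_mem_nhds _ hη)
    obtain ⟨u, hu, hsub⟩ := mem_nhdsGT_iff_exists_Ioo_subset.1 h1
    refine ⟨u, hu, fun w hw => ?_⟩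
    have := hsub hw
    rw [abs_sub_comm]
    exact this
  obtain ⟨u, hu, hux⟩ := key x
  obtain ⟨v, hv, hvy⟩ := key y
  -- The shift of `y` is kept below `u - x` and `b`, which leaves room for `p` between `q - b` and
  -- `u`.
  obtain ⟨q, hq1, hq2⟩ := exists_rat_btwn (show y < min v (y + min (u - x) b) by
    refine lt_min hv ?_
    have : 0 < min (u - x) b := lt_min (by linarith) hb
    linarith)
  have hqv := hq2.trans_le (min_le_left _ _)
  have hqb := hq2.trans_le (min_le_right _ _)
  have hm1 := min_le_left (u - x) b
  have hm2 := min_le_right (u - x) b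
  obtain ⟨p, hp1, hp2⟩ := exists_rat_btwn (show max x (q - b) < min u (x + b) by
    rw [max_lt_iff, lt_min_iff, lt_min_iff]
    refine ⟨⟨hu, by linarith⟩, by linarith, by linarith⟩)
  rw [max_lt_iff] at hp1
  rw [lt_min_iff] at hp2
  refine ⟨p, q, ?_, hux p ⟨hp1.1, hp2.1⟩, hvy q ⟨hq1, hqv⟩⟩
  rw [abs_le]
  constructor <;> linarith

/-- Reduces an uncountable supremum to a countable one, from which measurability follows. -/
lemma modulus_eq_iSup_rat {b : ℝ} (hb : 0 < b) (n : ℕ) (ω : Ω) :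
    modulus P g ε n b ω = ⨆ p : {p : ℚ × ℚ // |(p.1 : ℝ) - p.2| ≤ b},
      |empDev P g ε n ω p.1.1 - empDev P g ε n ω p.1.2| := by
  have : Nonempty {p : ℝ × ℝ // |p.1 - p.2| ≤ b} := ⟨⟨(0, 0), by simpa using hb.le⟩⟩
  have : Nonempty {p : ℚ × ℚ // |(p.1 : ℝ) - p.2| ≤ b} := ⟨⟨(0, 0), by simpa using hb.le⟩⟩
  have hbd := bddAbove_empDev (P := P) (g := g) (ε := ε) n ω
    (fun p : {p : ℚ × ℚ // |(p.1 : ℝ) - p.2| ≤ b} => (p.1.1 : ℝ)) (fun p => (p.1.2 : ℝ))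
  have main : ∀ x y : ℝ, x ≤ y → y - x ≤ b → |empDev P g ε n ω x - empDev P g ε n ω y| ≤
      ⨆ p : {p : ℚ × ℚ // |(p.1 : ℝ) - p.2| ≤ b},
        |empDev P g ε n ω p.1.1 - empDev P g ε n ω p.1.2| := by
    intro x y hxy hyx
    refine le_of_forall_pos_le_add fun η hη => ?_
    obtain ⟨p, q, hpq, h1, h2⟩ := exists_rat_empDev_close (P := P) (g := g) (ε := ε) hb n ω hxy hyx
      (half_pos hη)
    have h3 := le_ciSup hbd ⟨(p, q), hpq⟩
    dsimp only at h3
    have h4 : empDev P g ε n ω x - empDev P g ε n ω y =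
        (empDev P g ε n ω x - empDev P g ε n ω p) +
          (empDev P g ε n ω p - empDev P g ε n ω q) -
          (empDev P g ε n ω y - empDev P g ε n ω q) := by ring
    rw [h4]
    have h5 := abs_sub ((empDev P g ε n ω x - empDev P g ε n ω p) +
          (empDev P g ε n ω p - empDev P g ε n ω q)) (empDev P g ε n ω y - empDev P g ε n ω q)
    have h6 := abs_add_le (empDev P g ε n ω x - empDev P g ε n ω p)
      (empDev P g ε n ω p - empDev P g ε n ω q)
    linarith
  refine le_antisymm (ciSup_le ?_) (ciSup_le ?_)
  · rintro ⟨⟨x, y⟩, hp⟩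
    have hp' := abs_le.1 hp
    dsimp only at hp' ⊢
    rcases le_total x y with h | h
    · exact main x y h (by linarith)
    · rw [abs_sub_comm]; exact main y x h (by linarith)
  · rintro ⟨⟨p, q⟩, hpq⟩
    exact le_ciSup (bddAbove_empDev (P := P) (g := g) (ε := ε) n ω
      (fun r : {p : ℝ × ℝ // |p.1 - p.2| ≤ b} => r.1.1) (fun r => r.1.2)) ⟨((p : ℝ), (q : ℝ)), hpq⟩

lemma IsIID.measurable_empDev (hiid : IsIID P ε ε') (hg : Measurable g) (n : ℕ) (x : ℝ) :
    Measurable fun ω => empDev P g ε n ω x := by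
  refine Measurable.const_mul (Measurable.sub_const (Measurable.const_mul
    (Finset.measurable_fun_sum _ fun i _ => ?_) _) _) _
  exact (measurable_const.indicator measurableSet_Iic).comp (hiid.measurable_process hg i)

lemma IsIID.measurable_modulus (hiid : IsIID P ε ε') (hg : Measurable g) {n : ℕ} {b : ℝ}
    (hb : 1 ≤ n → 0 < b) : Measurable (modulus P g ε n b) := by
  rcases n.eq_zero_or_pos with rfl | hn
  -- At `n = 0` nothing is known about the sign of `b`, but the factor `√0` makes the modulus
  -- vanish.
  · have : modulus P g ε 0 b = fun _ => 0 := by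
      funext ω; simp [modulus, empDev]
    rw [this]; exact measurable_const
  · have : modulus P g ε n b = fun ω => ⨆ p : {p : ℚ × ℚ // |(p.1 : ℝ) - p.2| ≤ b},
        |empDev P g ε n ω p.1.1 - empDev P g ε n ω p.1.2| :=
      funext fun ω => modulus_eq_iSup_rat (hb hn) n ω
    rw [this]
    exact Measurable.iSup fun p => ((hiid.measurable_empDev hg n _).sub
      (hiid.measurable_empDev hg n _)).abs

lemma modulus_nonneg (n : ℕ) (b : ℝ) (ω : Ω) : 0 ≤ modulus P g ε n b ω :=
  Real.iSup_nonneg fun _ => abs_nonneg _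

end Measurability

end Oscillation

/-! ### Assembling the decomposition -/

/-- The oscillations of the empirical process are the sum of a term of order `√(b log n)`, from the
martingale part, and a term of order `o(b ι(n))`, from the drift. -/
lemma IsIID.exists_modulus_decomposition
    {Ω : Type*} [MeasurableSpace Ω] {P : Measure Ω} [IsProbabilityMeasure P]
    {ε : ℤ → Ω → ℝ} {ε' : Ω → ℝ} {g : (ℕ → ℝ) → ℝ} (hiid : IsIID P ε ε') (hg : Measurable g)
    {f : ℝ → ℝ} (hf : IsDensity (P.map (process g ε 0)) f) {fc : ℕ → (ℕ → ℝ) → ℝ → ℝ}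
    (hfc : ∀ k, 1 ≤ k → ∀ᵐ ξ ∂(P.map (past ε 0)), IsDensity (condLaw P g ε k ξ) (fc k ξ))
    {b : ℕ → ℝ} (hb_pos : ∀ n, 1 ≤ n → 0 < b n) (hb : Tendsto b atTop (𝓝 0))
    (hb_log : (fun n : ℕ => Real.log n) =O[atTop] fun n : ℕ => (n : ℝ) * b n)
    {c₀ : ℝ} (hc₀ : 0 < c₀) (hbdd : ∀ᵐ ω ∂P, ∀ x, fc 1 (past ε 0 ω) x ≤ c₀)
    (hsrd : ShortRange P g ε ε') :
    ∃ U V : ℕ → Ω → ℝ,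
      (∀ n, Measurable (U n)) ∧ (∀ n, Measurable (V n)) ∧
      (∀ n ω, modulus P g ε n (b n) ω = U n ω + V n ω) ∧
      IsBigOAS P U (fun n => √(b n * Real.log n)) ∧
      IsLittleOAS P V (fun n => b n * iota n) := by
  have hsum : shortRangeSum P g ε ε' ≠ ∞ := hsrd.ne
  have hfc1 := hfc 1 le_rfl
  obtain ⟨K, hK, hmart⟩ := hiid.ae_eventually_visitMart_le hg hfc1 hc₀.le hbdd hb_pos hb_log
  let V' : ℕ → Ω → ℝ := fun n ω =>
    2 * b n * ((√n)⁻¹ * √(energy P g ε n ω).toReal)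
  have hmod : ∀ n, Measurable (modulus P g ε n (b n)) := fun n =>
    hiid.measurable_modulus hg (hb_pos n)
  have hV' : ∀ n, Measurable (V' n) := fun n =>
    (((hiid.measurable_energy hg n).ennreal_toReal.sqrt).const_mul _).const_mul _
  -- Here `V'` is the drift's share of the increment bound. Truncation at the modulus makes `U =
  -- modulus - V` the positive part of `modulus - V'`, so an upper bound on the modulus is enough to
  -- control `U`.
  let V : ℕ → Ω → ℝ := fun n ω => min (modulus P g ε n (b n) ω) (V' n ω)
  have hV : ∀ n, Measurable (V n) := fun n => (hmod n).min (hV' n)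
  refine ⟨fun n ω => modulus P g ε n (b n) ω - V n ω, V,
    fun n => (hmod n).sub (hV n), hV, fun n ω => by ring, ?_, ?_⟩
  · filter_upwards [hmart, hiid.ae_visitDrift_le hg hf hfc1,
      hiid.ae_sqrt_energy_isLittleO hg hsum] with ω h1 h2 h3
    refine IsBigO.of_bound (K + 2 * c₀) ?_
    have hlog : ∀ᶠ n : ℕ in atTop, 1 ≤ Real.log n :=
      (Real.tendsto_log_atTop.comp tendsto_natCast_atTop_atTop).eventually_ge_atTop 1
    filter_upwards [h1, eventually_ge_atTop 1, hb.eventually_le_const one_pos, hlog]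
      with n hM hn hb1 hl
    have hbn := hb_pos n hn
    have hn1 : (1 : ℝ) ≤ n := by exact_mod_cast hn
    have hs1 : 1 ≤ √(n : ℝ) := Real.one_le_sqrt.2 hn1
    set E := √(energy P g ε n ω).toReal with hEdef
    have hinc : ∀ x y : ℝ, x < y → y - x ≤ b n →
        |empDev P g ε n ω y - empDev P g ε n ω x| ≤
          (√n)⁻¹ * (K * √(n * b n * Real.log n) + 2 * b n * E + 2 * c₀ * b n) := fun x y hxy hyx =>
      hiid.abs_empDev_sub_le hg hn hbn (Real.sqrt_nonneg _)
        (fun a c hac => hiid.real_map_process_Ioc_le hg hfc1 hbdd hac) hM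
        (h2 n (h3.1 n)) hxy hyx
    have hR : (√n)⁻¹ * (K * √(n * b n * Real.log n) + 2 * b n * E + 2 * c₀ * b n) ≤
        (K + 2 * c₀) * √(b n * Real.log n) + V' n ω := by
      have e1 : √(n * b n * Real.log n) = √n * √(b n * Real.log n) := by
        rw [mul_assoc, Real.sqrt_mul (by positivity)]
      -- Since eventually `b n ≤ 1 ≤ log n`; this absorbs the discretisation error `2 c₀ b n`.
      have e2 : b n ≤ √(b n * Real.log n) := Real.le_sqrt_of_sq_le (by nlinarith)
      have e3 : (√n)⁻¹ * (2 * c₀ * b n) ≤ 2 * c₀ * √(b n * Real.log n) :=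
        (mul_le_of_le_one_left (by positivity) (inv_le_one_of_one_le₀ hs1)).trans (by gcongr)
      have e4 : (√n)⁻¹ * (K * √(n * b n * Real.log n)) = K * √(b n * Real.log n) := by
        rw [e1]; field_simp
      have e5 : (√n)⁻¹ * (2 * b n * E) = V' n ω := by simp only [V', hEdef]; ring
      rw [mul_add, mul_add, e4, e5]
      linarith
    have hle : modulus P g ε n (b n) ω ≤
        (K + 2 * c₀) * √(b n * Real.log n) + V' n ω := by
      have : Nonempty {p : ℝ × ℝ // |p.1 - p.2| ≤ b n} := ⟨⟨(0, 0), by simpa using hbn.le⟩⟩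
      refine ciSup_le ?_
      rintro ⟨⟨x, y⟩, hp⟩
      have hp' := abs_le.1 hp
      dsimp only at hp' ⊢
      refine le_trans ?_ hR
      rcases lt_trichotomy x y with h | h | h
      · rw [abs_sub_comm]; exact hinc x y h (by linarith)
      · rw [h, sub_self, abs_zero]; positivity
      · exact hinc y x h (by linarith)
    have hVle : V n ω ≤ modulus P g ε n (b n) ω := min_le_left _ _
    rw [Real.norm_of_nonneg (sub_nonneg.2 hVle), Real.norm_of_nonneg (Real.sqrt_nonneg _)]
    rcases min_choice (modulus P g ε n (b n) ω) (V' n ω) with h | h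
    · simp only [V, h, sub_self]; positivity
    · simp only [V, h]; linarith
  · filter_upwards [hiid.ae_sqrt_energy_isLittleO hg hsum] with ω h3
    rw [isLittleO_iff]
    intro c hc
    -- Half of `c` compensates the factor 2 in `V'`.
    filter_upwards [(isLittleO_iff.1 h3.2) (half_pos hc), eventually_ge_atTop 1] with n h4 hn
    have hbn := hb_pos n hn
    have hs0 : 0 < √(n : ℝ) := Real.sqrt_pos.2 (by exact_mod_cast hn)
    have hV'0 : 0 ≤ V' n ω := by positivity
    rw [Real.norm_of_nonneg (Real.sqrt_nonneg _), norm_mul, Real.norm_of_nonneg hs0.le] at h4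
    rw [Real.norm_of_nonneg (le_min (modulus_nonneg n _ ω) hV'0), norm_mul,
      Real.norm_of_nonneg hbn.le]
    refine (min_le_right _ _).trans ?_
    calc V' n ω ≤ 2 * b n * ((√n)⁻¹ * (c / 2 * (√n * ‖iota n‖))) := by
          simp only [V']; gcongr
      _ = _ := by field_simp

end CausalProcess

theorem theorem2p1 {Ω : Type*} [MeasurableSpace Ω] (P : Measure Ω) [IsProbabilityMeasure P]
    (ε : ℤ → Ω → ℝ) (ε' : Ω → ℝ) (hiid : CausalProcess.IsIID P ε ε')
    (g : (ℕ → ℝ) → ℝ) (hg : Measurable g)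
    -- `F` has a square integrable density `f` with square integrable derivative `f'`
    (f f' : ℝ → ℝ)
    (hf : CausalProcess.IsDensity (P.map (CausalProcess.process g ε 0)) f)
    (hf' : CausalProcess.HasSqIntegrableDeriv f f')
    -- conditional densities `fc k ξ x = f_k(x | ξ_0 = ξ)`
    (fc : ℕ → (ℕ → ℝ) → ℝ → ℝ)
    (hfc : ∀ k, 1 ≤ k → ∀ᵐ ξ ∂(P.map (CausalProcess.past ε 0)),
      CausalProcess.IsDensity (CausalProcess.condLaw P g ε k ξ) (fc k ξ))
    -- the bandwidths
    (b : ℕ → ℝ) (hb_pos : ∀ n, 1 ≤ n → 0 < b n) (hb : Tendsto b atTop (𝓝 0))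
    (hb_log : (fun n : ℕ => Real.log n) =O[atTop] fun n : ℕ => (n : ℝ) * b n)
    (c₀ : ℝ) (hc₀ : 0 < c₀)
    (hbdd : ∀ᵐ ω ∂P, ∀ x, fc 1 (CausalProcess.past ε 0 ω) x ≤ c₀)
    (hsrd : CausalProcess.ShortRange P g ε ε') :
    ∃ U V : ℕ → Ω → ℝ,
      (∀ n, Measurable (U n)) ∧ (∀ n, Measurable (V n)) ∧
      (∀ n ω, CausalProcess.modulus P g ε n (b n) ω = U n ω + V n ω) ∧
      CausalProcess.IsBigOAS P U (fun n => √(b n * Real.log n)) ∧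
      CausalProcess.IsLittleOAS P V (fun n => b n * CausalProcess.iota n) :=
  hiid.exists_modulus_decomposition hg hf hfc hb_pos hb hb_log hc₀ hbdd hsrd
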